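/- Let $n\in\{2,3\}$, let $\Omega\subset\mathbb R^n$ be open and bounded (for instance a bounded Lipschitz domain), and let $V_h\subset H^1_0(\Omega)$ be a finite-dimensional subspace (all spaces complexified) with norm $\|v\|_{V_h}^2=\|\nabla v\|_{L^2}^2+\kappa\|v\|_{L^2}^2$, where $\kappa\in\{0,1\}$ is fixed (either of the usual $H^1_0$-norms). Let $V_h\subseteq H\subseteq V_h^\star$, where $H$ is $V_h$ with the $L^2(\Omega)$-norm and $V_h^\star$ carries the dual norm. Let $A_h=-\Delta:V_h\to V_h^\star$, $\langle A_hv,w\rangle=\int_\Omega\nabla v\cdot\overline{\nabla w}$; let $\Pi_h$ and $Q_h$ be the $L^2(\Omega)$- and the $H^1(\Omega)$-orthogonal projections onto $V_h$. Write $\widehat g(s)=\int_0^\infty e^{-st}g(t)\,dt$, $\ \|g\|_{\mathscr H^2_\alpha(X)}^2=\sup_{\sigma>\alpha}\int_{\mathbb R}\|g(\sigma+\imath\tau)\|_X^2\frac{d\tau}{2\pi}$, and $g\in L^2_\alpha(\mathbb R_+;X)$ if $\int_0^\infty e^{-2\alpha t}\|g(t)\|_X^2\,dt<\infty$. For $0<d<\pi/2$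 let $\mathcal D_d=\{z\in\mathbb C:|\arg(z+\sqrt{1+z^2})|<d\}$, and let $\mathcal N_2(\mathcal D_d;X)$ be the space of analytic $F:\mathcal D_d\to X$ with $\|F\|_{\mathcal N_2(\mathcal D_d;X)}^2=\int_{\partial\mathcal D_d}\|F\|_X^2\,|dz|<\infty$, the boundary integral being understood in the Hardy-space sense as $\sup_{0<y<d}\int_{\partial\mathcal D_y}\|F\|_X^2\,|dz|$. For a function $g$ on $\mathbb R_+$, $\widehat g(\alpha+\imath\,\cdot)\in\mathcal N_2(\mathcal D_d;X)$ means that $z\mapsto\widehat g(\alpha+\imath z)$, $\operatorname{Im}z<0$, has an analytic extension to $\mathcal D_d$ which lies in that space; it is denoted by the same symbol. Let $\alpha\ge1$, $0<d<\pi/2$ and $C_0\in\mathbb R$. Let $f:\mathbb R_+\to V_h^\star$ satisfy $f\in L^2_\alpha(\mathbb R_+;V_h^\star)$, $\partial_tf\in L^2(\mathbb R_+;V_h^\star)$, $\widehat f(\alpha+\imath\,\cdot),\ \widehat{\partial_tf}(\alpha+\imath\,\cdot)\in\mathcal N_2(\mathcal D_d;V_h^\star)$, $f(0)\in H^1(\Omega)$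 (that is, the functional $f(0)\in V_h^\star$ is the $L^2$-pairing with a function in $H^1(\Omega)$, also denoted $f(0)$), and $$\|\widehat f(\alpha+\imath\tau)\|_{V_h^\star}+\|\widehat{\partial_tf}(\alpha+\imath\tau)\|_{V_h^\star}\le\frac{C_0}{\sqrt{1+\tau^2}},\qquad\tau\in\mathbb R .$$ Let $u_0\in H^2(\Omega)$, $u_{0,h}=Q_hu_0$, and let $u_h:[0,\infty)\to V_h$ solve $(\partial_t+A_h)u_h=f$ in $V_h^\star$ for a.e. $t>0$, $u_h(0)=u_{0,h}$. For a subspace $V_R\subset V_h$, with $\mathsf P_{V_R}$ the $V_h$-orthogonal projection onto $V_R$, put $$\varepsilon(V_R)=\|\widehat{u_h}-\mathsf P_{V_R}\widehat{u_h}\|_{\mathscr H^2_\alpha(V_h)}^2+\|\widehat{\partial_tu_h}-\widehat{\partial_t\mathsf P_{V_R}u_h}\|_{\mathscr H^2_\alpha(V_h^\star)}^2 .$$ Then there are a constant $C(d,\alpha)>0$ depending only on $d$ and $\alpha$, with $C(d,\alpha)\to\infty$ as $d\to\pi/2$, and a constant $c>0$ depending only on $n$, $\Omega$, $\kappa$ and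 $C_0$ such that for every integer $R\ge1$ $$\inf_{V_R\subset V_h,\ \dim V_R\le R}\varepsilon(V_R)\le c\,C(d,\alpha)\,R^{1/2}\exp\Big(-2\sqrt{\tfrac{\pi dR}{4}}\Big)\,\mathcal B,$$ $$\mathcal B=\|\widehat f(\alpha+\imath\,\cdot)\|_{\mathcal N_2(\mathcal D_d;V_h^\star)}^2+\|\widehat{\partial_tf}(\alpha+\imath\,\cdot)\|_{\mathcal N_2(\mathcal D_d;V_h^\star)}^2+1+\|\Pi_h(f(0))\|_{V_h}^2+\|\Pi_h(\Delta u_0)\|_{V_h}^2+\|u_{0,h}-\Pi_hu_0\|_{V_h}^2+\|u_0\|_{H^2(\Omega)}^2 .$$ Moreover, for $R=2K+2$ with an integer $K\ge1$, the bound holds for a space spanned by sinc-point solutions: with $\vartheta=\sqrt{2\pi d/K}$ and $s_k=\alpha+\imath\sinh(k\vartheta)$, the space $V_R=\operatorname{span}\{u_{0,h},\widehat u_h(s_{-K}),\dots,\widehat u_h(s_K)\}$, where $(s_k+A_h)\widehat u_h(s_k)=\widehat f(s_k)+u_{0,h}$ in $V_h^\star$, satisfies $\varepsilon(V_R)\le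 c\,C(d,\alpha)\,R^{1/2}\exp(-2\sqrt{\pi dR/4})\,\mathcal B$. -/

import Mathlib

open MeasureTheory Filter Topology Set
open scoped ENNReal ContDiff

noncomputable section

namespace LaplaceRB

/-! ### Sobolev spaces of complex-valued functions on an open set `Ω ⊆ ℝⁿ` -/

/-- Euclidean space `ℝⁿ`. -/
abbrev RSpace (n : ℕ) := EuclideanSpace ℝ (Fin n)

/-- `ℂⁿ` with its Hermitian norm (values of gradients). -/
abbrev CSpace (n : ℕ) := EuclideanSpace ℂ (Fin n)

/-- The Lebesgue space `L²(Ω; X)`. -/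
abbrev L2 {n : ℕ} (Ω : Set (RSpace n)) (X : Type) [NormedAddCommGroup X] :=
  Lp X 2 (volume.restrict Ω)

/-- `φ ∈ C_c^∞(Ω)`. -/
structure IsTestFunction {n : ℕ} (Ω : Set (RSpace n)) (φ : RSpace n → ℂ) : Prop where
  smooth : ContDiff ℝ ∞ φ
  compact : HasCompactSupport φ
  support : tsupport φ ⊆ Ω

/-- The classical partial derivative `∂_i φ`. -/
def partialDeriv {n : ℕ} (i : Fin n) (φ : RSpace n → ℂ) (x : RSpace n) : ℂ :=
  fderiv ℝ φ x (EuclideanSpace.single i 1)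

/-- `w` is the weak partial derivative `∂_i u` on `Ω`. -/
def HasWeakPartial {n : ℕ} (Ω : Set (RSpace n)) (i : Fin n) (u w : RSpace n → ℂ) : Prop :=
  ∀ φ : RSpace n → ℂ, IsTestFunction Ω φ →
    ∫ x in Ω, u x * partialDeriv i φ x = - ∫ x in Ω, w x * φ x

/-- An element of `H¹(Ω)`: a function in `L²(Ω)` with its weak gradient in `L²(Ω)ⁿ`. -/
structure H1 {n : ℕ} (Ω : Set (RSpace n)) where
  val : L2 Ω ℂ
  grad : L2 Ω (CSpace n)
  weak_grad : ∀ i, HasWeakPartial Ω i (fun x => val x) (fun x => grad x i)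

/-- An element of `H²(Ω)`: an element of `H¹(Ω)` with its weak Hessian in `L²(Ω)^{n × n}`. -/
structure H2 {n : ℕ} (Ω : Set (RSpace n)) extends H1 Ω where
  hess : L2 Ω (EuclideanSpace ℂ (Fin n × Fin n))
  weak_hess : ∀ i j, HasWeakPartial Ω j (fun x => grad x i) (fun x => hess x (i, j))

/-- The squared `H²(Ω)` norm. -/
def H2.normSq {n : ℕ} {Ω : Set (RSpace n)} (u : H2 Ω) : ℝ :=
  ‖u.val‖ ^ 2 + ‖u.grad‖ ^ 2 + ‖u.hess‖ ^ 2

/-- The Laplacian `Δu = ∑ i, ∂_i ∂_i u ∈ L²(Ω)` of `u ∈ H²(Ω)`. -/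
def H2.laplacian {n : ℕ} {Ω : Set (RSpace n)} (u : H2 Ω) : L2 Ω ℂ :=
  (∑ i : Fin n, (EuclideanSpace.proj (i, i) :
    EuclideanSpace ℂ (Fin n × Fin n) →L[ℂ] ℂ)).compLp u.hess

/-- `H¹₀(Ω)`, as the set of pairs `(v, ∇v)`: the closure of `{(φ, ∇φ) | φ ∈ C_c^∞(Ω)}` in
`L²(Ω) × L²(Ω)ⁿ`. -/
def H10 {n : ℕ} (Ω : Set (RSpace n)) : Set (L2 Ω ℂ × L2 Ω (CSpace n)) :=
  closure {p | ∃ φ : RSpace n → ℂ, IsTestFunction Ω φ ∧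
    (∀ᵐ x ∂(volume.restrict Ω), p.1 x = φ x) ∧
    (∀ᵐ x ∂(volume.restrict Ω), ∀ i, p.2 x i = partialDeriv i φ x)}

/-! ### The discrete space, its dual, and the discrete operators -/

/-- `V` is (a copy of) a subspace of `H¹₀(Ω)`: each `v : V` stands for the pair `emb v = (v, ∇v)`,
and the Hilbert norm of `V` is `‖v‖² = ‖∇v‖²_{L²} + κ ‖v‖²_{L²}`. The two usual meanings of the
`H¹₀(Ω)` norm are `κ = 0` and `κ = 1`. -/
structure DiscreteSpace {n : ℕ} (κ : ℝ) (Ω : Set (RSpace n)) (V : Type)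
    [NormedAddCommGroup V] [InnerProductSpace ℂ V] where
  emb : V →ₗ[ℂ] L2 Ω ℂ × L2 Ω (CSpace n)
  emb_mem : ∀ v, emb v ∈ H10 Ω
  norm_sq : ∀ v, ‖v‖ ^ 2 = ‖(emb v).2‖ ^ 2 + κ * ‖(emb v).1‖ ^ 2

/-- The dual `V⋆` of `V`: antilinear functionals with the dual (operator) norm. -/
abbrev AntiDual (V : Type) [NormedAddCommGroup V] [InnerProductSpace ℂ V] := V →L⋆[ℂ] ℂ

namespace DiscreteSpace

variable {n : ℕ} {κ : ℝ} {Ω : Set (RSpace n)} {V : Type}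
  [NormedAddCommGroup V] [InnerProductSpace ℂ V] [FiniteDimensional ℂ V]

/-- The functional `w ↦ ∫_Ω g w̄` in `V⋆`, for `g ∈ L²(Ω)`. -/
def l2Functional (S : DiscreteSpace κ Ω V) (g : L2 Ω ℂ) : AntiDual V :=
  (innerSLFlip ℂ g).comp
    (LinearMap.toContinuousLinearMap ((LinearMap.fst ℂ _ _).comp S.emb))

/-- The functional `w ↦ ∫_Ω g · ∇w̄` in `V⋆`, for `g ∈ L²(Ω)ⁿ`. -/
def gradFunctional (S : DiscreteSpace κ Ω V) (g : L2 Ω (CSpace n)) : AntiDual V :=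
  (innerSLFlip ℂ g).comp
    (LinearMap.toContinuousLinearMap ((LinearMap.snd ℂ _ _).comp S.emb))

/-- The embedding `V ⊆ H ⊆ V⋆` of the Gelfand triple, where `H` is `V` with the `L²` norm. -/
def toDual (S : DiscreteSpace κ Ω V) (v : V) : AntiDual V :=
  S.l2Functional (S.emb v).1

/-- The discrete operator `A_h = -Δ : V → V⋆`. -/
def A (S : DiscreteSpace κ Ω V) (v : V) : AntiDual V :=
  S.gradFunctional (S.emb v).2

/-- `v = Π_h g`, the `L²(Ω)`-orthogonal projection of `g` onto `V`. -/
def IsL2Proj (S : DiscreteSpace κ Ω V) (g : L2 Ω ℂ) (v : V) : Prop :=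
  ∀ w : V, inner ℂ (S.emb w).1 ((S.emb v).1 - g) = 0

/-- `v = Q_h u`, the `H¹(Ω)`-orthogonal projection of `u` onto `V`. -/
def IsH1Proj (S : DiscreteSpace κ Ω V) (u : H1 Ω) (v : V) : Prop :=
  ∀ w : V, inner ℂ (S.emb w).1 ((S.emb v).1 - u.val) +
    inner ℂ (S.emb w).2 ((S.emb v).2 - u.grad) = 0

/-- `u`, with derivative `u'`, solves `(∂_t + A_h) u = f` in `V⋆` for a.e. `t > 0`, `u(0) = u₀`;
here `u' ∈ L²(0,T)` for all `T`, and `u` is the absolutely continuous primitive of `u'`. -/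
structure IsSolution (S : DiscreteSpace κ Ω V) (f : ℝ → AntiDual V) (u₀ : V) (u u' : ℝ → V) :
    Prop where
  memLp : ∀ T : ℝ, MemLp u' 2 (volume.restrict (Ioc 0 T))
  primitive : ∀ t : ℝ, 0 ≤ t → u t = u₀ + ∫ r in (0 : ℝ)..t, u' r
  equation : ∀ᵐ t ∂(volume.restrict (Ioi (0 : ℝ))), S.toDual (u' t) + S.A (u t) = f t

/-- `w` solves the Laplace-domain problem `(s + A_h) w = b` in `V⋆`. -/
def IsLaplaceSolution (S : DiscreteSpace κ Ω V) (s : ℂ) (b : AntiDual V) (w : V) : Prop :=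
  s • S.toDual w + S.A w = b

end DiscreteSpace

/-! ### Laplace transform, Hardy norm, and the class `N₂(D_d)` -/

section Laplace

variable {X : Type} [NormedAddCommGroup X] [NormedSpace ℂ X]

/-- `f ∈ L²_α(ℝ₊; X)`, that is `∫₀^∞ e^{-2αt} ‖f(t)‖² dt < ∞`. -/
def MemL2Weighted (α : ℝ) (f : ℝ → X) : Prop :=
  MemLp (fun t : ℝ => (Real.exp (-α * t) : ℂ) • f t) 2 (volume.restrict (Ioi 0))

/-- The Laplace transform `∫₀^∞ e^{-st} f(t) dt`. -/
def laplace (f : ℝ → X) (s : ℂ) : X :=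
  ∫ t in Ioi (0 : ℝ), Complex.exp (-s * t) • f t

/-- The squared norm of the Hardy space `ℋ²_α(X)`. -/
def hardySq (α : ℝ) (g : ℂ → X) : ℝ≥0∞ :=
  ⨆ σ ∈ Ioi α, (∫⁻ τ : ℝ, ‖g (σ + Complex.I * τ)‖ₑ ^ 2) / ENNReal.ofReal (2 * Real.pi)

/-- The domain `D_d = {z | |arg(z + √(1 + z²))| < d}` (principal branches). -/
def dom (d : ℝ) : Set ℂ :=
  {z | |Complex.arg (z + (1 + z ^ 2) ^ (1 / 2 : ℂ))| < d}

/-- `∫_{∂D_y} ‖F(z)‖² |dz|` for `0 < y < π/2`; the two branches of the hyperbola `∂D_y` are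
`x ↦ sinh(x ± iy)`. -/
def boundaryIntegral (y : ℝ) (F : ℂ → X) : ℝ≥0∞ :=
  (∫⁻ x : ℝ, ‖F (Complex.sinh (x + Complex.I * y))‖ₑ ^ 2 *
      ‖Complex.cosh (x + Complex.I * y)‖ₑ) +
  ∫⁻ x : ℝ, ‖F (Complex.sinh (x - Complex.I * y))‖ₑ ^ 2 *
      ‖Complex.cosh (x - Complex.I * y)‖ₑ

/-- The squared norm of `N₂(D_d; X)`. The integral over `∂D_d` is understood in the Hardy space
sense, through the curves `∂D_y ⊆ D_d`, `y < d`. -/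
def nTwoSq (d : ℝ) (F : ℂ → X) : ℝ≥0∞ :=
  ⨆ y ∈ Ioo 0 d, boundaryIntegral y F

/-- `F ∈ N₂(D_d; X)`. -/
def MemNTwo (d : ℝ) (F : ℂ → X) : Prop :=
  DifferentiableOn ℂ F (dom d) ∧ nTwoSq d F < ⊤

/-- The function `z ↦ f̂(α + iz)`, which the Laplace integral defines for `Im z < 0`, extends
analytically to `F` on `D_d`, and `F ∈ N₂(D_d; X)`. -/
structure LaplaceExtends (α d : ℝ) (f : ℝ → X) (F : ℂ → X) : Prop where
  mem : MemNTwo d F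
  eq_laplace : ∀ z ∈ dom d, z.im < 0 → F z = laplace f (α + Complex.I * z)

end Laplace

section Goal

variable {n : ℕ} {κ : ℝ} {Ω : Set (RSpace n)} {V : Type}
  [NormedAddCommGroup V] [InnerProductSpace ℂ V] [FiniteDimensional ℂ V]

/-- The goal functional `ε(V_R) = ‖û - P û‖²_{ℋ²_α(V)} + ‖(∂ₜu)^ - (∂ₜPu)^‖²_{ℋ²_α(V⋆)}` of the
subspace `V_R = W`, with `P` the `V`-orthogonal projection onto `W`; `u' = ∂ₜu`, and so
`∂ₜ(Pu) = P u'`. -/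
def goal (S : DiscreteSpace κ Ω V) (α : ℝ) (u u' : ℝ → V) (W : Submodule ℂ V) : ℝ≥0∞ :=
  hardySq α (fun s => laplace u s - W.starProjection (laplace u s)) +
  hardySq α (fun s => laplace (fun t => S.toDual (u' t)) s -
    laplace (fun t => S.toDual (W.starProjection (u' t))) s)

/-- The infimum of `ε(V_R)` over all subspaces `V_R ⊆ V` of dimension at most `R`. -/
def bestGoal (S : DiscreteSpace κ Ω V) (α : ℝ) (u u' : ℝ → V) (R : ℕ) : ℝ≥0∞ :=
  ⨅ W ∈ {W : Submodule ℂ V | Module.finrank ℂ W ≤ R}, goal S α u u' W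

/-- The sinc points `z_k = sinh(kϑ)`, for `ϑ = √(2πd/K)`. -/
def sincPoint (d : ℝ) (K : ℕ) (k : ℤ) : ℝ :=
  Real.sinh (k * Real.sqrt (2 * Real.pi * d / K))

/-- All hypotheses on the data: `f` and its derivative in time, the analytic extensions `F` and
`F'` of `z ↦ f̂(α + iz)` and of `z ↦ (∂ₜf)^(α + iz)`, the initial value `f₀ = f(0) ∈ H¹(Ω)`, and
the decay condition with constant `C₀`. -/
structure Admissible (S : DiscreteSpace κ Ω V) (α d C₀ : ℝ) (f f' : ℝ → AntiDual V)
    (F F' : ℂ → AntiDual V) (f₀ : H1 Ω) : Prop where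
  memL2 : MemL2Weighted α f
  extends_f : LaplaceExtends α d f F
  memLp_deriv : MemLp f' 2 (volume.restrict (Ioi (0 : ℝ)))
  primitive : ∀ t : ℝ, 0 ≤ t → f t = f 0 + ∫ r in (0 : ℝ)..t, f' r
  extends_deriv : LaplaceExtends α d f' F'
  initial : f 0 = S.l2Functional f₀.val
  decay : ∀ τ : ℝ, ‖F τ‖ + ‖F' τ‖ ≤ C₀ / Real.sqrt (1 + τ ^ 2)

/-- The rate `R^{1/2} exp(-2 √(π d R / 4))`. -/
def rate (d : ℝ) (R : ℕ) : ℝ :=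
  (R : ℝ) ^ (1 / 2 : ℝ) * Real.exp (-2 * Real.sqrt (Real.pi * d * R / 4))

end Goal

end LaplaceRB

end

/-! On the line Re s = α the transform of the solution is a resolvent applied to data, `laplace u s
= (s + A_h)⁻¹ (f̂(s) + u₀h)`. The transform of `u'` has the same shape, with f replaced by its time
derivative and u₀h by an element q of V representing f(0) − A_h u₀h. Integration by parts and the
definition of the H¹ projection give q = Π_h f(0) + Π_h Δu₀ + (u₀h − Π_h u₀)
(`DiscreteSpace.l2Functional_sub_A_eq_toDual`), which is where the terms of the bound come from.
Everything is made explicit in a V-orthonormal basis that diagonalises the L² form and the Dirichlet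
form simultaneously (`DiscreteSpace.exists_eigenbasis`, `laplace_evolution`).

A Laplace transform on a line Re s = σ > α is the Poisson integral of its values on Re s = α, so its
L² norm on that line is no larger. The projection commutes with the transform, hence `goal` is
controlled by two L² integrals over the single line Re s = α (`goal_le`). Comparing the V⋆ norm with
the V norm costs a Poincaré constant independent of V.

Substitute s = α + i sinh w. Since sinh maps the strip |Im w| < d into D_d, the data become analytic
in the strip, and so does the resolvent, because its symbol stays away from zero by the factor 1 −
sin d (`resolvent_symbol_lower_bound`); this factor makes the constant blow up as d → π/2. After
multiplication by √(cosh w) the integral over the line becomes an unweighted integral over ℝ. The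
resulting function has L² norms on horizontal lines bounded through the N₂ norm of the data, and on
ℝ it decays like exp(−|x|/2) by the pointwise decay condition.

For such a function the sinc interpolant on the grid θℤ has an error given by a contour integral
with kernel 1/(sin(πw/θ)(w − x)), of order exp(−πd/θ) (`sinc_error_le`). Dropping the nodes with |k|
> K costs exp(−Kθ/2). The choice θ = √(2πd/K) makes both equal to exp(−√(2πdK)/2). The truncated
interpolant is a combination of the samples, so it lies in any space containing them, and the
orthogonal projection does at least as well (`lintegral_sub_starProjection_le_of_nodes`). Squaring
and integrating over an interval of length of order √K gives the rate.

One space serves both terms of `goal`: the samples of the transform of `u'` are s û(s) − u₀h, hence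
lie in the span of u₀h and the samples û(s_k). This space has dimension at most 2K + 2. -/

noncomputable section

namespace LaplaceRB

/-! ### The residue theorem on a rectangle with simple poles on the real axis. -/

section Rectangle

theorem intervalIntegrable_comp_line {E : Type*} [NormedAddCommGroup E]
    {f : ℂ → E} {s : Set ℂ} (hf : ContinuousOn f s) {a b : ℝ}
    (hab : a ≤ b) {γ : ℝ → ℂ} (hγ : Continuous γ) (h : ∀ x ∈ Icc a b, γ x ∈ s) :
    IntervalIntegrable (fun x => f (γ x)) volume a b := by
  apply ContinuousOn.intervalIntegrable
  rw [uIcc_of_le hab]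
  exact hf.comp hγ.continuousOn h

/-- The boundary of the rectangle `[a, b] × [-y, y]`. -/
def rectBoundary (a b y : ℝ) : Set ℂ :=
  {w | (w.re ∈ Icc a b ∧ (w.im = y ∨ w.im = -y)) ∨
    (w.im ∈ Icc (-y) y ∧ (w.re = a ∨ w.re = b))}

theorem rectBoundary_intervalIntegrable {E : Type*} [NormedAddCommGroup E] {f : ℂ → E} {a b y : ℝ}
    (hab : a ≤ b) (hy : 0 ≤ y)
    (hf : ContinuousOn f (rectBoundary a b y)) :
    IntervalIntegrable (fun x : ℝ => f (x + (-y : ℝ) * Complex.I)) volume a b ∧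
    IntervalIntegrable (fun x : ℝ => f (x + y * Complex.I)) volume a b ∧
    IntervalIntegrable (fun s : ℝ => f (b + s * Complex.I)) volume (-y) y ∧
    IntervalIntegrable (fun s : ℝ => f (a + s * Complex.I)) volume (-y) y := by
  refine ⟨?_, ?_, ?_, ?_⟩
  · exact intervalIntegrable_comp_line hf hab (by fun_prop)
      fun x hx => Or.inl (by simpa using hx)
  · exact intervalIntegrable_comp_line hf hab (by fun_prop)
      fun x hx => Or.inl (by simpa using hx)
  · exact intervalIntegrable_comp_line hf (by linarith) (by fun_prop)
      fun x hx => Or.inr (by simpa using hx)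
  · exact intervalIntegrable_comp_line hf (by linarith) (by fun_prop)
      fun x hx => Or.inr (by simpa using hx)

variable {E : Type*} [NormedAddCommGroup E] [NormedSpace ℂ E]

/-- The integral over the boundary of the rectangle `[a, b] × [-y, y]`, counterclockwise. -/
def rectIntegral (a b y : ℝ) (f : ℂ → E) : E :=
  (∫ x : ℝ in a..b, f (x + (-y : ℝ) * Complex.I)) - (∫ x : ℝ in a..b, f (x + y * Complex.I)) +
    Complex.I • (∫ s : ℝ in (-y)..y, f (b + s * Complex.I)) -
    Complex.I • (∫ s : ℝ in (-y)..y, f (a + s * Complex.I))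

theorem rectIntegral_add {f g : ℂ → E} {a b y : ℝ} (hab : a ≤ b) (hy : 0 ≤ y)
    (hf : ContinuousOn f (rectBoundary a b y)) (hg : ContinuousOn g (rectBoundary a b y)) :
    rectIntegral a b y (fun w => f w + g w) = rectIntegral a b y f + rectIntegral a b y g := by
  obtain ⟨f1, f2, f3, f4⟩ := rectBoundary_intervalIntegrable hab hy hf
  obtain ⟨g1, g2, g3, g4⟩ := rectBoundary_intervalIntegrable hab hy hg
  simp only [rectIntegral]
  rw [intervalIntegral.integral_add f1 g1, intervalIntegral.integral_add f2 g2,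
    intervalIntegral.integral_add f3 g3, intervalIntegral.integral_add f4 g4]
  module

theorem rectIntegral_smul_const [CompleteSpace E] (f : ℂ → ℂ) (c : E) (a b y : ℝ) :
    rectIntegral a b y (fun w => f w • c) = rectIntegral a b y f • c := by
  simp only [rectIntegral, intervalIntegral.integral_smul_const]
  module

theorem rectIntegral_finset_sum {ι : Type*} (S : Finset ι) (f : ι → ℂ → E) {a b y : ℝ}
    (hab : a ≤ b) (hy : 0 ≤ y) (hf : ∀ i ∈ S, ContinuousOn (f i) (rectBoundary a b y)) :
    rectIntegral a b y (fun w => ∑ i ∈ S, f i w) = ∑ i ∈ S, rectIntegral a b y (f i) := by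
  classical
  induction S using Finset.induction_on with
  | empty => simp [rectIntegral]
  | insert i S hi ih =>
    simp only [Finset.sum_insert hi]
    rw [rectIntegral_add hab hy (hf i (by simp))
      (continuousOn_finsetSum _ fun j hj => hf j (by simp [hj])),
      ih fun j hj => hf j (by simp [hj])]

/-- The principal logarithm is an antiderivative, since a positive real part keeps the segment off
the branch cut. -/
theorem integral_inv_line {c β : ℂ} {a b : ℝ}
    (h : ∀ x ∈ uIcc a b, 0 < (c + x * β).re) :
    ∫ x : ℝ in a..b, β / (c + x * β) = Complex.log (c + b * β) - Complex.log (c + a * β) := by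
  have hd : ∀ x ∈ uIcc a b,
      HasDerivAt (fun x : ℝ => Complex.log (c + x * β)) (β / (c + x * β)) x := by
    intro x hx
    have h1 : HasDerivAt (fun x : ℝ => c + x * β) β x := by
      simpa using ((Complex.ofRealCLM.hasDerivAt (x := x)).mul_const β).const_add c
    exact h1.clog_real (Or.inl (h x hx))
  refine intervalIntegral.integral_eq_sub_of_hasDerivAt hd ?_
  apply ContinuousOn.intervalIntegrable
  refine ContinuousOn.div (by fun_prop) (by fun_prop) fun x hx h0 => ?_
  have := h x hx
  rw [h0] at this
  simp at this

theorem log_sub_log_conj {z : ℂ} (hz : 0 < z.re) :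
    Complex.log z - Complex.log (starRingEnd ℂ z) =
        2 * Complex.I * (Real.arctan (z.im / z.re) : ℝ) := by
  have h0 : z ≠ 0 := by rintro rfl; simp at hz
  have ha : z.arg ≠ Real.pi := by
    intro h
    have := Complex.arg_eq_pi_iff.1 h
    linarith [this.1]
  rw [Complex.log_conj _ ha, Complex.sub_conj, Complex.log_im]
  have : z.arg = Real.arctan (z.im / z.re) := by
    rw [← Complex.tan_arg, Real.arctan_tan]
    · exact (abs_lt.1 (Complex.abs_arg_lt_pi_div_two_iff.2 (Or.inl hz))).1
    · exact (abs_lt.1 (Complex.abs_arg_lt_pi_div_two_iff.2 (Or.inl hz))).2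
  rw [this]
  push_cast
  ring

theorem arctan_div_add_arctan_div {x y : ℝ} (hx : 0 < x) (hy : 0 < y) :
    Real.arctan (x / y) + Real.arctan (y / x) = Real.pi / 2 := by
  have := Real.arctan_inv_of_pos (div_pos hx hy)
  rw [inv_div] at this
  rw [this]; ring

/-- Each side, seen from p and turned by a fourth root of unity, lies in the right half-plane, where
the principal logarithm applies. It contributes 2i times an arctangent, and the four arctangents
pair up as arctan t + arctan(1/t) = π/2. -/
theorem rectIntegral_inv_sub {a b y p : ℝ} (ha : a < p) (hb : p < b) (hy : 0 < y) :
    rectIntegral a b y (fun w => (w - p)⁻¹) = 2 * Real.pi * Complex.I := by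
  have hI := Complex.I_sq
  have h1 : (∫ x : ℝ in a..b, ((x + (-y : ℝ) * Complex.I : ℂ) - p)⁻¹) =
      Complex.log (y + (b - p) * Complex.I) - Complex.log (y + (a - p) * Complex.I) := by
    have := integral_inv_line (c := y - p * Complex.I) (β := Complex.I) (a := a) (b := b)
      (by intro x _; simpa using hy)
    convert this using 2
    · ext x
      rw [inv_eq_one_div, ← mul_div_mul_left 1 _ Complex.I_ne_zero]
      congr 1
      · ring
      · push_cast; linear_combination (-(y:ℂ)) * hI
    · ring_nf
    · ring_nf
  have h2 : (∫ x : ℝ in a..b, ((x + y * Complex.I : ℂ) - p)⁻¹) =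
      Complex.log (y - (b - p) * Complex.I) - Complex.log (y - (a - p) * Complex.I) := by
    have := integral_inv_line (c := y + p * Complex.I) (β := -Complex.I) (a := a) (b := b)
      (by intro x _; simpa using hy)
    convert this using 2
    · ext x
      rw [inv_eq_one_div, ← mul_div_mul_left 1 _ (neg_ne_zero.2 Complex.I_ne_zero)]
      congr 1
      · ring
      · linear_combination (-(y:ℂ)) * hI
    · ring_nf
    · ring_nf
  have h3 : Complex.I • (∫ s : ℝ in (-y)..y, ((b + s * Complex.I : ℂ) - p)⁻¹) =
      Complex.log ((b - p) + y * Complex.I) - Complex.log ((b - p) - y * Complex.I) := by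
    have := integral_inv_line (c := b - p) (β := Complex.I) (a := -y) (b := y)
      (by intro x _; simpa using hb)
    rw [smul_eq_mul, ← intervalIntegral.integral_const_mul]
    refine (intervalIntegral.integral_congr fun x _ => ?_).trans (this.trans ?_)
    · simp only [div_eq_mul_inv]; ring_nf
    · push_cast; ring_nf
  have h4 : Complex.I • (∫ s : ℝ in (-y)..y, ((a + s * Complex.I : ℂ) - p)⁻¹) =
      Complex.log ((p - a) - y * Complex.I) - Complex.log ((p - a) + y * Complex.I) := by
    have := integral_inv_line (c := p - a) (β := -Complex.I) (a := -y) (b := y)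
      (by intro x _; simpa using ha)
    rw [smul_eq_mul, ← intervalIntegral.integral_const_mul]
    refine (intervalIntegral.integral_congr fun x _ => ?_).trans (this.trans ?_)
    · simp only [div_eq_mul_inv]
      rw [neg_mul, ← mul_neg, ← inv_neg]
      ring_nf
    · push_cast; ring_nf
  have k1 := log_sub_log_conj (z := y + (b - p) * Complex.I) (by simpa using hy)
  have k2 := log_sub_log_conj (z := y + (p - a) * Complex.I) (by simpa using hy)
  have k3 := log_sub_log_conj (z := (b - p) + y * Complex.I) (by simpa using hb)
  have k4 := log_sub_log_conj (z := (p - a) + y * Complex.I) (by simpa using ha)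
  simp only [map_add, map_mul, map_sub, Complex.conj_ofReal, Complex.conj_I, Complex.add_re,
    Complex.ofReal_re, Complex.mul_re, Complex.sub_re, Complex.I_re, Complex.sub_im,
    Complex.ofReal_im, Complex.I_im, Complex.add_im, Complex.mul_im] at k1 k2 k3 k4
  have e1 := arctan_div_add_arctan_div (sub_pos.2 hb) hy
  have e2 := arctan_div_add_arctan_div (sub_pos.2 ha) hy
  have e1' := congrArg (fun r : ℝ => (r : ℂ)) e1
  have e2' := congrArg (fun r : ℝ => (r : ℂ)) e2
  simp only [mul_zero, mul_one, zero_add, add_zero, sub_self] at k1 k2 k3 k4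
  push_cast at k1 k2 k3 k4 e1' e2'
  simp only [rectIntegral]
  rw [h1, h2, h3, h4]
  have r1 : (y : ℂ) + (a - p) * Complex.I = y + (p - a) * -Complex.I := by ring
  have r2 : (y : ℂ) - (a - p) * Complex.I = y + (p - a) * Complex.I := by ring
  have r3 : (y : ℂ) - (b - p) * Complex.I = y + (b - p) * -Complex.I := by ring
  have r4 : (b - p : ℂ) - y * Complex.I = (b - p) + y * -Complex.I := by ring
  have r5 : (p - a : ℂ) - y * Complex.I = (p - a) + y * -Complex.I := by ring
  rw [r1, r2, r3, r4, r5]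
  linear_combination k1 + k2 + k3 + k4 + 2 * Complex.I * (e1' + e2')

/-- The residue theorem for a rectangle and finitely many simple poles on the real axis. -/
theorem rectIntegral_eq_sum_residues [CompleteSpace E] {f : ℂ → E} {a b y : ℝ} (hab : a < b)
    (hy : 0 < y) (S : Finset ℝ) (hS : ∀ p ∈ S, p ∈ Ioo a b) (c : ℝ → E)
    (hf : ∀ w : ℂ, w.re ∈ Icc a b → w.im ∈ Icc (-y) y → (∀ p ∈ S, w ≠ (p : ℝ)) →
      DifferentiableAt ℂ f w)
    (hr : ∀ p ∈ S, ∃ r : ℂ → E, DifferentiableAt ℂ r p ∧ r p = c p ∧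
      ∀ᶠ w in 𝓝[≠] (p : ℂ), f w = (w - p)⁻¹ • r w) :
    rectIntegral a b y f = (2 * Real.pi * Complex.I) • ∑ p ∈ S, c p := by
  classical
  -- Subtracting the principal parts leaves removable singularities. `G` below fills them by their
  -- limits, and the Cauchy–Goursat theorem applies to it because mere continuity is enough at
  -- countably many points.
  set F : ℂ → E := fun w => f w - ∑ p ∈ S, (w - (p : ℝ))⁻¹ • c p with hF
  have hlim : ∀ p ∈ S, ∃ L : E, Tendsto F (𝓝[≠] (p : ℂ)) (𝓝 L) := by
    intro p hp
    obtain ⟨r, hr1, hr2, hr3⟩ := hr p hp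
    refine ⟨deriv r p - ∑ q ∈ S.erase p, ((p : ℂ) - (q : ℝ))⁻¹ • c q, ?_⟩
    have t1 : Tendsto (slope r (p : ℂ)) (𝓝[≠] (p : ℂ)) (𝓝 (deriv r p)) :=
      hasDerivAt_iff_tendsto_slope.1 hr1.hasDerivAt
    have t2 : Tendsto (fun w : ℂ => ∑ q ∈ S.erase p, (w - (q : ℝ))⁻¹ • c q) (𝓝[≠] (p : ℂ))
        (𝓝 (∑ q ∈ S.erase p, ((p : ℂ) - (q : ℝ))⁻¹ • c q)) := by
      apply tendsto_nhdsWithin_of_tendsto_nhds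
      refine tendsto_finsetSum _ fun q hq => ?_
      have hne : (p : ℂ) - (q : ℝ) ≠ 0 := by
        rw [sub_ne_zero]
        exact_mod_cast (Finset.ne_of_mem_erase hq).symm
      exact (((continuous_id.tendsto (p : ℂ)).sub_const _).inv₀ hne).smul_const _
    refine (t1.sub t2).congr' ?_
    filter_upwards [hr3] with w hw
    rw [hF]
    simp only
    rw [← Finset.add_sum_erase _ _ hp, hw, slope, vsub_eq_sub, hr2, smul_sub]
    abel
  choose! Lm hL using hlim
  set G : ℂ → E := fun w => if ∃ p ∈ S, w = (p : ℝ) then Lm w.re else F w with hG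
  have hGF : ∀ w : ℂ, (∀ p ∈ S, w ≠ (p : ℝ)) → G w = F w := by
    intro w hw
    rw [hG]
    simp only
    rw [if_neg]
    push Not
    exact hw
  have hopen : ∀ w : ℂ, (∀ p ∈ S, w ≠ (p : ℝ)) → ∀ᶠ v : ℂ in 𝓝 w, ∀ p ∈ S, v ≠ (p : ℝ) := by
    intro w hw
    rw [Filter.eventually_all_finset]
    intro p hp
    exact isOpen_ne.mem_nhds (hw p hp)
  have hdiff : ∀ w : ℂ, w.re ∈ Icc a b → w.im ∈ Icc (-y) y → (∀ p ∈ S, w ≠ (p : ℝ)) →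
      DifferentiableAt ℂ G w := by
    intro w h1 h2 h3
    have : DifferentiableAt ℂ F w := by
      refine (hf w h1 h2 h3).sub ?_
      refine DifferentiableAt.fun_sum fun p hp => ?_
      refine DifferentiableAt.smul_const ?_ _
      exact (differentiableAt_id.sub_const _).inv (sub_ne_zero.2 (h3 p hp))
    refine this.congr_of_eventuallyEq ?_
    filter_upwards [hopen w h3] with v hv using hGF v hv
  have hcont : ∀ w : ℂ, w.re ∈ Icc a b → w.im ∈ Icc (-y) y → ContinuousAt G w := by
    intro w h1 h2
    by_cases h3 : ∀ p ∈ S, w ≠ (p : ℝ)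
    · exact (hdiff w h1 h2 h3).continuousAt
    · push Not at h3
      obtain ⟨p, hp, rfl⟩ := h3
      rw [← continuousWithinAt_compl_self]
      have hv : G p = Lm p := by
        rw [hG]; simp only; rw [if_pos ⟨p, hp, rfl⟩]; simp
      rw [ContinuousWithinAt, hv]
      refine (hL p hp).congr' ?_
      have : ∀ᶠ v : ℂ in 𝓝 (p : ℂ), ∀ q ∈ S.erase p, v ≠ (q : ℝ) := by
        rw [Filter.eventually_all_finset]
        intro q hq
        refine isOpen_ne.mem_nhds ?_
        show (p : ℂ) ≠ (q : ℝ)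
        exact_mod_cast (Finset.ne_of_mem_erase hq).symm
      filter_upwards [nhdsWithin_le_nhds this, self_mem_nhdsWithin] with v hv1 hv2
      refine (hGF v fun q hq => ?_).symm
      by_cases hqp : q = p
      · subst hqp; exact hv2
      · exact hv1 q (Finset.mem_erase.2 ⟨hqp, hq⟩)
  have hbd : ∀ w ∈ rectBoundary a b y, ∀ p ∈ S, w ≠ (p : ℝ) := by
    rintro w hw p hp rfl
    have := hS p hp
    rcases hw with ⟨_, h | h⟩ | ⟨_, h | h⟩
    · simp at h; linarith
    · simp at h; linarith
    · simp at h; linarith [this.1]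
    · simp at h; linarith [this.2]
  have hbd' : ∀ w ∈ rectBoundary a b y, w.re ∈ Icc a b ∧ w.im ∈ Icc (-y) y := by
    rintro w (⟨h1, h | h⟩ | ⟨h1, h | h⟩)
    · exact ⟨h1, by rw [h]; constructor <;> linarith⟩
    · exact ⟨h1, by rw [h]; constructor <;> linarith⟩
    · exact ⟨by rw [h]; exact ⟨le_refl _, hab.le⟩, h1⟩
    · exact ⟨by rw [h]; exact ⟨hab.le, le_refl _⟩, h1⟩
  have hzero : rectIntegral a b y G = 0 := by
    have := Complex.integral_boundary_rect_eq_zero_of_differentiable_on_off_countable G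
      (⟨a, -y⟩ : ℂ) (⟨b, y⟩ : ℂ) ((fun p : ℝ => (p : ℂ)) '' S) (S.countable_toSet.image _) ?_ ?_
    · simpa only [rectIntegral] using this
    · intro w hw
      simp only [uIcc_of_le hab.le, uIcc_of_le (show -y ≤ y by linarith)] at hw
      exact (hcont w hw.1 hw.2).continuousWithinAt
    · rintro w ⟨hw, hw2⟩
      simp only [min_eq_left hab.le, max_eq_right hab.le, min_eq_left (show -y ≤ y by linarith),
        max_eq_right (show -y ≤ y by linarith)] at hw
      refine hdiff w (Ioo_subset_Icc_self hw.1) (Ioo_subset_Icc_self hw.2) fun p hp h => hw2 ?_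
      exact ⟨p, hp, h.symm⟩
  have hdec : rectIntegral a b y f =
      rectIntegral a b y (fun w => G w + ∑ p ∈ S, (w - (p : ℝ))⁻¹ • c p) := by
    have : ∀ w ∈ rectBoundary a b y, f w = G w + ∑ p ∈ S, (w - (p : ℝ))⁻¹ • c p := by
      intro w hw
      rw [hGF w (hbd w hw), hF]
      simp
    simp only [rectIntegral]
    congr 1
    · congr 1
      · congr 1
        · refine intervalIntegral.integral_congr fun x hx => this _ (Or.inl ?_)
          rw [uIcc_of_le hab.le] at hx
          simpa using hx
        · refine intervalIntegral.integral_congr fun x hx => this _ (Or.inl ?_)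
          rw [uIcc_of_le hab.le] at hx
          simpa using hx
      · congr 1
        refine intervalIntegral.integral_congr fun x hx => this _ (Or.inr ?_)
        rw [uIcc_of_le (by linarith)] at hx
        simpa using hx
    · congr 1
      refine intervalIntegral.integral_congr fun x hx => this _ (Or.inr ?_)
      rw [uIcc_of_le (by linarith)] at hx
      simpa using hx
  have hc1 : ContinuousOn G (rectBoundary a b y) := fun w hw =>
    (hcont w (hbd' w hw).1 (hbd' w hw).2).continuousWithinAt
  have hc2 : ∀ p ∈ S, ContinuousOn (fun w : ℂ => (w - (p : ℝ))⁻¹ • c p) (rectBoundary a b y) := by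
    intro p hp
    refine ContinuousOn.smul ?_ continuousOn_const
    exact ContinuousOn.inv₀ (by fun_prop) fun w hw => sub_ne_zero.2 (hbd w hw p hp)
  rw [hdec, rectIntegral_add hab.le hy.le hc1 (continuousOn_finsetSum _ hc2), hzero, zero_add,
    rectIntegral_finset_sum S _ hab.le hy.le hc2, Finset.smul_sum]
  refine Finset.sum_congr rfl fun p hp => ?_
  rw [rectIntegral_smul_const, rectIntegral_inv_sub (hS p hp).1 (hS p hp).2 hy]

end Rectangle

/-! ### Cauchy–Schwarz for vector-valued integrals. -/

section CauchySchwarz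

variable {α : Type*} [MeasurableSpace α] {μ : Measure α}

theorem lintegral_mul_sq_le {f g : α → ℝ≥0∞} (hf : AEMeasurable f μ) (hg : AEMeasurable g μ) :
    (∫⁻ a, f a * g a ∂μ) ^ 2 ≤ (∫⁻ a, f a ^ 2 ∂μ) * ∫⁻ a, g a ^ 2 ∂μ := by
  have h := ENNReal.lintegral_mul_le_Lp_mul_Lq μ Real.HolderConjugate.two_two hf hg
  simp only [Pi.mul_apply, ENNReal.rpow_two] at h
  calc (∫⁻ a, f a * g a ∂μ) ^ 2
      ≤ ((∫⁻ a, f a ^ 2 ∂μ) ^ (1 / 2 : ℝ) * (∫⁻ a, g a ^ 2 ∂μ) ^ (1 / 2 : ℝ)) ^ 2 := by gcongr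
    _ = _ := by
      rw [mul_pow, ← ENNReal.rpow_natCast, ← ENNReal.rpow_natCast, ← ENNReal.rpow_mul,
        ← ENNReal.rpow_mul]
      norm_num

theorem enorm_integral_smul_sq_le {E : Type*} [NormedAddCommGroup E] [NormedSpace ℂ E]
    {a : α → ℂ} {g : α → E} (ha : AEStronglyMeasurable a μ) (hg : AEStronglyMeasurable g μ) :
    ‖∫ t, a t • g t ∂μ‖ₑ ^ 2 ≤ (∫⁻ t, ‖a t‖ₑ ^ 2 ∂μ) * ∫⁻ t, ‖g t‖ₑ ^ 2 ∂μ := by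
  refine le_trans ?_ (lintegral_mul_sq_le ha.enorm hg.enorm)
  gcongr
  refine (enorm_integral_le_lintegral_enorm _).trans (le_of_eq ?_)
  simp [enorm_smul]

theorem norm_le_of_enorm_sq_le {E : Type*} [NormedAddCommGroup E] {v : E} {r : ℝ} (hr : 0 ≤ r)
    (h : ‖v‖ₑ ^ 2 ≤ ENNReal.ofReal (r ^ 2)) : ‖v‖ ≤ r := by
  rw [← ofReal_norm, ← ENNReal.ofReal_pow (norm_nonneg _),
    ENNReal.ofReal_le_ofReal_iff (by positivity)] at h
  exact (pow_le_pow_iff_left₀ (norm_nonneg _) hr two_ne_zero).1 h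

end CauchySchwarz

/-! ### The four sides of the sinc contour integral. -/

section SincError

/-- The Cauchy density with location x and scale y has total mass one. -/
theorem lintegral_inv_sq_add_sq (x : ℝ) {y : ℝ} (hy : 0 < y) :
    ∫⁻ t : ℝ, ENNReal.ofReal (((t - x) ^ 2 + y ^ 2)⁻¹) = ENNReal.ofReal (Real.pi / y) := by
  have h := ProbabilityTheory.lintegral_cauchyPDF_eq_one x (γ := y.toNNReal)
    (by simpa using hy)
  simp only [ProbabilityTheory.cauchyPDF, ProbabilityTheory.cauchyPDFReal,
    Real.coe_toNNReal _ hy.le] at h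
  have hpi := Real.pi_pos
  rw [← mul_one (ENNReal.ofReal (Real.pi / y)), ← h, ← lintegral_const_mul' _ _ (by simp)]
  refine lintegral_congr fun t => ?_
  rw [← ENNReal.ofReal_mul (by positivity)]
  congr 1
  field_simp

theorem norm_sin_sq (u v : ℝ) :
    ‖Complex.sin (u + v * Complex.I)‖ ^ 2 = Real.sin u ^ 2 + Real.sinh v ^ 2 := by
  rw [Complex.sin_add_mul_I, ← Complex.normSq_eq_norm_sq, ← Complex.ofReal_sin,
    ← Complex.ofReal_cosh, ← Complex.ofReal_cos, ← Complex.ofReal_sinh, ← Complex.ofReal_mul,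
    ← Complex.ofReal_mul, Complex.normSq_add_mul_I]
  have h1 := Real.cosh_sq v
  have h2 := Real.sin_sq_add_cos_sq u
  rw [mul_pow, mul_pow, h1]
  linear_combination (Real.sinh v ^ 2) * h2

theorem norm_sin_pi_div (t s θ : ℝ) :
    ‖Complex.sin (Real.pi * (t + s * Complex.I) / θ)‖ ^ 2 =
      Real.sin (Real.pi * t / θ) ^ 2 + Real.sinh (Real.pi * s / θ) ^ 2 := by
  rw [← norm_sin_sq]
  congr 3
  push_cast
  ring

variable {E : Type*} [NormedAddCommGroup E] [NormedSpace ℂ E] {g : ℂ → E} {θ y : ℝ}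

/-- The integrand of the contour integral for the error of the sinc interpolation at `x`. -/
def sincKernel (θ x : ℝ) (w : ℂ) : ℂ := (Complex.sin (Real.pi * w / θ) * (w - x))⁻¹

/-- From |sin(u + iv)|² = sin² u + sinh² v only sinh² v is kept; it is constant on the line and is
the source of the exponential convergence. -/
theorem norm_sincKernel_horizontal_le (hθ : 0 < θ) {σ : ℝ} (hσ : |σ| = y) (hy : 0 < y) (x t : ℝ) :
    ‖sincKernel θ x (t + σ * Complex.I)‖ ^ 2 ≤
      (Real.sinh (Real.pi * y / θ) ^ 2)⁻¹ * ((t - x) ^ 2 + y ^ 2)⁻¹ := by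
  have hσ2 : σ ^ 2 = y ^ 2 := by rw [← hσ, sq_abs]
  have h1 : ‖(t + σ * Complex.I - x : ℂ)‖ ^ 2 = (t - x) ^ 2 + y ^ 2 := by
    rw [← hσ2, ← Complex.normSq_add_mul_I (t - x) σ, Complex.normSq_eq_norm_sq]
    push_cast
    ring_nf
  have hs : Real.sinh (Real.pi * σ / θ) ^ 2 = Real.sinh (Real.pi * y / θ) ^ 2 := by
    rcases abs_eq hy.le |>.1 hσ with h | h
    · rw [h]
    · rw [h, show Real.pi * -y / θ = -(Real.pi * y / θ) by ring, Real.sinh_neg]; ring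
  rw [sincKernel, norm_inv, norm_mul, inv_pow, mul_pow, mul_inv, h1, norm_sin_pi_div, hs]
  have hpi := Real.pi_pos
  have : 0 < Real.sinh (Real.pi * y / θ) := Real.sinh_pos_iff.2 (by positivity)
  gcongr
  nlinarith [sq_nonneg (Real.sin (Real.pi * t / θ))]

theorem measurable_sincKernel (θ x : ℝ) : Measurable (sincKernel θ x) := by
  unfold sincKernel
  fun_prop

/-- Cauchy–Schwarz, with the L² norm of the kernel computed from the Cauchy density. The bound does
not involve the end points, so the rectangle may grow. -/
theorem norm_integral_horizontal_le (hθ : 0 < θ) {σ : ℝ} (hσ : |σ| = y) (hy : 0 < y) (x : ℝ)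
    {a b : ℝ} (hab : a ≤ b) (hg : Continuous fun t : ℝ => g (t + σ * Complex.I)) {M : ℝ}
    (hM : 0 ≤ M) (hgM : ∫⁻ t : ℝ, ‖g (t + σ * Complex.I)‖ₑ ^ 2 ≤ ENNReal.ofReal (M ^ 2)) :
    ‖∫ t : ℝ in a..b, sincKernel θ x (t + σ * Complex.I) • g (t + σ * Complex.I)‖ ≤
      √(Real.pi / y) / Real.sinh (Real.pi * y / θ) * M := by
  have hpi := Real.pi_pos
  have hsh : 0 < Real.sinh (Real.pi * y / θ) := Real.sinh_pos_iff.2 (by positivity)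
  apply norm_le_of_enorm_sq_le (by positivity)
  rw [intervalIntegral.integral_of_le hab]
  have hm : Measurable fun t : ℝ => sincKernel θ x (t + σ * Complex.I) :=
    (measurable_sincKernel θ x).comp (by fun_prop)
  refine (enorm_integral_smul_sq_le hm.aestronglyMeasurable
    hg.aestronglyMeasurable).trans ?_
  rw [mul_pow, ENNReal.ofReal_mul (by positivity)]
  refine mul_le_mul' ?_ ((setLIntegral_le_lintegral _ _).trans hgM)
  refine (setLIntegral_le_lintegral _ _).trans ?_
  calc ∫⁻ t : ℝ, ‖sincKernel θ x (t + σ * Complex.I)‖ₑ ^ 2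
      ≤ ∫⁻ t : ℝ, ENNReal.ofReal ((Real.sinh (Real.pi * y / θ) ^ 2)⁻¹) *
          ENNReal.ofReal (((t - x) ^ 2 + y ^ 2)⁻¹) := by
        refine lintegral_mono fun t => ?_
        rw [← ENNReal.ofReal_mul (by positivity), ← ofReal_norm,
          ← ENNReal.ofReal_pow (norm_nonneg _)]
        exact ENNReal.ofReal_le_ofReal (norm_sincKernel_horizontal_le hθ hσ hy x t)
    _ = _ := by
        rw [lintegral_const_mul' _ _ (by simp), lintegral_inv_sq_add_sq x hy,
          ← ENNReal.ofReal_mul (by positivity)]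
        congr 1
        rw [div_pow, Real.sq_sqrt (by positivity)]
        ring

/-- On this side the squared kernel is at most 4/|X − x|², on a segment of length 2y. The side
therefore becomes negligible as X moves away from x. -/
theorem norm_integral_vertical_le {x X : ℝ} (hX : X ≠ x)
    (hsin : 1 / 2 ≤ |Real.sin (Real.pi * X / θ)|) (hy : 0 < y)
    (hg : ContinuousOn (fun s : ℝ => g (X + s * Complex.I)) (Icc (-y) y)) {B : ℝ} (hB : 0 ≤ B)
    (hgB : ∫⁻ s : ℝ in Ioc (-y) y, ‖g (X + s * Complex.I)‖ₑ ^ 2 ≤ ENNReal.ofReal B) :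
    ‖∫ s : ℝ in (-y)..y, sincKernel θ x (X + s * Complex.I) • g (X + s * Complex.I)‖ ≤
      √(8 * y * B) / |X - x| := by
  have hXx : 0 < |X - x| := abs_pos.2 (sub_ne_zero.2 hX)
  apply norm_le_of_enorm_sq_le (by positivity)
  rw [intervalIntegral.integral_of_le (by linarith)]
  have hm : Measurable fun s : ℝ => sincKernel θ x (X + s * Complex.I) :=
    (measurable_sincKernel θ x).comp (by fun_prop)
  refine (enorm_integral_smul_sq_le hm.aestronglyMeasurable
    ((hg.mono Ioc_subset_Icc_self).aestronglyMeasurable measurableSet_Ioc)).trans ?_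
  have key : ∀ s : ℝ, ‖sincKernel θ x (X + s * Complex.I)‖ ^ 2 ≤ 4 / |X - x| ^ 2 := by
    intro s
    rw [sincKernel, norm_inv, norm_mul, inv_pow, mul_pow, norm_sin_pi_div]
    have h1 : |X - x| ^ 2 ≤ ‖(X + s * Complex.I - x : ℂ)‖ ^ 2 := by
      have := Complex.abs_re_le_norm (X + s * Complex.I - x : ℂ)
      simp only [Complex.sub_re, Complex.add_re, Complex.ofReal_re, Complex.mul_re, Complex.I_re,
        mul_zero, Complex.ofReal_im, Complex.I_im, mul_one, sub_self, add_zero] at this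
      gcongr
    have h2 : 1 / 4 ≤ Real.sin (Real.pi * X / θ) ^ 2 + Real.sinh (Real.pi * s / θ) ^ 2 := by
      have : (1 / 2 : ℝ) ^ 2 ≤ |Real.sin (Real.pi * X / θ)| ^ 2 := by gcongr
      rw [sq_abs] at this
      nlinarith [sq_nonneg (Real.sinh (Real.pi * s / θ))]
    calc _ ≤ (1 / 4 * |X - x| ^ 2)⁻¹ := by
          exact inv_anti₀ (mul_pos (by norm_num) (pow_pos hXx 2))
            (mul_le_mul h2 h1 (sq_nonneg _) (by linarith))
      _ = _ := by field_simp
  calc _ ≤ (∫⁻ s : ℝ in Ioc (-y) y, ENNReal.ofReal (4 / |X - x| ^ 2)) * ENNReal.ofReal B := by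
        refine mul_le_mul' (lintegral_mono fun s => ?_) hgB
        rw [← ofReal_norm, ← ENNReal.ofReal_pow (norm_nonneg _)]
        exact ENNReal.ofReal_le_ofReal (key s)
    _ = _ := by
        rw [lintegral_const, Measure.restrict_apply_univ, Real.volume_Ioc,
          ← ENNReal.ofReal_mul (by positivity),
          ← ENNReal.ofReal_mul (mul_nonneg (by positivity) (by linarith))]
        congr 1
        rw [div_pow, Real.sq_sqrt (by positivity)]
        ring

/-- In this window πX/θ is within π/4, hence within π/3, of an odd multiple of π/2, and cos(π/3) =
1/2. -/
theorem half_le_abs_sin_of_mem {θ X : ℝ} (hθ : 0 < θ) {m : ℤ}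
    (hX : X ∈ Icc ((m + 1 / 4) * θ) ((m + 3 / 4) * θ)) : 1 / 2 ≤ |Real.sin (Real.pi * X / θ)| := by
  have hpi := Real.pi_pos
  set u := Real.pi * X / θ - m * Real.pi - Real.pi / 2 with hu
  have h1 : |Real.sin (Real.pi * X / θ)| = |Real.cos u| := by
    have : Real.pi * X / θ = (u + Real.pi / 2) + m * Real.pi := by rw [hu]; ring
    rw [this, Real.sin_add_int_mul_pi, abs_mul, Real.sin_add_pi_div_two]
    rcases Int.even_or_odd m with h | h
    · simp [h.neg_one_zpow]
    · simp [h.neg_one_zpow]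
  have h2 : |u| ≤ Real.pi / 3 := by
    have e : u = Real.pi * (X - (m + 1 / 2) * θ) / θ := by rw [hu]; field_simp; ring
    rw [e, abs_le]
    constructor
    · rw [le_div_iff₀ hθ]; nlinarith [hX.1, mul_pos hpi hθ]
    · rw [div_le_iff₀ hθ]; nlinarith [hX.2, mul_pos hpi hθ]
  rw [h1, ← Real.cos_pi_div_three, ← Real.cos_abs u]
  exact (Real.cos_le_cos_of_nonneg_of_le_pi (abs_nonneg _) (by linarith) h2).trans (le_abs_self _)

/-- No bound on individual vertical lines is assumed, so a good one is found by averaging. By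
Tonelli the mean over a window of length θ/2 is at most 2yM²/(θ/2), and some line does not exceed
the mean. -/
theorem exists_vertical_line {E : Type*} [NormedAddCommGroup E] {g : ℂ → E} {d M : ℝ}
    (hg : ContinuousOn g {w | |w.im| < d}) (hy : y < d)
    (hy0 : 0 < y) (hθ : 0 < θ)
    (hgM : ∀ s : ℝ, s ≠ 0 → |s| < d →
      ∫⁻ t : ℝ, ‖g (t + s * Complex.I)‖ₑ ^ 2 ≤ ENNReal.ofReal (M ^ 2)) (m : ℤ) :
    ∃ X ∈ Icc ((m + 1 / 4) * θ) ((m + 3 / 4) * θ),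
      ∫⁻ s : ℝ in Ioc (-y) y, ‖g (X + s * Complex.I)‖ₑ ^ 2 ≤
        ENNReal.ofReal (4 * y * M ^ 2 / θ) := by
  set I := Icc ((m + 1 / 4) * θ) ((m + 3 / 4) * θ) with hI
  have hvol : volume I = ENNReal.ofReal (θ / 2) := by
    rw [hI, Real.volume_Icc]; congr 1; ring
  have hmeas : AEMeasurable (Function.uncurry fun (X : ℝ) (s : ℝ) =>
      ‖g (X + s * Complex.I)‖ₑ ^ 2)
      ((volume.restrict I).prod (volume.restrict (Ioc (-y) y))) := by
    rw [Measure.prod_restrict]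
    refine AEMeasurable.pow_const ?_ 2
    refine (ContinuousOn.aestronglyMeasurable ?_
      (measurableSet_Icc.prod measurableSet_Ioc)).enorm
    refine hg.comp (f := fun p : ℝ × ℝ => (p.1 + p.2 * Complex.I : ℂ)) (by fun_prop) ?_
    rintro ⟨X, s⟩ ⟨_, hs⟩
    simp only [mem_ofPred_eq, Complex.add_im, Complex.ofReal_im, Complex.mul_im, Complex.ofReal_re,
      Complex.I_im, mul_one, Complex.I_re, mul_zero, add_zero, zero_add]
    exact (abs_le.2 ⟨hs.1.le, hs.2⟩).trans_lt hy
  have hmeas' : AEMeasurable (fun X : ℝ => ∫⁻ s : ℝ in Ioc (-y) y, ‖g (X + s * Complex.I)‖ₑ ^ 2)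
      (volume.restrict I) := hmeas.lintegral_prod_right'
  obtain ⟨X, hX, hXle⟩ := exists_le_setLAverage (by rw [hvol]; simpa using hθ)
    (by rw [hvol]; simp) hmeas'
  refine ⟨X, hX, hXle.trans ?_⟩
  rw [setLAverage_eq, lintegral_lintegral_swap hmeas, hvol]
  have : ∫⁻ s : ℝ in Ioc (-y) y, ∫⁻ X in I, ‖g (X + s * Complex.I)‖ₑ ^ 2 ≤
      ∫⁻ s : ℝ in Ioc (-y) y, ENNReal.ofReal (M ^ 2) := by
    refine lintegral_mono_ae ?_
    -- The bound on horizontal lines excludes the real axis, as the N₂ norm does; a single line is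
    -- null in the double integral.
    have h0 : ∀ᵐ s : ℝ ∂(volume.restrict (Ioc (-y) y)), s ≠ 0 := by
      refine ae_restrict_of_ae ?_
      simp [ae_iff]
    filter_upwards [h0, ae_restrict_mem measurableSet_Ioc] with s hs0 hs
    exact (setLIntegral_le_lintegral _ _).trans
      (hgM s hs0 ((abs_le.2 ⟨hs.1.le, hs.2⟩).trans_lt hy))
  refine (ENNReal.div_le_div_right this _).trans (le_of_eq ?_)
  rw [lintegral_const, Measure.restrict_apply_univ, Real.volume_Ioc,
    ← ENNReal.ofReal_mul (by positivity), ← ENNReal.ofReal_div_of_pos (by positivity)]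
  congr 1
  field_simp
  ring

end SincError

/-! ### Sinc interpolation of functions analytic in a strip. -/

section SincInterpolation

variable {E : Type*} [NormedAddCommGroup E] [NormedSpace ℂ E] {g : ℂ → E} {θ y : ℝ}

/-- The value at `x` of the sinc function that is `1` at `kθ` and `0` at the other nodes. -/
def sincWeight (θ x : ℝ) (k : ℤ) : ℝ :=
  Real.sin (Real.pi * x / θ) * θ / (Real.pi * Real.cos (Real.pi * k) * (x - k * θ))

theorem abs_cos_pi_mul_int (k : ℤ) : |Real.cos (Real.pi * k)| = 1 := by
  rw [mul_comm, Real.cos_int_mul_pi]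
  rcases Int.even_or_odd k with h | h
  · simp [h.neg_one_zpow]
  · simp [h.neg_one_zpow]

theorem abs_sincWeight_le (hθ : 0 < θ) (x : ℝ) (k : ℤ) :
    |sincWeight θ x k| ≤ θ / (Real.pi * |x - k * θ|) := by
  rw [sincWeight, abs_div, abs_mul, abs_mul, abs_mul, abs_cos_pi_mul_int, mul_one,
    abs_of_pos Real.pi_pos, abs_of_pos hθ]
  gcongr
  exact mul_le_of_le_one_left hθ.le (Real.abs_sin_le_one _)

/-- The integrand has a simple pole at x, with residue g(x)/sin(πx/θ), and one at each node kθ. The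
windows for a and b make the rectangle enclose exactly the nodes with |k| ≤ N. After multiplication
by sin(πx/θ)/(2πi) the residues are g(x) and the terms of the interpolant with opposite sign. -/
theorem rectIntegral_sincKernel [CompleteSpace E] {d : ℝ}
    (hg : DifferentiableOn ℂ g {w | |w.im| < d})
    (hy : y < d) (hy0 : 0 < y) (hθ : 0 < θ) {x : ℝ} (hx : ∀ k : ℤ, x ≠ k * θ) {N : ℕ} {a b : ℝ}
    (ha : a ∈ Icc (((-N - 1 : ℤ) + 1 / 4) * θ) (((-N - 1 : ℤ) + 3 / 4) * θ))
    (hb : b ∈ Icc (((N : ℤ) + 1 / 4) * θ) (((N : ℤ) + 3 / 4) * θ)) (hax : a < x) (hxb : x < b) :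
    g x - ∑ k ∈ Finset.Icc (-N : ℤ) N, (sincWeight θ x k : ℂ) • g ((k * θ : ℝ) : ℂ) =
      ((2 * Real.pi * Complex.I)⁻¹ * Real.sin (Real.pi * x / θ) : ℂ) •
        rectIntegral a b y (fun w => sincKernel θ x w • g w) := by
  have hpi := Real.pi_pos
  have hpiC : (Real.pi : ℂ) ≠ 0 := by exact_mod_cast hpi.ne'
  have hθC : (θ : ℂ) ≠ 0 := by exact_mod_cast hθ.ne'
  set D : ℂ → ℂ := fun w => Complex.sin (Real.pi * w / θ) with hD
  have hDd : Differentiable ℂ D := by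
    intro w
    simp only [hD]
    fun_prop
  have hD0 : ∀ w, D w = 0 → ∃ k : ℤ, w = (k * θ : ℝ) := by
    intro w hw
    obtain ⟨k, hk⟩ := Complex.sin_eq_zero_iff.1 hw
    refine ⟨k, ?_⟩
    have : w = k * Real.pi * θ / Real.pi := by rw [← hk]; field_simp
    rw [this]
    push_cast
    field_simp
  have hDk : ∀ k : ℤ, D (k * θ : ℝ) = 0 := by
    intro k
    rw [hD]
    refine Complex.sin_eq_zero_iff.2 ⟨k, ?_⟩
    push_cast
    field_simp
  have hDx : D x ≠ 0 := by
    intro h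
    obtain ⟨k, hk⟩ := hD0 _ h
    exact hx k (by exact_mod_cast hk)
  have hDeriv : ∀ k : ℤ, deriv D (k * θ : ℝ) = Real.cos (Real.pi * k) * (Real.pi / θ) := by
    intro k
    have h1 : HasDerivAt (fun w : ℂ => Real.pi * w / θ) (Real.pi / θ : ℂ) ((k * θ : ℝ) : ℂ) := by
      simpa using ((hasDerivAt_id ((k * θ : ℝ) : ℂ)).const_mul (Real.pi : ℂ)).div_const (θ : ℂ)
    rw [hD, h1.csin.deriv]
    congr 1
    rw [Complex.ofReal_cos]
    congr 1
    push_cast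
    field_simp
  have hcos : ∀ k : ℤ, Real.cos (Real.pi * k) ≠ 0 := by
    intro k h
    have := abs_cos_pi_mul_int k
    rw [h] at this
    simp at this
  have hgat : ∀ w : ℂ, w.im ∈ Icc (-y) y → DifferentiableAt ℂ g w := by
    intro w hw
    refine (hg w ((abs_le.2 hw).trans_lt hy)).differentiableAt ?_
    exact (isOpen_lt (by fun_prop) continuous_const).mem_nhds ((abs_le.2 hw).trans_lt hy)
  have him : ∀ p : ℝ, (p : ℂ).im ∈ Icc (-y) y := by
    intro p
    simp [hy0.le]
  classical
  set T : Finset ℝ := (Finset.Icc (-N : ℤ) N).image (fun k : ℤ => k * θ) with hT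
  have hxT : x ∉ T := by
    intro h
    obtain ⟨k, _, hk⟩ := Finset.mem_image.1 h
    exact hx k hk.symm
  set c : ℝ → E := fun p => if p = x then (D x)⁻¹ • g x else (deriv D p * (p - x))⁻¹ • g p with hc
  have hres := rectIntegral_eq_sum_residues (f := fun w => sincKernel θ x w • g w)
    (hax.trans hxb) hy0 (insert x T) ?_ c ?_ ?_
  · rw [hres, Finset.sum_insert hxT, hT, Finset.sum_image, smul_smul, smul_add]
    · have e0 : ((2 * Real.pi * Complex.I)⁻¹ * Real.sin (Real.pi * x / θ) *
          (2 * Real.pi * Complex.I) : ℂ) = D x := by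
        rw [hD, Complex.ofReal_sin]
        push_cast
        field_simp
      rw [e0, hc]
      simp only [if_true]
      rw [smul_smul, mul_inv_cancel₀ hDx, one_smul, Finset.smul_sum, sub_eq_add_neg,
        ← Finset.sum_neg_distrib]
      congr 1
      refine Finset.sum_congr rfl fun k _ => ?_
      rw [if_neg (hx k).symm, smul_smul, ← neg_smul, hDeriv]
      congr 1
      have hne : ((k * θ : ℝ) : ℂ) - x ≠ 0 := by
        rw [sub_ne_zero]
        exact_mod_cast (hx k).symm
      have hne' : (x : ℂ) - k * θ ≠ 0 := by
        rw [sub_ne_zero]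
        exact_mod_cast hx k
      have hcosC : (Real.cos (Real.pi * k) : ℂ) ≠ 0 := by exact_mod_cast hcos k
      have eD : D x = (Real.sin (Real.pi * x / θ) : ℂ) := by
        rw [hD, Complex.ofReal_sin]
        push_cast
        rfl
      rw [eD, sincWeight]
      rw [show ((k * θ : ℝ) : ℂ) - x = -(x - k * θ) by push_cast; ring, Complex.ofReal_div,
        Complex.ofReal_mul, Complex.ofReal_mul, Complex.ofReal_mul, Complex.ofReal_sub,
        Complex.ofReal_mul, Complex.ofReal_intCast]
      field_simp
    · intro k _ l _ h
      have := mul_right_cancel₀ hθ.ne' h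
      exact_mod_cast this
  · intro p hp
    rcases Finset.mem_insert.1 hp with rfl | hp
    · exact ⟨hax, hxb⟩
    · obtain ⟨k, hk, rfl⟩ := Finset.mem_image.1 hp
      rw [Finset.mem_Icc] at hk
      have h1 : (-N : ℝ) ≤ k := by exact_mod_cast hk.1
      have h2 : (k : ℝ) ≤ N := by exact_mod_cast hk.2
      have h3 := ha.2
      have h4 := hb.1
      push_cast at h3 h4
      constructor <;> nlinarith
  · intro w hw1 hw2 hw3
    have hwx : w - x ≠ 0 := sub_ne_zero.2 (hw3 x (Finset.mem_insert_self _ _))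
    have hDw : D w ≠ 0 := by
      intro h
      obtain ⟨k, rfl⟩ := hD0 w h
      refine hw3 (k * θ) (Finset.mem_insert_of_mem (Finset.mem_image.2 ⟨k, ?_, rfl⟩)) rfl
      rw [Complex.ofReal_re] at hw1
      have h1 := ha.1.trans hw1.1
      have h2 := hw1.2.trans hb.2
      have h3 := lt_of_mul_lt_mul_right
        (show ((-N - 1 : ℤ) : ℝ) * θ < k * θ by push_cast at h1 ⊢; nlinarith) hθ.le
      have h4 := lt_of_mul_lt_mul_right
        (show (k : ℝ) * θ < ((N + 1 : ℤ) : ℝ) * θ by push_cast at h2 ⊢; nlinarith) hθ.le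
      have h3' : (-N - 1 : ℤ) < k := by exact_mod_cast h3
      have h4' : k < (N + 1 : ℤ) := by exact_mod_cast h4
      rw [Finset.mem_Icc]
      omega
    refine DifferentiableAt.smul ?_ (hgat w hw2)
    exact ((hDd w).mul (differentiableAt_id.sub_const _)).inv (mul_ne_zero hDw hwx)
  · intro p hp
    rcases Finset.mem_insert.1 hp with rfl | hp
    · refine ⟨fun w => (D w)⁻¹ • g w, ((hDd p).inv hDx).smul (hgat _ (him p)), ?_, ?_⟩
      · rw [hc]; simp
      · refine Eventually.of_forall fun w => ?_
        simp only [sincKernel]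
        rw [smul_smul, mul_inv, mul_comm]
    · have hpx : p ≠ x := fun h => hxT (h ▸ hp)
      obtain ⟨k, hk, rfl⟩ := Finset.mem_image.1 hp
      set P : ℂ := ((k * θ : ℝ) : ℂ) with hP
      -- `dslope D P` is the entire quotient D(w)/(w − P), equal to D'(P) ≠ 0 at P. This shows that
      -- the pole is simple and gives its residue.
      have hds : DifferentiableAt ℂ (dslope D P) P :=
        (((Complex.differentiableOn_dslope (s := univ) univ_mem).2
          hDd.differentiableOn).differentiableAt univ_mem)
      have hne : dslope D P P ≠ 0 := by
        rw [dslope_same, hDeriv]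
        have : (Real.cos (Real.pi * k) : ℂ) ≠ 0 := by exact_mod_cast hcos k
        exact mul_ne_zero this (div_ne_zero hpiC hθC)
      have hPx : P - x ≠ 0 := by
        rw [sub_ne_zero, hP]
        exact_mod_cast hpx
      refine ⟨fun w => (dslope D P w * (w - x))⁻¹ • g w, ?_, ?_, ?_⟩
      · refine DifferentiableAt.smul ?_ (hgat _ (him _))
        exact (hds.mul (differentiableAt_id.sub_const _)).inv (mul_ne_zero hne hPx)
      · rw [hc]
        simp only
        rw [if_neg hpx, dslope_same]
      · refine Eventually.of_forall fun w => ?_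
        have e : D w = (w - P) * dslope D P w := by
          have := sub_smul_dslope D P w
          rw [smul_eq_mul, hDk, sub_zero] at this
          exact this.symm
        simp only [sincKernel]
        change (D w * (w - x))⁻¹ • g w = _
        rw [e, smul_smul, mul_assoc, mul_inv]

/-- The horizontal sides give the main term, twice, against the prefactor 1/(2π). The vertical sides
vanish as N grows. This replaces convergence of the full cardinal series by a statement about large
partial sums. -/
theorem sinc_error_le [CompleteSpace E] {d M : ℝ} (hg : DifferentiableOn ℂ g {w | |w.im| < d})
    (hy : y < d) (hy0 : 0 < y) (hθ : 0 < θ) (hM : 0 ≤ M)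
    (hgM : ∀ s : ℝ, s ≠ 0 → |s| < d →
      ∫⁻ t : ℝ, ‖g (t + s * Complex.I)‖ₑ ^ 2 ≤ ENNReal.ofReal (M ^ 2))
    {x : ℝ} (hx : ∀ k : ℤ, x ≠ k * θ) {ε : ℝ} (hε : 0 < ε) :
    ∀ᶠ N : ℕ in atTop,
      ‖g x - ∑ k ∈ Finset.Icc (-N : ℤ) N, (sincWeight θ x k : ℂ) • g ((k * θ : ℝ) : ℂ)‖ ≤
        M / (√(Real.pi * y) * Real.sinh (Real.pi * y / θ)) + ε := by
  have hpi := Real.pi_pos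
  have hsh : 0 < Real.sinh (Real.pi * y / θ) := Real.sinh_pos_iff.2 (by positivity)
  set V := √(8 * y * (4 * y * M ^ 2 / θ)) with hV
  have hV0 : 0 ≤ V := Real.sqrt_nonneg _
  -- This places both vertical sides at distance at least V/ε from x, so that each contributes at
  -- most ε.
  obtain ⟨N₀, hN₀⟩ := exists_nat_gt ((|x| + V / ε + 1) / θ)
  filter_upwards [eventually_ge_atTop N₀] with N hN
  have hNθ : |x| + V / ε + 1 < N * θ := by
    rw [div_lt_iff₀ hθ] at hN₀
    have : (N₀ : ℝ) ≤ N := by exact_mod_cast hN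
    nlinarith
  have hVε : 0 ≤ V / ε := by positivity
  obtain ⟨a, ha, haV⟩ := exists_vertical_line hg.continuousOn hy hy0 hθ hgM (-N - 1)
  obtain ⟨b, hb, hbV⟩ := exists_vertical_line hg.continuousOn hy hy0 hθ hgM N
  have ha' : a < -(|x| + V / ε) := by
    have := ha.2
    push_cast at this
    nlinarith
  have hb' : |x| + V / ε < b := by
    have := hb.1
    push_cast at this
    nlinarith
  have hx1 := neg_abs_le x
  have hx2 := le_abs_self x
  have hax : a < x := by linarith
  have hxb : x < b := by linarith
  rw [rectIntegral_sincKernel hg hy hy0 hθ hx ha hb hax hxb, norm_smul]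
  have hpre : ‖((2 * Real.pi * Complex.I)⁻¹ * Real.sin (Real.pi * x / θ) : ℂ)‖ ≤
      (2 * Real.pi)⁻¹ := by
    rw [norm_mul, norm_inv, norm_mul, norm_mul, Complex.norm_I, Complex.norm_ofNat,
      Complex.norm_real, Complex.norm_real, Real.norm_of_nonneg hpi.le, mul_one, Real.norm_eq_abs]
    exact mul_le_of_le_one_right (by positivity) (Real.abs_sin_le_one _)
  have hline : ∀ σ : ℝ, |σ| ≤ y → Continuous fun t : ℝ => g (t + σ * Complex.I) := by
    intro σ hσ
    refine hg.continuousOn.comp_continuous (by fun_prop) fun t => ?_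
    simpa using hσ.trans_lt hy
  have hvert : ∀ X : ℝ, ContinuousOn (fun s : ℝ => g (X + s * Complex.I)) (Icc (-y) y) := by
    intro X
    refine hg.continuousOn.comp (by fun_prop) fun s hs => ?_
    simpa using (abs_le.2 hs).trans_lt hy
  have i1 := norm_integral_horizontal_le hθ (σ := -y) (by rw [abs_neg, abs_of_pos hy0]) hy0 x
    (hax.trans hxb).le (hline _ (by rw [abs_neg, abs_of_pos hy0])) hM
    (hgM _ (by linarith) (by rwa [abs_neg, abs_of_pos hy0]))
  have i2 := norm_integral_horizontal_le hθ (σ := y) (abs_of_pos hy0) hy0 x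
    (hax.trans hxb).le (hline _ (abs_of_pos hy0).le) hM
    (hgM _ hy0.ne' (by rwa [abs_of_pos hy0]))
  have i3 := norm_integral_vertical_le hax.ne (half_le_abs_sin_of_mem hθ ha) hy0 (hvert a)
    (by positivity) haV
  have i4 := norm_integral_vertical_le hxb.ne' (half_le_abs_sin_of_mem hθ hb) hy0 (hvert b)
    (by positivity) hbV
  rw [← hV] at i3 i4
  have key : ∀ X : ℝ, V / ε ≤ |X - x| → V / |X - x| ≤ ε := by
    intro X h
    rw [div_le_iff₀ hε] at h
    exact div_le_of_le_mul₀ (abs_nonneg _) hε.le (by linarith)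
  have i3' := i3.trans (key a (by rw [abs_sub_comm]; exact le_trans (by linarith) (le_abs_self _)))
  have i4' := i4.trans (key b (le_trans (by linarith) (le_abs_self _)))
  set H := √(Real.pi / y) / Real.sinh (Real.pi * y / θ) * M with hH
  have htot : ‖rectIntegral a b y (fun w => sincKernel θ x w • g w)‖ ≤ H + H + ε + ε := by
    unfold rectIntegral
    refine (norm_sub_le _ _).trans (add_le_add ((norm_add_le _ _).trans
      (add_le_add ((norm_sub_le _ _).trans (add_le_add i1 i2)) ?_)) ?_)
    · rw [norm_smul, Complex.norm_I, one_mul]; exact i4'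
    · rw [norm_smul, Complex.norm_I, one_mul]; exact i3'
  have hH0 : 0 ≤ H := by positivity
  calc _ ≤ (2 * Real.pi)⁻¹ * (H + H + ε + ε) := by gcongr
    _ = H / Real.pi + ε / Real.pi := by field_simp; ring
    _ ≤ _ := by
      have e : H / Real.pi = M / (√(Real.pi * y) * Real.sinh (Real.pi * y / θ)) := by
        rw [hH, Real.sqrt_div hpi.le, Real.sqrt_mul hpi.le]
        have := Real.mul_self_sqrt hpi.le
        have h1 : √Real.pi ≠ 0 := by positivity
        have h2 : √y ≠ 0 := by positivity
        field_simp
        nlinarith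
      rw [e]
      gcongr
      exact div_le_self hε.le (by linarith [Real.pi_gt_three])

end SincInterpolation

/-! ### Projection error for a space containing finitely many samples. -/

section StripApproximation

/-- The exponential tail telescopes, since r exp(−(N+1)r) ≤ exp(−Nr) − exp(−(N+1)r). Keeping the
negative term makes the induction close. -/
theorem norm_sum_Icc_sub_sum_Icc_le {E : Type*} [NormedAddCommGroup E] {v : ℤ → E} {A r : ℝ}
    (hr : 0 < r) (hA : 0 ≤ A) {K : ℕ}
    (hv : ∀ k : ℤ, (K : ℤ) < |k| → ‖v k‖ ≤ A * Real.exp (-(|(k : ℝ)| * r))) {N : ℕ}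
    (hN : K ≤ N) :
    ‖∑ k ∈ Finset.Icc (-N : ℤ) N, v k - ∑ k ∈ Finset.Icc (-K : ℤ) K, v k‖ ≤
      2 * A / r * (Real.exp (-(K * r)) - Real.exp (-(N * r))) := by
  induction N, hN using Nat.le_induction with
  | base => simp
  | succ N hN ih =>
    have hI : Finset.Icc (-(N + 1 : ℕ) : ℤ) (N + 1 : ℕ) =
        insert ((N + 1 : ℕ) : ℤ) (insert (-(N + 1 : ℕ) : ℤ) (Finset.Icc (-N : ℤ) N)) := by
      ext k
      simp only [Finset.mem_Icc, Finset.mem_insert]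
      omega
    have hn1 : (-(N + 1 : ℕ) : ℤ) ∉ Finset.Icc (-N : ℤ) N := by
      simp only [Finset.mem_Icc]; omega
    have hn2 : ((N + 1 : ℕ) : ℤ) ∉ insert (-(N + 1 : ℕ) : ℤ) (Finset.Icc (-N : ℤ) N) := by
      simp only [Finset.mem_Icc, Finset.mem_insert]; omega
    rw [hI, Finset.sum_insert hn2, Finset.sum_insert hn1]
    have hNn : (0 : ℝ) ≤ N := N.cast_nonneg
    have h1 : ‖v ((N + 1 : ℕ) : ℤ)‖ ≤ A * Real.exp (-((N + 1) * r)) := by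
      have := hv ((N + 1 : ℕ) : ℤ) (by rw [abs_of_nonneg (by omega)]; omega)
      rw [abs_of_nonneg (by push_cast; linarith)] at this
      simpa using this
    have h2 : ‖v (-(N + 1 : ℕ) : ℤ)‖ ≤ A * Real.exp (-((N + 1) * r)) := by
      have := hv (-(N + 1 : ℕ) : ℤ) (by rw [abs_neg, abs_of_nonneg (by omega)]; omega)
      rw [Int.cast_neg, abs_neg, abs_of_nonneg (by push_cast; linarith)] at this
      simpa using this
    have h3 : r * Real.exp (-((N + 1) * r)) ≤
        Real.exp (-(N * r)) - Real.exp (-((N + 1) * r)) := by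
      have : Real.exp (-(N * r)) = Real.exp (-((N + 1) * r)) * Real.exp r := by
        rw [← Real.exp_add]; ring_nf
      rw [this]
      nlinarith [Real.add_one_le_exp r, Real.exp_pos (-((N + 1) * r))]
    calc _ = ‖v ((N + 1 : ℕ) : ℤ) + v (-(N + 1 : ℕ) : ℤ) +
          (∑ k ∈ Finset.Icc (-N : ℤ) N, v k - ∑ k ∈ Finset.Icc (-K : ℤ) K, v k)‖ := by
          congr 1; abel
      _ ≤ A * Real.exp (-((N + 1) * r)) + A * Real.exp (-((N + 1) * r)) +
          2 * A / r * (Real.exp (-(K * r)) - Real.exp (-(N * r))) :=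
          (norm_add_le _ _).trans (add_le_add ((norm_add_le _ _).trans (add_le_add h1 h2)) ih)
      _ = 2 * A / r * (r * Real.exp (-((N + 1) * r)) +
          (Real.exp (-(K * r)) - Real.exp (-(N * r)))) := by field_simp; ring
      _ ≤ 2 * A / r * ((Real.exp (-(N * r)) - Real.exp (-((N + 1) * r))) +
          (Real.exp (-(K * r)) - Real.exp (-(N * r)))) := by gcongr
      _ = _ := by push_cast; ring

theorem lintegral_exp_neg_abs_le (c : ℝ) :
    ∫⁻ x in {x : ℝ | c < |x|}, ENNReal.ofReal (Real.exp (-|x|)) ≤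
      ENNReal.ofReal (2 * Real.exp (-c)) := by
  have h1 : ∫⁻ x in Ioi c, ENNReal.ofReal (Real.exp (-x)) = ENNReal.ofReal (Real.exp (-c)) := by
    rw [← ofReal_integral_eq_lintegral_ofReal (integrableOn_exp_neg_Ioi c)
      (Eventually.of_forall fun x => (Real.exp_pos _).le), integral_exp_neg_Ioi]
  have h2 : ∫⁻ x in Iic (-c), ENNReal.ofReal (Real.exp x) = ENNReal.ofReal (Real.exp (-c)) := by
    rw [← ofReal_integral_eq_lintegral_ofReal (integrableOn_exp_Iic _)
      (Eventually.of_forall fun x => (Real.exp_pos _).le), integral_exp_Iic]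
  have hsub : {x : ℝ | c < |x|} ⊆ Ioi c ∪ Iic (-c) := by
    intro x hx
    rcases lt_abs.1 (show c < |x| from hx) with h | h
    · exact Or.inl h
    · exact Or.inr (by simp; linarith)
  calc _ ≤ ∫⁻ x in Ioi c ∪ Iic (-c), ENNReal.ofReal (Real.exp (-|x|)) :=
        lintegral_mono_set hsub
    _ ≤ (∫⁻ x in Ioi c, ENNReal.ofReal (Real.exp (-|x|))) +
        ∫⁻ x in Iic (-c), ENNReal.ofReal (Real.exp (-|x|)) := lintegral_union_le _ _ _
    _ ≤ (∫⁻ x in Ioi c, ENNReal.ofReal (Real.exp (-x))) +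
        ∫⁻ x in Iic (-c), ENNReal.ofReal (Real.exp x) := by
      refine add_le_add (lintegral_mono fun x => ?_) (lintegral_mono fun x => ?_)
      · exact ENNReal.ofReal_le_ofReal (Real.exp_le_exp.2 (by linarith [le_abs_self x]))
      · exact ENNReal.ofReal_le_ofReal (Real.exp_le_exp.2 (by linarith [neg_abs_le x]))
    _ = _ := by
      rw [h1, h2, ← ENNReal.ofReal_add (Real.exp_pos _).le (Real.exp_pos _).le]
      ring_nf

theorem inv_sinh_le {u v : ℝ} (hu : 0 < u) (huv : u ≤ v) :
    (Real.sinh v)⁻¹ ≤ 2 / (1 - Real.exp (-(2 * u))) * Real.exp (-v) := by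
  have h1 : Real.exp (-(2 * u)) < 1 := Real.exp_lt_one_iff.2 (by linarith)
  have h2 : Real.exp (-(2 * v)) ≤ Real.exp (-(2 * u)) := Real.exp_le_exp.2 (by linarith)
  have h3 : Real.sinh v = Real.exp v * (1 - Real.exp (-(2 * v))) / 2 := by
    rw [Real.sinh_eq, mul_sub, ← Real.exp_add]; ring_nf
  have h4 : 0 < 1 - Real.exp (-(2 * u)) := by linarith
  have h5 := Real.exp_pos v
  rw [Real.exp_neg v, ← div_eq_mul_inv, div_div, inv_eq_one_div, div_le_div_iff₀ _ (by positivity),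
    h3]
  · nlinarith
  · rw [Real.sinh_pos_iff]; linarith

variable {V : Type*} [NormedAddCommGroup V] [InnerProductSpace ℂ V]

theorem norm_sub_starProjection_le (W : Submodule ℂ V) [W.HasOrthogonalProjection] (v : V) {w : V}
    (hw : w ∈ W) : ‖v - W.starProjection v‖ ≤ ‖v - w‖ := by
  have h : v - W.starProjection v = Wᗮ.starProjection (v - w) := by
    rw [Submodule.starProjection_orthogonal_val, map_sub, Submodule.starProjection_eq_self_iff.2 hw]
    abel
  rw [h]
  exact Submodule.norm_starProjection_apply_le _ _

theorem norm_sub_starProjection_le_self (W : Submodule ℂ V) [W.HasOrthogonalProjection] (v : V) :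
    ‖v - W.starProjection v‖ ≤ ‖v‖ := by
  simpa using norm_sub_starProjection_le W v W.zero_mem

variable [CompleteSpace V] {g : ℂ → V} {d M B : ℝ}

/-- The interpolant truncated at K lies in W, so its error bounds that of the projection. The error
splits into the contour part, for some large N, and the nodes with K < |k| ≤ N. For the latter, |x|
+ 1 ≤ Kθ keeps x at distance at least one from kθ, which bounds the weights by θ/π. At a node the
projection error is zero. -/
theorem norm_sub_starProjection_le_of_nodes (hg : DifferentiableOn ℂ g {w | |w.im| < d})
    (hd : 0 < d) (hM : 0 ≤ M) (hB : 0 ≤ B)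
    (hgM : ∀ s : ℝ, s ≠ 0 → |s| < d →
      ∫⁻ t : ℝ, ‖g (t + s * Complex.I)‖ₑ ^ 2 ≤ ENNReal.ofReal (M ^ 2))
    (hgB : ∀ x : ℝ, ‖g x‖ ≤ B * Real.exp (-(|x| / 2)))
    {θ : ℝ} (hθ : 0 < θ) {K : ℕ} (W : Submodule ℂ V) [W.HasOrthogonalProjection]
    (hW : ∀ k : ℤ, |k| ≤ K → g ((k * θ : ℝ) : ℂ) ∈ W) {x : ℝ} (hxK : |x| + 1 ≤ K * θ) :
    ‖g x - W.starProjection (g x)‖ ≤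
      M / (√(Real.pi * d) * Real.sinh (Real.pi * d / θ)) + 2 * B * Real.exp (-(K * θ / 2)) := by
  have hpi := Real.pi_pos
  have hshd : 0 < Real.sinh (Real.pi * d / θ) := Real.sinh_pos_iff.2 (by positivity)
  by_cases hx : ∃ k : ℤ, x = k * θ
  · obtain ⟨k, rfl⟩ := hx
    have hk : |k| ≤ (K : ℤ) := by
      rw [abs_mul, abs_of_pos hθ] at hxK
      have : |(k : ℝ)| ≤ K := le_of_mul_le_mul_right (by linarith) hθ
      exact_mod_cast this
    rw [Submodule.starProjection_eq_self_iff.2 (hW k hk), sub_self, norm_zero]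
    positivity
  push Not at hx
  set w := ∑ k ∈ Finset.Icc (-K : ℤ) K, (sincWeight θ x k : ℂ) • g ((k * θ : ℝ) : ℂ) with hw
  have hwW : w ∈ W := by
    refine W.sum_mem fun k hk => W.smul_mem _ (hW k ?_)
    rw [Finset.mem_Icc] at hk
    exact abs_le.2 hk
  refine (norm_sub_starProjection_le W _ hwW).trans ?_
  have htail : ∀ k : ℤ, (K : ℤ) < |k| → ‖(sincWeight θ x k : ℂ) • g ((k * θ : ℝ) : ℂ)‖ ≤
      (θ / Real.pi * B) * Real.exp (-(|(k : ℝ)| * (θ / 2))) := by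
    intro k hk
    have hkK : (K : ℝ) ≤ |(k : ℝ)| := by exact_mod_cast hk.le
    have hdist : 1 ≤ |x - k * θ| := by
      have h1 : |(k : ℝ) * θ| ≤ |x - k * θ| + |x| := by
        have := abs_sub_abs_le_abs_sub ((k : ℝ) * θ) x
        rw [abs_sub_comm] at this
        linarith
      rw [abs_mul, abs_of_pos hθ] at h1
      nlinarith
    rw [norm_smul, Complex.norm_real, Real.norm_eq_abs, mul_assoc]
    refine mul_le_mul ((abs_sincWeight_le hθ x k).trans ?_) ?_ (norm_nonneg _) (by positivity)
    · rw [← div_div]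
      exact div_le_self (by positivity) hdist
    · refine (hgB _).trans (le_of_eq ?_)
      rw [abs_mul, abs_of_pos hθ, mul_div_assoc]
  have hy : ∀ y ∈ Ioo 0 d, ‖g x - w‖ ≤
      M / (√(Real.pi * y) * Real.sinh (Real.pi * y / θ)) + 2 * B * Real.exp (-(K * θ / 2)) := by
    intro y hy
    refine le_of_forall_pos_le_add fun ε hε => ?_
    obtain ⟨N, hN, hNK⟩ := ((sinc_error_le hg hy.2 hy.1 hθ hM hgM hx hε).and
      (eventually_ge_atTop K)).exists
    have h2 := norm_sum_Icc_sub_sum_Icc_le (by positivity) (by positivity) htail hNK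
    rw [← hw] at h2
    have h3 : 2 * (θ / Real.pi * B) / (θ / 2) *
        (Real.exp (-(K * (θ / 2))) - Real.exp (-(N * (θ / 2)))) ≤
          2 * B * Real.exp (-(K * θ / 2)) := by
      have e : 2 * (θ / Real.pi * B) / (θ / 2) = 4 / Real.pi * B := by field_simp; ring
      rw [e, mul_div_assoc]
      have h4 : 4 / Real.pi ≤ 2 := by
        rw [div_le_iff₀ hpi]; linarith [Real.pi_gt_three]
      have h5 := Real.exp_pos (-(N * (θ / 2)))
      have h6 := Real.exp_pos (-(K * (θ / 2)))
      calc _ ≤ 4 / Real.pi * B * Real.exp (-(K * (θ / 2))) := by gcongr; linarith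
        _ ≤ _ := by gcongr
    calc ‖g x - w‖ = ‖(g x - ∑ k ∈ Finset.Icc (-N : ℤ) N,
          (sincWeight θ x k : ℂ) • g ((k * θ : ℝ) : ℂ)) +
          (∑ k ∈ Finset.Icc (-N : ℤ) N, (sincWeight θ x k : ℂ) • g ((k * θ : ℝ) : ℂ) - w)‖ := by
          congr 1; abel
      _ ≤ _ := by
        refine (norm_add_le _ _).trans ((add_le_add hN (h2.trans h3)).trans (le_of_eq ?_))
        ring
  -- The estimate is available only for y < d; continuity of the bound in y lets y increase to d.
  have hlim : Tendsto (fun y : ℝ => M / (√(Real.pi * y) * Real.sinh (Real.pi * y / θ)) +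
      2 * B * Real.exp (-(K * θ / 2))) (𝓝[<] d)
      (𝓝 (M / (√(Real.pi * d) * Real.sinh (Real.pi * d / θ)) +
        2 * B * Real.exp (-(K * θ / 2)))) := by
    apply tendsto_nhdsWithin_of_tendsto_nhds
    have : ContinuousAt (fun y : ℝ => M / (√(Real.pi * y) * Real.sinh (Real.pi * y / θ)) +
      2 * B * Real.exp (-(K * θ / 2))) d := by
      refine ContinuousAt.add (ContinuousAt.div continuousAt_const ?_ (by positivity))
        continuousAt_const
      exact ContinuousAt.mul (by fun_prop)
        (Real.continuous_sinh.continuousAt.comp (by fun_prop))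
    exact this
  refine ge_of_tendsto hlim ?_
  filter_upwards [Ioo_mem_nhdsLT hd] with y hy' using hy y hy'

/-- The constant of the sinc approximation in the strip of half-width `d`. -/
def stripConst (d : ℝ) : ℝ :=
  4 * √(2 * Real.pi * d) *
    (4 / (Real.pi * d * (1 - Real.exp (-√(2 * Real.pi * d))) ^ 2) + 4) + 6

theorem stripConst_pos {d : ℝ} : 0 < d → 0 < stripConst d := by
  intro hd
  have := Real.pi_pos
  unfold stripConst
  positivity

/-- Put L = √(2πdK). The spacing balances the two errors: πd/θ = Kθ/2 = L/2. On |x| ≤ L − 1 the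
squared error is of order exp(−L), and the length 2L of the range produces the factor √K. For |x| >
L − 1 the projection error is at most ‖g x‖, whose square integrates to order exp(−L). -/
theorem lintegral_sub_starProjection_le_of_nodes (hg : DifferentiableOn ℂ g {w | |w.im| < d})
    (hd : 0 < d) (hM : 0 ≤ M) (hB : 0 ≤ B)
    (hgM : ∀ s : ℝ, s ≠ 0 → |s| < d →
      ∫⁻ t : ℝ, ‖g (t + s * Complex.I)‖ₑ ^ 2 ≤ ENNReal.ofReal (M ^ 2))
    (hgB : ∀ x : ℝ, ‖g x‖ ≤ B * Real.exp (-(|x| / 2)))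
    {K : ℕ} (hK : 1 ≤ K) (W : Submodule ℂ V) [W.HasOrthogonalProjection]
    (hW : ∀ k : ℤ, |k| ≤ K → g ((k * √(2 * Real.pi * d / K) : ℝ) : ℂ) ∈ W) :
    ∫⁻ x : ℝ, ‖g x - W.starProjection (g x)‖ₑ ^ 2 ≤
      ENNReal.ofReal (stripConst d * (√K * Real.exp (-√(2 * Real.pi * d * K)) *
        (M ^ 2 + B ^ 2))) := by
  have hpi := Real.pi_pos
  have hK0 : (0 : ℝ) < K := by exact_mod_cast hK
  have hK1 : 1 ≤ √(K : ℝ) := by rw [Real.one_le_sqrt]; exact_mod_cast hK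
  set θ := √(2 * Real.pi * d / K) with hθdef
  have hθ : 0 < θ := by positivity
  set l := √(2 * Real.pi * d) with hl
  have hl0 : 0 < l := by positivity
  set L := √(2 * Real.pi * d * K) with hL
  have hLl : L = l * √K := by rw [hL, hl, Real.sqrt_mul (by positivity)]
  have hLK : K * θ = L := by
    rw [← Real.sqrt_sq (by positivity : 0 ≤ K * θ), mul_pow, hθdef, hL,
      Real.sq_sqrt (by positivity)]
    congr 1
    field_simp
  have hdθ : Real.pi * d / θ = L / 2 := by
    have h1 : θ ^ 2 = 2 * Real.pi * d / K := by rw [hθdef, Real.sq_sqrt (by positivity)]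
    rw [← hLK, div_eq_div_iff hθ.ne' two_ne_zero]
    have : K * θ ^ 2 = 2 * Real.pi * d := by rw [h1]; field_simp
    nlinarith
  have hlL : l ≤ L := by rw [hLl]; exact le_mul_of_one_le_right hl0.le hK1
  set q := 1 - Real.exp (-l) with hq
  have hq0 : 0 < q := by
    have : Real.exp (-l) < 1 := Real.exp_lt_one_iff.2 (by linarith)
    rw [hq]; linarith
  have hpt : ∀ x : ℝ, |x| + 1 ≤ L → ‖g x - W.starProjection (g x)‖ ^ 2 ≤
      2 * Real.exp (-L) * (4 / (Real.pi * d * q ^ 2) * M ^ 2 + 4 * B ^ 2) := by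
    intro x hx
    have h1 := norm_sub_starProjection_le_of_nodes hg hd hM hB hgM hgB hθ W hW (x := x)
      (by rw [hLK]; exact hx)
    rw [hdθ, hLK] at h1
    -- K ≥ 1 gives L ≥ l, so 1/sinh(L/2) is compared with exp(−L/2) with a constant depending on d
    -- only.
    have h2 := inv_sinh_le (u := l / 2) (v := L / 2) (by positivity) (by linarith)
    rw [show 2 * (l / 2) = l by ring, ← hq] at h2
    have h3 : M / (√(Real.pi * d) * Real.sinh (L / 2)) ≤
        M / √(Real.pi * d) * (2 / q) * Real.exp (-(L / 2)) := by
      rw [← div_div, div_eq_mul_inv (M / √(Real.pi * d)), mul_assoc (M / √(Real.pi * d))]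
      gcongr
    have hexp : Real.exp (-(L / 2)) ^ 2 = Real.exp (-L) := by
      rw [← Real.exp_nat_mul]; congr 1; push_cast; ring
    calc _ ≤ (M / √(Real.pi * d) * (2 / q) * Real.exp (-(L / 2)) +
            2 * B * Real.exp (-(L / 2))) ^ 2 := by
          gcongr; exact h1.trans (by gcongr)
      _ = (M / √(Real.pi * d) * (2 / q) + 2 * B) ^ 2 * Real.exp (-(L / 2)) ^ 2 := by ring
      _ ≤ 2 * ((M / √(Real.pi * d) * (2 / q)) ^ 2 + (2 * B) ^ 2) * Real.exp (-(L / 2)) ^ 2 := by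
          gcongr
          exact add_sq_le
      _ = _ := by
          rw [hexp, mul_pow, div_pow, Real.sq_sqrt (by positivity)]
          field_simp
          ring
  set X := 2 * Real.exp (-L) * (4 / (Real.pi * d * q ^ 2) * M ^ 2 + 4 * B ^ 2) with hX
  have hX0 : 0 ≤ X := by positivity
  have hint1 : ∫⁻ x in Icc (-(L - 1)) (L - 1), ‖g x - W.starProjection (g x)‖ₑ ^ 2 ≤
      ENNReal.ofReal (X * (2 * L)) := by
    calc _ ≤ ∫⁻ x : ℝ in Icc (-(L - 1)) (L - 1), ENNReal.ofReal X := by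
          refine setLIntegral_mono' measurableSet_Icc fun x hx => ?_
          rw [← ofReal_norm, ← ENNReal.ofReal_pow (norm_nonneg _)]
          exact ENNReal.ofReal_le_ofReal (hpt x (by linarith [abs_le.2 hx]))
      _ ≤ _ := by
          rw [lintegral_const, Measure.restrict_apply_univ, Real.volume_Icc,
            ← ENNReal.ofReal_mul hX0]
          apply ENNReal.ofReal_le_ofReal
          gcongr
          linarith
  have hint2 : ∫⁻ x in {x : ℝ | L - 1 < |x|}, ‖g x - W.starProjection (g x)‖ₑ ^ 2 ≤
      ENNReal.ofReal (B ^ 2 * (2 * Real.exp (-(L - 1)))) := by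
    calc _ ≤ ∫⁻ x in {x : ℝ | L - 1 < |x|}, ENNReal.ofReal (B ^ 2) *
          ENNReal.ofReal (Real.exp (-|x|)) := by
          refine lintegral_mono fun x => ?_
          rw [← ofReal_norm, ← ENNReal.ofReal_pow (norm_nonneg _),
            ← ENNReal.ofReal_mul (by positivity)]
          apply ENNReal.ofReal_le_ofReal
          calc _ ≤ (B * Real.exp (-(|x| / 2))) ^ 2 := by
                gcongr
                exact (norm_sub_starProjection_le_self W _).trans (hgB x)
            _ = _ := by
                rw [mul_pow, ← Real.exp_nat_mul]; congr 2; push_cast; ring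
      _ ≤ _ := by
          rw [lintegral_const_mul' _ _ (by simp), ENNReal.ofReal_mul (by positivity)]
          gcongr
          exact lintegral_exp_neg_abs_le _
  have hcover : (univ : Set ℝ) ⊆ Icc (-(L - 1)) (L - 1) ∪ {x : ℝ | L - 1 < |x|} := by
    intro x _
    rcases le_or_gt |x| (L - 1) with h | h
    · exact Or.inl (abs_le.1 h)
    · exact Or.inr h
  rw [← setLIntegral_univ]
  refine (lintegral_mono_set hcover).trans ((lintegral_union_le _ _ _).trans
    ((add_le_add hint1 hint2).trans ?_))
  rw [← ENNReal.ofReal_add (by positivity) (by positivity)]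
  apply ENNReal.ofReal_le_ofReal
  have he : Real.exp (-(L - 1)) ≤ 3 * Real.exp (-L) := by
    rw [show -(L - 1) = 1 + -L by ring, Real.exp_add]
    gcongr
    exact (Real.exp_one_lt_d9.trans (by norm_num)).le
  have hE := Real.exp_pos (-L)
  calc _ ≤ X * (2 * L) + B ^ 2 * (2 * (3 * Real.exp (-L))) * √K := by
        refine add_le_add le_rfl ?_
        refine le_trans ?_ (le_mul_of_one_le_right (by positivity) hK1)
        gcongr
    _ = √K * Real.exp (-L) * (4 * l * (4 / (Real.pi * d * q ^ 2) * M ^ 2 + 4 * B ^ 2) +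
          6 * B ^ 2) := by rw [hX, hLl]; ring
    _ ≤ √K * Real.exp (-L) * (stripConst d * (M ^ 2 + B ^ 2)) := by
        gcongr
        rw [stripConst, ← hl, ← hq]
        have hA : 0 ≤ 4 / (Real.pi * d * q ^ 2) := by positivity
        set A := 4 / (Real.pi * d * q ^ 2)
        have e : (4 * l * (A + 4) + 6) * (M ^ 2 + B ^ 2) =
          (4 * l * (A * M ^ 2 + 4 * B ^ 2) + 6 * B ^ 2) +
            (4 * l * A * B ^ 2 + 16 * l * M ^ 2 + 6 * M ^ 2) := by ring
        rw [e]
        have : 0 ≤ 4 * l * A * B ^ 2 + 16 * l * M ^ 2 + 6 * M ^ 2 := by positivity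
        linarith
    _ = _ := by ring

end StripApproximation

/-! ### The substitution z = sinh w and the symbol of the resolvent. -/

section Hyperbolic

theorem sinh_strip (x s : ℝ) : Complex.sinh (x + s * Complex.I) =
    (Real.sinh x * Real.cos s : ℝ) + (Real.cosh x * Real.sin s : ℝ) * Complex.I := by
  rw [Complex.sinh_add, Complex.cosh_mul_I, Complex.sinh_mul_I]
  push_cast
  ring

theorem cosh_strip (x s : ℝ) : Complex.cosh (x + s * Complex.I) =
    (Real.cosh x * Real.cos s : ℝ) + (Real.sinh x * Real.sin s : ℝ) * Complex.I := by
  rw [Complex.cosh_add, Complex.cosh_mul_I, Complex.sinh_mul_I]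
  push_cast
  ring

theorem cosh_re_pos {w : ℂ} (hw : |w.im| < Real.pi / 2) : 0 < (Complex.cosh w).re := by
  rw [← Complex.re_add_im w, cosh_strip]
  simp only [Complex.add_re, Complex.ofReal_re, Complex.mul_re, Complex.I_re, mul_zero,
    Complex.ofReal_im, Complex.I_im, mul_one, sub_self, add_zero]
  exact mul_pos (Real.cosh_pos _) (Real.cos_pos_of_mem_Ioo (abs_lt.1 hw))

theorem norm_cosh_strip_le (x s : ℝ) : ‖Complex.cosh (x + s * Complex.I)‖ ≤ Real.cosh x := by
  refine (le_abs_self _).trans (abs_le_of_sq_le_sq ?_ (Real.cosh_pos x).le)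
  rw [cosh_strip, ← Complex.normSq_eq_norm_sq, Complex.normSq_add_mul_I]
  nlinarith [Real.cosh_sq x, Real.sin_sq_add_cos_sq s, sq_nonneg (Real.sin s)]

/-- As Re cosh w > 0 in the strip, the principal root of 1 + sinh² w is cosh w; then sinh w + cosh w
= exp w, whose argument is Im w. -/
theorem sinh_mem_dom {d : ℝ} (hd : d ≤ Real.pi / 2) {w : ℂ} (hw : |w.im| < d) :
    Complex.sinh w ∈ dom d := by
  have h1 : (1 + Complex.sinh w ^ 2) ^ (1 / 2 : ℂ) = Complex.cosh w := by
    rw [add_comm, ← Complex.cosh_sq, one_div]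
    exact Complex.sq_cpow_two_inv (cosh_re_pos (hw.trans_le hd))
  change |Complex.arg (Complex.sinh w + (1 + Complex.sinh w ^ 2) ^ (1 / 2 : ℂ))| < d
  have hpi := Real.pi_pos
  have h2 := abs_lt.1 hw
  rw [h1, Complex.sinh_add_cosh, ← Complex.log_im, Complex.log_exp (by linarith) (by linarith)]
  exact hw

theorem exp_abs_le_two_mul_cosh (x : ℝ) : Real.exp |x| ≤ 2 * Real.cosh x := by
  rw [← Real.cosh_abs, Real.cosh_eq]
  linarith [Real.exp_pos (-|x|)]

/-- The majorant is 2 exp(−|x|). The tail estimate covers all of ℝ for every threshold c < 0, and c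
→ 0 gives the constant. -/
theorem lintegral_inv_cosh_le : ∫⁻ x : ℝ, ENNReal.ofReal ((Real.cosh x)⁻¹) ≤ 4 := by
  have key : ∀ c : ℝ, c < 0 → ∫⁻ x : ℝ, ENNReal.ofReal ((Real.cosh x)⁻¹) ≤
      ENNReal.ofReal (4 * Real.exp (-c)) := by
    intro c hc
    have h := lintegral_exp_neg_abs_le c
    have hu : {x : ℝ | c < |x|} = univ := by
      ext x
      exact ⟨fun _ => trivial, fun _ => lt_of_lt_of_le hc (abs_nonneg x)⟩
    rw [hu, setLIntegral_univ] at h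
    calc _ ≤ ∫⁻ x : ℝ, ENNReal.ofReal 2 * ENNReal.ofReal (Real.exp (-|x|)) := by
          refine lintegral_mono fun x => ?_
          rw [← ENNReal.ofReal_mul (by norm_num)]
          apply ENNReal.ofReal_le_ofReal
          rw [Real.exp_neg, ← div_eq_mul_inv, inv_eq_one_div,
            div_le_div_iff₀ (Real.cosh_pos x) (Real.exp_pos _), one_mul]
          exact exp_abs_le_two_mul_cosh x
      _ ≤ _ := by
          rw [lintegral_const_mul' _ _ (by simp)]
          refine (mul_le_mul_right h _).trans (le_of_eq ?_)
          rw [← ENNReal.ofReal_mul (by norm_num)]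
          ring_nf
  have hlim : Tendsto (fun c : ℝ => ENNReal.ofReal (4 * Real.exp (-c))) (𝓝[<] 0)
      (𝓝 (ENNReal.ofReal (4 * Real.exp (-0)))) := by
    apply tendsto_nhdsWithin_of_tendsto_nhds
    exact (ENNReal.continuous_ofReal.comp (by fun_prop)).tendsto (0 : ℝ)
  have := ge_of_tendsto hlim (eventually_nhdsWithin_of_forall key)
  simpa using this

theorem lintegral_comp_sinh (h : ℝ → ℝ≥0∞) :
    ∫⁻ τ : ℝ, h τ = ∫⁻ x : ℝ, ENNReal.ofReal (Real.cosh x) * h (Real.sinh x) := by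
  have := lintegral_image_eq_lintegral_abs_deriv_mul (s := univ) (f := Real.sinh)
    (f' := Real.cosh) MeasurableSet.univ (fun x _ => (Real.hasDerivAt_sinh x).hasDerivWithinAt)
    Real.sinh_injective.injOn h
  rw [image_univ, Real.sinh_surjective.range_eq, setLIntegral_univ, setLIntegral_univ] at this
  rw [this]
  refine lintegral_congr fun x => ?_
  rw [abs_of_pos (Real.cosh_pos x)]

/-- With ν = p + αm, c = cosh x and σ = sin s, the symbol is (ν − mcσ) + i m sinh x cos s. Its
modulus is at least (1 − sin d) max(ν, mc). The bound by ν controls data in V⋆; the bound by mc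
gives the extra decay 1/cosh x for data entering through the embedding V ⊆ V⋆. -/
theorem resolvent_symbol_lower_bound {d s x α m p : ℝ} (hd : d < Real.pi / 2) (hs : |s| ≤ d)
    (hm : 0 ≤ m) (hν : m ≤ p + α * m) :
    (1 - Real.sin d) * (p + α * m) ≤
      ‖((α + Complex.I * Complex.sinh (x + s * Complex.I)) * m + p : ℂ)‖ ∧
    (1 - Real.sin d) * (m * Real.cosh x) ≤
      ‖((α + Complex.I * Complex.sinh (x + s * Complex.I)) * m + p : ℂ)‖ := by
  have hpi := Real.pi_pos
  obtain ⟨hs1, hs2⟩ := abs_le.1 hs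
  have hS1 : Real.sin s ≤ Real.sin d :=
    Real.sin_le_sin_of_le_of_le_pi_div_two (by linarith) hd.le hs2
  have hS3 : Real.sin d ≤ 1 := Real.sin_le_one d
  have hS0 : 0 ≤ Real.sin d :=
    Real.sin_nonneg_of_nonneg_of_le_pi ((abs_nonneg s).trans hs) (by linarith)
  have hSm : -1 ≤ Real.sin s := Real.neg_one_le_sin s
  set ν := p + α * m with hνdef
  set c := Real.cosh x with hc
  set σ := Real.sin s with hσ
  set S := Real.sin d with hS
  have hc1 : 1 ≤ c := Real.one_le_cosh x
  have hN : ‖((α + Complex.I * Complex.sinh (x + s * Complex.I)) * m + p : ℂ)‖ ^ 2 =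
      (ν - m * c * σ) ^ 2 + m ^ 2 * (c ^ 2 - 1) * (1 - σ ^ 2) := by
    have e : ((α + Complex.I * Complex.sinh (x + s * Complex.I)) * m + p : ℂ) =
        ((ν - m * c * σ : ℝ) : ℂ) + ((m * Real.sinh x * Real.cos s : ℝ) : ℂ) * Complex.I := by
      rw [sinh_strip, hνdef, hc, hσ]
      push_cast
      linear_combination (Complex.cosh x * Complex.sin s * m : ℂ) * Complex.I_sq
    rw [e, ← Complex.normSq_eq_norm_sq, Complex.normSq_add_mul_I]
    have h1 : Real.sinh x ^ 2 = c ^ 2 - 1 := by rw [hc, Real.cosh_sq]; ring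
    have h2 : Real.cos s ^ 2 = 1 - σ ^ 2 := by rw [hσ, ← Real.cos_sq']
    rw [mul_pow, mul_pow, h1, h2]
  have hσ2 : 0 ≤ 1 - σ ^ 2 := by nlinarith
  have hk : 0 ≤ 1 - S := by linarith
  have hν0 : 0 ≤ ν := hm.trans hν
  have ha0 : 0 ≤ m * c := by positivity
  have key : (1 - S) * max ν (m * c) ≤
      ‖((α + Complex.I * Complex.sinh (x + s * Complex.I)) * m + p : ℂ)‖ := by
    refine (le_abs_self _).trans (abs_le_of_sq_le_sq ?_ (norm_nonneg _))
    rw [hN]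
    rcases le_total (m * c) ν with h | h
    · rw [max_eq_left h]
      have h1 : (1 - S) * ν ≤ ν - m * c * σ := by
        rcases le_total 0 σ with h0 | h0
        · nlinarith
        · nlinarith [mul_nonneg ha0 (neg_nonneg.2 h0), mul_nonneg hν0 hS0]
      have h2 : ((1 - S) * ν) ^ 2 ≤ (ν - m * c * σ) ^ 2 :=
        pow_le_pow_left₀ (by positivity) h1 2
      have h3 : 0 ≤ m ^ 2 * (c ^ 2 - 1) * (1 - σ ^ 2) :=
        mul_nonneg (mul_nonneg (sq_nonneg _) (by nlinarith)) hσ2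
      linarith
    -- Here the squared modulus is rewritten as (mc − νσ)² + (ν² − m²)(1 − σ²), with the second term
    -- nonnegative since m ≤ ν.
    · rw [max_eq_right h]
      have h1 : (1 - S) * (m * c) ≤ m * c - ν * σ := by
        rcases le_total 0 σ with h0 | h0
        · nlinarith
        · nlinarith [mul_nonneg hν0 (neg_nonneg.2 h0), mul_nonneg ha0 hS0]
      have h2 : ((1 - S) * (m * c)) ^ 2 ≤ (m * c - ν * σ) ^ 2 :=
        pow_le_pow_left₀ (by positivity) h1 2
      have h3 : 0 ≤ (ν ^ 2 - m ^ 2) * (1 - σ ^ 2) :=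
        mul_nonneg (by nlinarith) hσ2
      nlinarith
  exact ⟨(mul_le_mul_of_nonneg_left (le_max_left _ _) hk).trans key,
    (mul_le_mul_of_nonneg_left (le_max_right _ _) hk).trans key⟩

end Hyperbolic

/-! ### The resolvent in a diagonalising basis. -/

section Resolvent

variable {V : Type} [NormedAddCommGroup V] [InnerProductSpace ℂ V] {ι : Type*} [Fintype ι]

theorem norm_sum_smul_sq (e : OrthonormalBasis ι ℂ V) (a : ι → ℂ) :
    ‖∑ j, a j • e j‖ ^ 2 = ∑ j, ‖a j‖ ^ 2 := by
  rw [← e.sum_sq_norm_inner_right]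
  refine Finset.sum_congr rfl fun i _ => ?_
  rw [e.orthonormal.inner_right_fintype]

theorem norm_sum_smul_le (e : OrthonormalBasis ι ℂ V) {a b : ι → ℂ} {C : ℝ} (hC : 0 ≤ C)
    (h : ∀ j, ‖a j‖ ≤ C * ‖b j‖) : ‖∑ j, a j • e j‖ ≤ C * ‖∑ j, b j • e j‖ := by
  refine (le_abs_self _).trans (abs_le_of_sq_le_sq ?_ (by positivity))
  rw [mul_pow, norm_sum_smul_sq, norm_sum_smul_sq, Finset.mul_sum]
  refine Finset.sum_le_sum fun j _ => ?_
  rw [← mul_pow]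
  exact pow_le_pow_left₀ (norm_nonneg _) (h j) 2

/-- The sum b is the Riesz representative of φ: antilinearity gives φ(b) = ‖b‖². -/
theorem norm_sum_antiDual_smul_le (e : OrthonormalBasis ι ℂ V) (φ : AntiDual V) :
    ‖∑ j, φ (e j) • e j‖ ≤ ‖φ‖ := by
  set b := ∑ j, φ (e j) • e j with hb
  have h1 : φ b = (‖b‖ ^ 2 : ℝ) := by
    rw [norm_sum_smul_sq, hb, map_sum]
    push_cast
    refine Finset.sum_congr rfl fun j _ => ?_
    rw [map_smulₛₗ, smul_eq_mul, Complex.conj_mul']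
  have h2 := φ.le_opNorm b
  rw [h1, Complex.norm_real, Real.norm_of_nonneg (by positivity), sq] at h2
  rcases (norm_nonneg b).eq_or_lt with h | h
  · rw [← h]; exact norm_nonneg _
  · exact le_of_mul_le_mul_right h2 h

/-- The solution `w` of `(s + A) w = φ + q`, in an orthonormal basis of `V` in which the embedding
`V ⊆ V⋆` has the eigenvalues `m j` and the operator `A` has the eigenvalues `p j`. -/
def resolvent (e : OrthonormalBasis ι ℂ V) (m p : ι → ℝ) (s : ℂ) (φ : AntiDual V) (q : V) : V :=
  ∑ j, ((φ (e j) + m j * inner ℂ (e j) q) / (s * m j + p j)) • e j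

/-- Both estimates are coordinatewise. The q part carries a factor `m j`, which the second lower
bound on the symbol turns into 1/c. -/
theorem norm_resolvent_le (e : OrthonormalBasis ι ℂ V) {m p : ι → ℝ} {s : ℂ} (φ : AntiDual V)
    (q : V) {k c : ℝ} (hk : 0 < k) (hc : 0 < c) (hm : ∀ j, 0 ≤ m j)
    (h1 : ∀ j, k ≤ ‖s * m j + p j‖) (h2 : ∀ j, k * (m j * c) ≤ ‖s * m j + p j‖) :
    ‖resolvent e m p s φ q‖ ≤ k⁻¹ * (‖φ‖ + ‖q‖ / c) := by
  have hsplit : resolvent e m p s φ q = ∑ j, (φ (e j) / (s * m j + p j)) • e j +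
      ∑ j, ((m j * inner ℂ (e j) q) / (s * m j + p j)) • e j := by
    rw [resolvent, ← Finset.sum_add_distrib]
    refine Finset.sum_congr rfl fun j _ => ?_
    rw [add_div, add_smul]
  rw [hsplit, mul_add]
  refine (norm_add_le _ _).trans (add_le_add ?_ ?_)
  · refine (norm_sum_smul_le e (b := fun j => φ (e j)) (inv_nonneg.2 hk.le) fun j => ?_).trans
      (mul_le_mul_of_nonneg_left (norm_sum_antiDual_smul_le e φ) (inv_nonneg.2 hk.le))
    rw [norm_div, div_eq_inv_mul]
    exact mul_le_mul_of_nonneg_right (inv_anti₀ hk (h1 j)) (norm_nonneg _)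
  · refine (norm_sum_smul_le e (b := fun j => inner ℂ (e j) q) (C := k⁻¹ / c) (by positivity)
      fun j => ?_).trans (le_of_eq ?_)
    · rw [norm_div, norm_mul, Complex.norm_real, Real.norm_of_nonneg (hm j), div_eq_inv_mul,
        ← mul_assoc]
      refine mul_le_mul_of_nonneg_right ?_ (norm_nonneg _)
      rw [inv_mul_le_iff₀ (hk.trans_le (h1 j))]
      have := h2 j
      calc m j = (k * (m j * c)) * (k⁻¹ / c) := by field_simp
        _ ≤ _ := by gcongr
    · rw [e.sum_repr']; ring

end Resolvent

/-! ### The pulled-back resolvent on lines of the strip. -/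

section LineIntegrals

/-- Evaluation of antilinear functionals at `v`. -/
def AntiDual.evalCLM {V : Type} [NormedAddCommGroup V] [InnerProductSpace ℂ V] (v : V) :
    AntiDual V →L[ℂ] ℂ :=
  LinearMap.mkContinuous
    { toFun := fun φ => φ v
      map_add' := fun _ _ => rfl
      map_smul' := fun _ _ => rfl } ‖v‖ fun φ => by
    rw [mul_comm]
    exact φ.le_opNorm v

/-- The line Im w = s parametrises one of the two branches of the boundary of D_{|s|}, according to
the sign of s, with |dz| = |cosh w| |dw|. -/
theorem lintegral_line_le_nTwoSq {X : Type} [NormedAddCommGroup X] [NormedSpace ℂ X]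
    (d : ℝ) (F : ℂ → X) {s : ℝ} (hs : s ≠ 0) (hsd : |s| < d) :
    ∫⁻ x : ℝ, ‖F (Complex.sinh (x + s * Complex.I))‖ₑ ^ 2 *
      ‖Complex.cosh (x + s * Complex.I)‖ₑ ≤ nTwoSq d F := by
  have hmem : |s| ∈ Ioo 0 d := ⟨abs_pos.2 hs, hsd⟩
  refine le_trans ?_ (le_iSup₂ (f := fun y (_ : y ∈ Ioo 0 d) => boundaryIntegral y F) |s| hmem)
  rcases lt_or_gt_of_ne hs with h | h
  · refine le_trans (le_of_eq ?_) le_add_self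
    refine lintegral_congr fun x => ?_
    rw [show (x : ℂ) - Complex.I * (|s| : ℝ) = x + s * Complex.I by
      rw [abs_of_neg h]; push_cast; ring]
  · refine le_trans (le_of_eq ?_) le_self_add
    refine lintegral_congr fun x => ?_
    rw [show (x : ℂ) + Complex.I * (|s| : ℝ) = x + s * Complex.I by
      rw [abs_of_pos h]; ring]

variable {V : Type} [NormedAddCommGroup V] [InnerProductSpace ℂ V] {ι : Type*} [Fintype ι]
  {e : OrthonormalBasis ι ℂ V} {m p : ι → ℝ} {α d C₀ : ℝ} {Φ : ℂ → AntiDual V} {q : V}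

theorem one_sub_sin_pos (hd : d ∈ Ioo 0 (Real.pi / 2)) : 0 < 1 - Real.sin d := by
  have := Real.sin_lt_sin_of_lt_of_le_pi_div_two (by linarith [hd.1, hd.2]) le_rfl hd.2
  rw [Real.sin_pi_div_two] at this
  linarith

theorem norm_resolvent_strip_le (hd : d ∈ Ioo 0 (Real.pi / 2)) (hm : ∀ j, 0 ≤ m j)
    (hν : ∀ j, m j ≤ p j + α * m j) (hν1 : ∀ j, 1 ≤ p j + α * m j) (φ : AntiDual V) (q : V)
    (x : ℝ) {s : ℝ} (hs : |s| ≤ d) :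
    ‖resolvent e m p (α + Complex.I * Complex.sinh (x + s * Complex.I)) φ q‖ ≤
      (1 - Real.sin d)⁻¹ * (‖φ‖ + ‖q‖ / Real.cosh x) := by
  refine norm_resolvent_le e φ q (one_sub_sin_pos hd) (Real.cosh_pos x) hm (fun j => ?_)
    fun j => ?_
  · refine le_trans ?_ (resolvent_symbol_lower_bound hd.2 hs (hm j) (hν j)).1
    exact le_mul_of_one_le_right (one_sub_sin_pos hd).le (hν1 j)
  · exact (resolvent_symbol_lower_bound hd.2 hs (hm j) (hν j)).2

/-- At τ = sinh x the decay condition reads C₀/cosh x, the same rate as the contribution of q. -/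
theorem norm_resolvent_real_le (hd : d ∈ Ioo 0 (Real.pi / 2)) (hm : ∀ j, 0 ≤ m j)
    (hν : ∀ j, m j ≤ p j + α * m j) (hν1 : ∀ j, 1 ≤ p j + α * m j)
    (hC : ∀ τ : ℝ, ‖Φ τ‖ ≤ C₀ / √(1 + τ ^ 2)) (x : ℝ) :
    ‖resolvent e m p (α + Complex.I * (Real.sinh x : ℝ)) (Φ (Real.sinh x : ℝ)) q‖ ≤
      (1 - Real.sin d)⁻¹ * ((C₀ + ‖q‖) / Real.cosh x) := by
  have h := norm_resolvent_strip_le (e := e) hd hm hν hν1 (Φ (Real.sinh x : ℝ)) q x (s := 0)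
    (by rw [abs_zero]; exact hd.1.le)
  rw [Complex.ofReal_zero, zero_mul, add_zero, ← Complex.ofReal_sinh] at h
  refine h.trans (mul_le_mul_of_nonneg_left ?_ (inv_nonneg.2 (one_sub_sin_pos hd).le))
  rw [add_div]
  refine add_le_add ((hC _).trans (le_of_eq ?_)) le_rfl
  rw [add_comm (1 : ℝ), ← Real.cosh_sq, Real.sqrt_sq (Real.cosh_pos x).le]

/-- The pull-back of `z ↦ (α + iz + A)⁻¹ (Φ z + q)` to the strip by `z = sinh w`, with the weight
`√(cosh w)` that turns `|dz|` into `|dw|`. -/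
def stripResolvent (e : OrthonormalBasis ι ℂ V) (m p : ι → ℝ) (α : ℝ) (Φ : ℂ → AntiDual V)
    (q : V) (w : ℂ) : V :=
  Complex.cosh w ^ (((2 : ℕ) : ℂ)⁻¹) •
    resolvent e m p (α + Complex.I * Complex.sinh w) (Φ (Complex.sinh w)) q

theorem enorm_stripResolvent_sub_sq (W : Submodule ℂ V) [W.HasOrthogonalProjection] (w : ℂ) :
    ‖stripResolvent e m p α Φ q w - W.starProjection (stripResolvent e m p α Φ q w)‖ₑ ^ 2 =
      ‖Complex.cosh w‖ₑ *
        ‖resolvent e m p (α + Complex.I * Complex.sinh w) (Φ (Complex.sinh w)) q -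
          W.starProjection
            (resolvent e m p (α + Complex.I * Complex.sinh w) (Φ (Complex.sinh w)) q)‖ₑ ^ 2 := by
  rw [stripResolvent, map_smul, ← smul_sub, enorm_smul, mul_pow, ← enorm_pow,
    Complex.cpow_nat_inv_pow _ two_ne_zero]

theorem enorm_stripResolvent_sq (w : ℂ) :
    ‖stripResolvent e m p α Φ q w‖ₑ ^ 2 = ‖Complex.cosh w‖ₑ *
      ‖resolvent e m p (α + Complex.I * Complex.sinh w) (Φ (Complex.sinh w)) q‖ₑ ^ 2 := by
  rw [stripResolvent, enorm_smul, mul_pow, ← enorm_pow, Complex.cpow_nat_inv_pow _ two_ne_zero]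

theorem differentiableOn_stripResolvent (hd : d ∈ Ioo 0 (Real.pi / 2)) (hm : ∀ j, 0 ≤ m j)
    (hν : ∀ j, m j ≤ p j + α * m j) (hν1 : ∀ j, 1 ≤ p j + α * m j)
    (hΦ : DifferentiableOn ℂ Φ (dom d)) :
    DifferentiableOn ℂ (stripResolvent e m p α Φ q) {w | |w.im| < d} := by
  intro w hw
  have hw' : |w.im| < d := hw
  have hcosh : DifferentiableWithinAt ℂ (fun w => Complex.cosh w ^ (((2 : ℕ) : ℂ)⁻¹))
      {w | |w.im| < d} w := by
    refine DifferentiableWithinAt.cpow_const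
      Complex.differentiable_cosh.differentiableAt.differentiableWithinAt (Or.inl ?_)
    exact cosh_re_pos (hw'.trans hd.2)
  refine hcosh.smul ?_
  unfold resolvent
  refine DifferentiableWithinAt.fun_sum fun j _ => ?_
  refine DifferentiableWithinAt.smul_const ?_ _
  have hsinh : DifferentiableWithinAt ℂ Complex.sinh {w | |w.im| < d} w :=
    Complex.differentiable_sinh.differentiableAt.differentiableWithinAt
  have hden : DifferentiableWithinAt ℂ
      (fun w => (α + Complex.I * Complex.sinh w) * m j + p j) {w | |w.im| < d} w :=
    (((hsinh.const_mul _).const_add _).mul_const _).add_const _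
  refine DifferentiableWithinAt.div ?_ hden ?_
  · refine DifferentiableWithinAt.add_const _ ?_
    have hcomp : DifferentiableWithinAt ℂ (fun w => Φ (Complex.sinh w)) {w | |w.im| < d} w :=
      (hΦ _ (sinh_mem_dom hd.2.le hw')).comp w hsinh fun v hv => sinh_mem_dom hd.2.le hv
    exact (AntiDual.evalCLM (e j)).differentiableAt.comp_differentiableWithinAt w hcomp
  · have := (resolvent_symbol_lower_bound (x := w.re) hd.2 hw'.le (hm j) (hν j)).1
    rw [Complex.re_add_im] at this
    have h2 : 0 < (1 - Real.sin d) * (p j + α * m j) :=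
      mul_pos (one_sub_sin_pos hd) (by linarith [hν1 j])
    exact norm_pos_iff.1 (h2.trans_le this)

/-- The weight |cosh w| completes the data to the N₂ integrand. For the q part it is at most cosh t
against 1/cosh² t, which leaves the integrable 1/cosh t. -/
theorem lintegral_stripResolvent_line_le (hd : d ∈ Ioo 0 (Real.pi / 2)) (hm : ∀ j, 0 ≤ m j)
    (hν : ∀ j, m j ≤ p j + α * m j) (hν1 : ∀ j, 1 ≤ p j + α * m j) {s : ℝ} (hs : s ≠ 0)
    (hsd : |s| < d) :
    ∫⁻ t : ℝ, ‖stripResolvent e m p α Φ q (t + s * Complex.I)‖ₑ ^ 2 ≤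
      ENNReal.ofReal (2 * ((1 - Real.sin d)⁻¹) ^ 2) *
        (nTwoSq d Φ + ENNReal.ofReal (4 * ‖q‖ ^ 2)) := by
  have hk := one_sub_sin_pos hd
  set k := 1 - Real.sin d with hkdef
  calc _ ≤ ∫⁻ t : ℝ, ENNReal.ofReal (2 * (k⁻¹) ^ 2) *
        (‖Φ (Complex.sinh (t + s * Complex.I))‖ₑ ^ 2 * ‖Complex.cosh (t + s * Complex.I)‖ₑ +
          ENNReal.ofReal (‖q‖ ^ 2) * ENNReal.ofReal ((Real.cosh t)⁻¹)) := by
        refine lintegral_mono fun t => ?_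
        rw [enorm_stripResolvent_sq]
        have hb := norm_resolvent_strip_le (e := e) hd hm hν hν1
          (Φ (Complex.sinh (t + s * Complex.I))) q t hsd.le
        set r := resolvent e m p (α + Complex.I * Complex.sinh (t + s * Complex.I))
          (Φ (Complex.sinh (t + s * Complex.I))) q
        set f := ‖Φ (Complex.sinh (t + s * Complex.I))‖ with hf
        have hc := norm_cosh_strip_le t s
        have hct := Real.cosh_pos t
        rw [← ofReal_norm, ← ofReal_norm, ← ofReal_norm (Φ _), ← ENNReal.ofReal_pow (norm_nonneg _),
          ← ENNReal.ofReal_pow (norm_nonneg _), ← ENNReal.ofReal_mul (norm_nonneg _),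
          ← ENNReal.ofReal_mul (by positivity), ← ENNReal.ofReal_mul (by positivity),
          ← ENNReal.ofReal_add (by positivity) (by positivity),
          ← ENNReal.ofReal_mul (by positivity)]
        apply ENNReal.ofReal_le_ofReal
        have h1 : ‖r‖ ^ 2 ≤ 2 * k⁻¹ ^ 2 * (f ^ 2 + (‖q‖ / Real.cosh t) ^ 2) := by
          calc ‖r‖ ^ 2 ≤ (k⁻¹ * (f + ‖q‖ / Real.cosh t)) ^ 2 := by gcongr
            _ = k⁻¹ ^ 2 * (f + ‖q‖ / Real.cosh t) ^ 2 := by ring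
            _ ≤ k⁻¹ ^ 2 * (2 * (f ^ 2 + (‖q‖ / Real.cosh t) ^ 2)) := by
              gcongr; exact add_sq_le
            _ = _ := by ring
        set c := ‖Complex.cosh (t + s * Complex.I)‖
        have h2 : c * (‖q‖ / Real.cosh t) ^ 2 ≤ ‖q‖ ^ 2 * (Real.cosh t)⁻¹ := by
          calc _ ≤ Real.cosh t * (‖q‖ / Real.cosh t) ^ 2 := by gcongr
            _ = _ := by field_simp
        calc c * ‖r‖ ^ 2 ≤ c * (2 * k⁻¹ ^ 2 * (f ^ 2 + (‖q‖ / Real.cosh t) ^ 2)) := by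
              gcongr
          _ = 2 * k⁻¹ ^ 2 * (f ^ 2 * c + c * (‖q‖ / Real.cosh t) ^ 2) := by ring
          _ ≤ _ := by gcongr
    _ = ENNReal.ofReal (2 * (k⁻¹) ^ 2) *
        ((∫⁻ t : ℝ, ‖Φ (Complex.sinh (t + s * Complex.I))‖ₑ ^ 2 *
          ‖Complex.cosh (t + s * Complex.I)‖ₑ) +
          ENNReal.ofReal (‖q‖ ^ 2) * ∫⁻ t : ℝ, ENNReal.ofReal ((Real.cosh t)⁻¹)) := by
        rw [lintegral_const_mul' _ _ ENNReal.ofReal_ne_top, lintegral_add_right _ (by fun_prop),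
          lintegral_const_mul' _ _ ENNReal.ofReal_ne_top]
    _ ≤ _ := by
        gcongr
        · exact lintegral_line_le_nTwoSq d Φ hs hsd
        · rw [mul_comm (4 : ℝ), ENNReal.ofReal_mul (by positivity)]
          gcongr
          simpa using lintegral_inv_cosh_le

/-- The resolvent decays like 1/cosh x and the weight grows like √(cosh x), which leaves the rate
exp(−|x|/2). -/
theorem norm_stripResolvent_real_le (hd : d ∈ Ioo 0 (Real.pi / 2)) (hm : ∀ j, 0 ≤ m j)
    (hν : ∀ j, m j ≤ p j + α * m j) (hν1 : ∀ j, 1 ≤ p j + α * m j) (hC₀ : 0 ≤ C₀)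
    (hC : ∀ τ : ℝ, ‖Φ τ‖ ≤ C₀ / √(1 + τ ^ 2)) (x : ℝ) :
    ‖stripResolvent e m p α Φ q x‖ ≤
      √2 * (1 - Real.sin d)⁻¹ * (C₀ + ‖q‖) * Real.exp (-(|x| / 2)) := by
  have hk := one_sub_sin_pos hd
  have hb := norm_resolvent_real_le (e := e) (q := q) hd hm hν hν1 hC x
  have hct := Real.cosh_pos x
  set k := 1 - Real.sin d with hkdef
  refine (le_abs_self _).trans (abs_le_of_sq_le_sq ?_ (by positivity))
  have h1 : ‖stripResolvent e m p α Φ q x‖ ^ 2 = Real.cosh x *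
      ‖resolvent e m p (α + Complex.I * (Real.sinh x : ℝ)) (Φ (Real.sinh x : ℝ)) q‖ ^ 2 := by
    rw [stripResolvent, norm_smul, mul_pow, ← norm_pow, Complex.cpow_nat_inv_pow _ two_ne_zero,
      ← Complex.ofReal_cosh, ← Complex.ofReal_sinh, Complex.norm_real, Real.norm_of_nonneg hct.le]
  have hexp : Real.exp (-(|x| / 2)) ^ 2 = Real.exp (-|x|) := by
    rw [← Real.exp_nat_mul]; congr 1; push_cast; ring
  have hinv : (Real.cosh x)⁻¹ ≤ 2 * Real.exp (-|x|) := by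
    rw [Real.exp_neg, ← div_eq_mul_inv, inv_eq_one_div, div_le_div_iff₀ hct (Real.exp_pos _),
      one_mul]
    exact exp_abs_le_two_mul_cosh x
  rw [h1]
  calc _ ≤ Real.cosh x * (k⁻¹ * ((C₀ + ‖q‖) / Real.cosh x)) ^ 2 := by gcongr
    _ = (k⁻¹ * (C₀ + ‖q‖)) ^ 2 * (Real.cosh x)⁻¹ := by field_simp
    _ ≤ (k⁻¹ * (C₀ + ‖q‖)) ^ 2 * (2 * Real.exp (-|x|)) := by gcongr
    _ = _ := by
      rw [mul_pow, mul_pow, mul_pow, mul_pow, hexp, Real.sq_sqrt (by norm_num)]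
      ring

theorem nonneg_of_decay (hC : ∀ τ : ℝ, ‖Φ τ‖ ≤ C₀ / √(1 + τ ^ 2)) : 0 ≤ C₀ := by
  have := (norm_nonneg _).trans (hC 0)
  simpa using this

theorem lintegral_resolvent_eq (W : Submodule ℂ V) [W.HasOrthogonalProjection] :
    ∫⁻ τ : ℝ, ‖resolvent e m p (α + Complex.I * τ) (Φ τ) q -
        W.starProjection (resolvent e m p (α + Complex.I * τ) (Φ τ) q)‖ₑ ^ 2 =
      ∫⁻ x : ℝ, ‖stripResolvent e m p α Φ q x -
        W.starProjection (stripResolvent e m p α Φ q x)‖ₑ ^ 2 := by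
  rw [lintegral_comp_sinh]
  refine lintegral_congr fun x => ?_
  rw [enorm_stripResolvent_sub_sq, ← Complex.ofReal_cosh, ← Complex.ofReal_sinh]
  congr 1
  rw [← ofReal_norm, Complex.norm_real, Real.norm_of_nonneg (Real.cosh_pos x).le]

/-- This is the strip estimate applied to `stripResolvent`, after the change of variables τ = sinh
x. Its samples at the nodes are scalar multiples of the resolvent at the sinc points, so membership
in W is not affected by the weight. -/
theorem lintegral_resolvent_sub_starProjection_le [CompleteSpace V]
    (hd : d ∈ Ioo 0 (Real.pi / 2)) (hm : ∀ j, 0 ≤ m j)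
    (hν : ∀ j, m j ≤ p j + α * m j) (hν1 : ∀ j, 1 ≤ p j + α * m j) (hΦ : MemNTwo d Φ)
    (hC : ∀ τ : ℝ, ‖Φ τ‖ ≤ C₀ / √(1 + τ ^ 2)) {K : ℕ} (hK : 1 ≤ K)
    (W : Submodule ℂ V) [W.HasOrthogonalProjection]
    (hW : ∀ k : ℤ, |k| ≤ K → resolvent e m p (α + Complex.I * sincPoint d K k)
      (Φ (sincPoint d K k)) q ∈ W) :
    ∫⁻ τ : ℝ, ‖resolvent e m p (α + Complex.I * τ) (Φ τ) q -
        W.starProjection (resolvent e m p (α + Complex.I * τ) (Φ τ) q)‖ₑ ^ 2 ≤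
      ENNReal.ofReal (10 * stripConst d * ((1 - Real.sin d)⁻¹) ^ 2 *
        (√K * Real.exp (-√(2 * Real.pi * d * K)))) *
          (nTwoSq d Φ + ENNReal.ofReal ((C₀ + ‖q‖) ^ 2)) := by
  have hC₀ := nonneg_of_decay hC
  have hk := one_sub_sin_pos hd
  have hs := stripConst_pos hd.1
  set N := (nTwoSq d Φ).toReal with hN
  have hNof : nTwoSq d Φ = ENNReal.ofReal N := (ENNReal.ofReal_toReal hΦ.2.ne).symm
  have hN0 : 0 ≤ N := ENNReal.toReal_nonneg
  rw [lintegral_resolvent_eq, hNof]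
  set k := 1 - Real.sin d with hkdef
  have hline : ∀ s : ℝ, s ≠ 0 → |s| < d →
      ∫⁻ t : ℝ, ‖stripResolvent e m p α Φ q (t + s * Complex.I)‖ₑ ^ 2 ≤
        ENNReal.ofReal (√(2 * k⁻¹ ^ 2 * (N + 4 * ‖q‖ ^ 2)) ^ 2) := by
    intro s hs hsd
    refine (lintegral_stripResolvent_line_le hd hm hν hν1 hs hsd).trans (le_of_eq ?_)
    rw [hNof, ← ENNReal.ofReal_add hN0 (by positivity), ← ENNReal.ofReal_mul (by positivity),
      Real.sq_sqrt (by positivity)]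
  have hmain := lintegral_sub_starProjection_le_of_nodes
    (differentiableOn_stripResolvent (e := e) (q := q) hd hm hν hν1 hΦ.1) hd.1 (Real.sqrt_nonneg _)
    (B := √2 * k⁻¹ * (C₀ + ‖q‖)) (by positivity) hline
    (norm_stripResolvent_real_le hd hm hν hν1 hC₀ hC) hK W ?_
  · refine hmain.trans ?_
    rw [← ENNReal.ofReal_add hN0 (by positivity), ← ENNReal.ofReal_mul (by positivity)]
    apply ENNReal.ofReal_le_ofReal
    rw [Real.sq_sqrt (by positivity), mul_pow, mul_pow, Real.sq_sqrt (by norm_num)]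
    have hq : ‖q‖ ^ 2 ≤ (C₀ + ‖q‖) ^ 2 := by gcongr; linarith
    calc _ ≤ stripConst d * (√K * Real.exp (-√(2 * Real.pi * d * K)) *
          (2 * k⁻¹ ^ 2 * (N + 4 * (C₀ + ‖q‖) ^ 2) + 2 * k⁻¹ ^ 2 * (C₀ + ‖q‖) ^ 2)) := by gcongr
      _ = 2 * stripConst d * k⁻¹ ^ 2 * (√K * Real.exp (-√(2 * Real.pi * d * K))) *
          (N + 5 * (C₀ + ‖q‖) ^ 2) := by ring
      _ ≤ 2 * stripConst d * k⁻¹ ^ 2 * (√K * Real.exp (-√(2 * Real.pi * d * K))) *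
          (5 * N + 5 * (C₀ + ‖q‖) ^ 2) := by gcongr; linarith
      _ = _ := by ring
  · intro j hj
    have := hW j hj
    rw [sincPoint] at this
    rw [stripResolvent, ← Complex.ofReal_sinh]
    exact W.smul_mem _ this

/-- This is a bound without any sampling, from the decay on the real line alone. It serves the
dimensions too small for the sinc spaces. -/
theorem lintegral_resolvent_sub_starProjection_le_const
    (hd : d ∈ Ioo 0 (Real.pi / 2)) (hm : ∀ j, 0 ≤ m j)
    (hν : ∀ j, m j ≤ p j + α * m j) (hν1 : ∀ j, 1 ≤ p j + α * m j)
    (hC : ∀ τ : ℝ, ‖Φ τ‖ ≤ C₀ / √(1 + τ ^ 2))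
    (W : Submodule ℂ V) [W.HasOrthogonalProjection] :
    ∫⁻ τ : ℝ, ‖resolvent e m p (α + Complex.I * τ) (Φ τ) q -
        W.starProjection (resolvent e m p (α + Complex.I * τ) (Φ τ) q)‖ₑ ^ 2 ≤
      ENNReal.ofReal (4 * ((1 - Real.sin d)⁻¹) ^ 2 * (C₀ + ‖q‖) ^ 2) := by
  have hC₀ := nonneg_of_decay hC
  have hk := one_sub_sin_pos hd
  set k := 1 - Real.sin d with hkdef
  rw [lintegral_comp_sinh]
  calc _ ≤ ∫⁻ x : ℝ, ENNReal.ofReal (k⁻¹ ^ 2 * (C₀ + ‖q‖) ^ 2) *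
        ENNReal.ofReal ((Real.cosh x)⁻¹) := by
        refine lintegral_mono fun x => ?_
        have hct := Real.cosh_pos x
        rw [← ofReal_norm, ← ENNReal.ofReal_pow (norm_nonneg _), ← ENNReal.ofReal_mul hct.le,
          ← ENNReal.ofReal_mul (by positivity)]
        apply ENNReal.ofReal_le_ofReal
        calc _ ≤ Real.cosh x * (k⁻¹ * ((C₀ + ‖q‖) / Real.cosh x)) ^ 2 := by
              gcongr
              exact (norm_sub_starProjection_le_self W _).trans
                (norm_resolvent_real_le hd hm hν hν1 hC x)
          _ = _ := by field_simp
    _ ≤ _ := by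
        rw [lintegral_const_mul' _ _ ENNReal.ofReal_ne_top]
        refine (mul_le_mul_right lintegral_inv_cosh_le _).trans (le_of_eq ?_)
        rw [show (4 : ℝ≥0∞) = ENNReal.ofReal 4 by simp, ← ENNReal.ofReal_mul (by positivity)]
        ring_nf

end LineIntegrals

/-! ### Absolutely convergent Laplace integrals. -/

section LaplaceTransform

variable {X : Type} [NormedAddCommGroup X] [NormedSpace ℂ X]

/-- The Laplace integral of `f` at `s` converges absolutely. -/
def LaplaceIntegrable (f : ℝ → X) (s : ℂ) : Prop :=
  IntegrableOn (fun t : ℝ => Complex.exp (-s * t) • f t) (Ioi 0)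

theorem norm_exp_neg_mul (s : ℂ) (t : ℝ) :
    ‖Complex.exp (-s * t)‖ = Real.exp (-s.re * t) := by
  rw [Complex.norm_exp]
  simp

theorem LaplaceIntegrable.mono {f : ℝ → X} {s s' : ℂ} (h : LaplaceIntegrable f s)
    (hs : s.re ≤ s'.re) : LaplaceIntegrable f s' := by
  have e : (fun t : ℝ => Complex.exp (-s' * t) • f t) =
      fun t : ℝ => Complex.exp (-(s' - s) * t) • (Complex.exp (-s * t) • f t) := by
    ext t
    rw [smul_smul, ← Complex.exp_add]
    ring_nf
  unfold LaplaceIntegrable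
  rw [e]
  refine Integrable.bdd_smul (φ := fun t : ℝ => Complex.exp (-(s' - s) * t)) h 1
    (Continuous.aestronglyMeasurable (by fun_prop)) ?_
  filter_upwards [ae_restrict_mem measurableSet_Ioi] with t ht
  rw [norm_exp_neg_mul]
  refine Real.exp_le_one_iff.2 ?_
  have : 0 ≤ (s' - s).re := by simpa using hs
  have := mul_nonneg this (le_of_lt ht : (0 : ℝ) ≤ t)
  linarith

/-- Multiplied by exp(−sx), the primitive of h' is the convolution on the half-line of exp(−st)
h'(t) with exp(−st). Integrability and the product formula for convolutions then give both claims,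
with no boundary term at infinity to discuss. -/
theorem LaplaceIntegrable.const_add_primitive [CompleteSpace X] {h h' : ℝ → X} {s : ℂ}
    (hs : 0 < s.re)
    (hh' : LaplaceIntegrable h' s) {h₀ : X}
    (hprim : ∀ t : ℝ, 0 ≤ t → h t = h₀ + ∫ r in (0 : ℝ)..t, h' r) :
    LaplaceIntegrable h s ∧ s • laplace h s = h₀ + laplace h' s := by
  have hs0 : s ≠ 0 := by rintro rfl; simp at hs
  have hexp : IntegrableOn (fun t : ℝ => Complex.exp (-s * t)) (Ioi 0) :=
    integrableOn_exp_mul_complex_Ioi (by simpa using hs) 0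
  have hexpint : ∫ t : ℝ in Ioi 0, Complex.exp (-s * t) = s⁻¹ := by
    rw [integral_exp_mul_complex_Ioi (by simpa using hs)]
    simp [neg_div_neg_eq]
  set L : X →L[ℝ] ℂ →L[ℝ] X := (ContinuousLinearMap.lsmul ℝ ℂ : ℂ →L[ℝ] X →L[ℝ] X).flip with hL
  have hconv : ∀ x : ℝ, ∫ t in (0 : ℝ)..x,
      L (Complex.exp (-s * t) • h' t) (Complex.exp (-s * (x - t : ℝ))) =
        Complex.exp (-s * x) • ∫ t in (0 : ℝ)..x, h' t := by
    intro x
    rw [← intervalIntegral.integral_smul]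
    refine intervalIntegral.integral_congr fun t _ => ?_
    simp only [hL, ContinuousLinearMap.flip_apply, ContinuousLinearMap.lsmul_apply]
    rw [smul_smul, ← Complex.exp_add]
    congr 2
    push_cast
    ring
  have h1 := integrable_posConvolution hh' hexp L
  have h2 := integral_posConvolution hh' hexp L
  simp only [hconv] at h2
  unfold posConvolution at h1
  simp only [hconv] at h1
  rw [integrable_indicator_iff measurableSet_Ioi] at h1
  have hsum : ∀ t ∈ Ioi (0 : ℝ), Complex.exp (-s * t) • h₀ +
      Complex.exp (-s * t) • (∫ r in (0 : ℝ)..t, h' r) = Complex.exp (-s * t) • h t := by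
    intro t ht
    rw [hprim t (le_of_lt ht), smul_add]
  have hc : IntegrableOn (fun t : ℝ => Complex.exp (-s * t) • h₀) (Ioi 0) := hexp.smul_const h₀
  refine ⟨(hc.add h1).congr_fun hsum measurableSet_Ioi, ?_⟩
  have : laplace h s = s⁻¹ • h₀ + s⁻¹ • laplace h' s := by
    rw [laplace, ← setIntegral_congr_fun measurableSet_Ioi hsum, integral_add hc h1, h2,
      integral_smul_const, hexpint]
    rfl
  rw [this, smul_add, smul_smul, smul_smul, mul_inv_cancel₀ hs0, one_smul, one_smul]

theorem LaplaceIntegrable.of_memLp {f : ℝ → X} (hf : MemLp f 2 (volume.restrict (Ioi (0 : ℝ))))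
    {s : ℂ} (hs : 0 < s.re) : LaplaceIntegrable f s := by
  have he : MemLp (fun t : ℝ => Complex.exp (-s * t)) 2 (volume.restrict (Ioi (0 : ℝ))) := by
    rw [memLp_two_iff_integrable_sq_norm (Continuous.aestronglyMeasurable (by fun_prop))]
    have h := integrableOn_exp_mul_Ioi (a := -2 * s.re) (by linarith) 0
    refine h.congr_fun (fun t _ => ?_) measurableSet_Ioi
    simp only
    rw [norm_exp_neg_mul, ← Real.exp_nat_mul]
    congr 1
    push_cast
    ring
  exact memLp_one_iff_integrable.1 (hf.smul he)

theorem laplace_clm {Y : Type} [NormedAddCommGroup Y] [NormedSpace ℂ Y] [CompleteSpace X]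
    [CompleteSpace Y] (T : X →L[ℂ] Y) {f : ℝ → X} {s : ℂ} (hf : LaplaceIntegrable f s) :
    LaplaceIntegrable (fun t => T (f t)) s ∧ laplace (fun t => T (f t)) s = T (laplace f s) := by
  have e : ∀ t : ℝ, Complex.exp (-s * t) • T (f t) = T (Complex.exp (-s * t) • f t) :=
    fun t => (map_smul T _ _).symm
  constructor
  · unfold LaplaceIntegrable
    simp only [e]
    exact T.integrable_comp hf
  · unfold laplace
    simp only [e]
    exact T.integral_comp_comm hf

theorem laplaceIntegrable_of_bound {f : ℝ → X} {A η : ℝ} {s : ℂ} (hs : η < s.re)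
    (hm : AEStronglyMeasurable f (volume.restrict (Ioi (0 : ℝ))))
    (hf : ∀ᵐ t ∂(volume.restrict (Ioi (0 : ℝ))), ‖f t‖ ≤ A * Real.exp (η * t)) :
    LaplaceIntegrable f s := by
  have h := (integrableOn_exp_mul_Ioi (a := -(s.re - η)) (by linarith) 0).const_mul A
  refine Integrable.mono' h ?_ ?_
  · exact AEStronglyMeasurable.smul (Continuous.aestronglyMeasurable (by fun_prop)) hm
  · filter_upwards [hf] with t ht
    rw [norm_smul, norm_exp_neg_mul]
    calc _ ≤ Real.exp (-s.re * t) * (A * Real.exp (η * t)) := by gcongr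
      _ = A * Real.exp (-(s.re - η) * t) := by
        rw [mul_left_comm, ← Real.exp_add]; ring_nf

end LaplaceTransform

/-! ### The Poisson integral and the Hardy norm. -/

section HardySpace

theorem integrable_exp_neg_abs {b : ℝ} (hb : 0 < b) :
    Integrable fun t : ℝ => (Real.exp (-(b * |t|)) : ℂ) := by
  have h1 : IntegrableOn (fun t : ℝ => Real.exp (-(b * |t|))) (Iic 0) := by
    refine (integrableOn_exp_mul_Iic hb 0).congr_fun (fun t ht => ?_) measurableSet_Iic
    simp only
    rw [abs_of_nonpos ht]; ring_nf
  have h2 : IntegrableOn (fun t : ℝ => Real.exp (-(b * |t|))) (Ioi 0) := by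
    refine (integrableOn_exp_mul_Ioi (a := -b) (by linarith) 0).congr_fun (fun t ht => ?_)
      measurableSet_Ioi
    simp only
    rw [abs_of_pos ht]; ring_nf
  have := h1.union h2
  rw [Iic_union_Ioi, integrableOn_univ] at this
  exact this.ofReal

theorem fourier_exp_neg_abs {b : ℝ} (hb : 0 < b) (ξ : ℝ) :
    FourierTransform.fourier (fun t : ℝ => (Real.exp (-(b * |t|)) : ℂ)) ξ =
      ((2 * b / (b ^ 2 + (2 * Real.pi * ξ) ^ 2) : ℝ) : ℂ) := by
  rw [Real.fourier_real_eq_integral_exp_smul]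
  set a : ℂ := (2 * Real.pi * ξ : ℝ) * Complex.I with ha
  have hint : Integrable fun t : ℝ =>
      Complex.exp ((-2 * Real.pi * t * ξ : ℝ) * Complex.I) • (Real.exp (-(b * |t|)) : ℂ) := by
    refine Integrable.bdd_smul
      (φ := fun t : ℝ => Complex.exp ((-2 * Real.pi * t * ξ : ℝ) * Complex.I))
      (integrable_exp_neg_abs hb) 1 (Continuous.aestronglyMeasurable (by fun_prop))
      (Eventually.of_forall fun t => ?_)
    rw [Complex.norm_exp_ofReal_mul_I]
  have h1 : ∫ t : ℝ in Iic 0,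
      Complex.exp ((-2 * Real.pi * t * ξ : ℝ) * Complex.I) • (Real.exp (-(b * |t|)) : ℂ) =
        1 / (b - a) := by
    have := integral_exp_mul_complex_Iic (a := b - a) (by simpa [ha] using hb) 0
    rw [Complex.ofReal_zero, mul_zero, Complex.exp_zero] at this
    rw [← this]
    refine setIntegral_congr_fun measurableSet_Iic fun t ht => ?_
    rw [abs_of_nonpos ht, smul_eq_mul, Complex.ofReal_exp, ← Complex.exp_add, ha]
    congr 1
    push_cast
    ring
  have h2 : ∫ t : ℝ in Ioi 0,
      Complex.exp ((-2 * Real.pi * t * ξ : ℝ) * Complex.I) • (Real.exp (-(b * |t|)) : ℂ) =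
        1 / (b + a) := by
    have := integral_exp_mul_complex_Ioi (a := -(b + a)) (by simpa [ha] using hb) 0
    rw [Complex.ofReal_zero, mul_zero, Complex.exp_zero, neg_div_neg_eq] at this
    rw [← this]
    refine setIntegral_congr_fun measurableSet_Ioi fun t ht => ?_
    rw [abs_of_pos ht, smul_eq_mul, Complex.ofReal_exp, ← Complex.exp_add, ha]
    congr 1
    push_cast
    ring
  rw [← intervalIntegral.integral_Iic_add_Ioi (b := 0) hint.integrableOn hint.integrableOn, h1, h2]
  have hne : ∀ σ : ℝ, (b : ℂ) + σ * Complex.I ≠ 0 := by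
    intro σ h
    have := congrArg Complex.re h
    simp at this
    exact hb.ne' this
  have n1 : (b : ℂ) - a ≠ 0 := by
    have := hne (-(2 * Real.pi * ξ))
    rw [ha]
    convert this using 1
    push_cast; ring
  have n2 : (b : ℂ) + a ≠ 0 := hne _
  rw [div_add_div _ _ n1 n2]
  have e : ((b : ℂ) - a) * (b + a) = ((b ^ 2 + (2 * Real.pi * ξ) ^ 2 : ℝ) : ℂ) := by
    rw [ha]
    push_cast
    linear_combination (-(2 * Real.pi * ξ : ℂ) ^ 2) * Complex.I_sq
  rw [e]
  push_cast
  congr 1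
  ring

/-- The Poisson kernel of the half-plane, as the Fourier transform of `e^{-b|t|}`. -/
def poissonKernel (b ξ : ℝ) : ℝ := 2 * b / (b ^ 2 + (2 * Real.pi * ξ) ^ 2)

theorem poissonKernel_nonneg {b : ℝ} (hb : 0 < b) (ξ : ℝ) : 0 ≤ poissonKernel b ξ := by
  unfold poissonKernel
  positivity

theorem continuous_poissonKernel {b : ℝ} (hb : 0 < b) : Continuous (poissonKernel b) := by
  unfold poissonKernel
  refine Continuous.div (by fun_prop) (by fun_prop) fun ξ => ?_
  positivity

theorem integrable_poissonKernel {b : ℝ} (hb : 0 < b) : Integrable (poissonKernel b) := by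
  have h1 : Integrable fun ξ : ℝ => (1 + ξ ^ 2)⁻¹ := integrable_inv_one_add_sq
  have hpi := Real.pi_pos
  have h2 := (h1.comp_mul_left' (R := 2 * Real.pi / b) (by positivity)).const_mul (2 / b)
  refine h2.congr (Eventually.of_forall fun ξ => ?_)
  simp only [poissonKernel]
  field_simp

/-- This is Fourier inversion for exp(−b|t|), which is continuous and integrable together with its
transform. -/
theorem integral_poissonKernel {b : ℝ} (hb : 0 < b) (t : ℝ) :
    ∫ ξ : ℝ, (poissonKernel b ξ : ℂ) * Complex.exp ((2 * Real.pi * ξ * t : ℝ) * Complex.I) =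
      (Real.exp (-(b * |t|)) : ℂ) := by
  have hF : FourierTransform.fourier (fun t : ℝ => (Real.exp (-(b * |t|)) : ℂ)) =
      fun ξ => (poissonKernel b ξ : ℂ) := funext fun ξ => fourier_exp_neg_abs hb ξ
  have hinv := Continuous.fourierInv_fourier_eq
    (f := fun t : ℝ => (Real.exp (-(b * |t|)) : ℂ)) (by fun_prop) (integrable_exp_neg_abs hb)
    (by rw [hF]; exact (integrable_poissonKernel hb).ofReal)
  have := congrFun hinv t
  rw [hF, Real.fourierInv_eq'] at this
  rw [← this]
  refine integral_congr_ae (Eventually.of_forall fun ξ => ?_)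
  simp only [smul_eq_mul]
  rw [mul_comm]
  congr 2
  simp
  ring

variable {X : Type} [NormedAddCommGroup X] [NormedSpace ℂ X]

theorem continuous_laplace_line {f : ℝ → X} {α : ℝ} (hf : LaplaceIntegrable f α) :
    Continuous fun τ : ℝ => laplace f (α + Complex.I * τ) := by
  unfold laplace
  refine continuous_of_dominated (bound := fun t => ‖Complex.exp (-(α : ℂ) * t) • f t‖)
    (fun τ => ?_) (fun τ => ?_) hf.norm ?_
  · exact (hf.mono (s' := α + Complex.I * τ) (by simp)).aestronglyMeasurable
  · refine Eventually.of_forall fun t => le_of_eq ?_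
    rw [norm_smul, norm_smul, norm_exp_neg_mul, norm_exp_neg_mul]
    simp
  · refine Eventually.of_forall fun t => ?_
    fun_prop

variable [CompleteSpace X]

/-- For t > 0 the additional factor exp(−bt) is exp(−b|t|); its Fourier representation is inserted
in the Laplace integral and Fubini is applied. -/
theorem laplace_eq_integral_poissonKernel {f : ℝ → X} {α b : ℝ} (hb : 0 < b)
    (hf : LaplaceIntegrable f α) (τ : ℝ) :
    laplace f ((α + b : ℝ) + Complex.I * τ) =
      ∫ ξ : ℝ, (poissonKernel b ξ : ℂ) •
        laplace f (α + Complex.I * (τ - 2 * Real.pi * ξ : ℝ)) := by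
  have hfτ : LaplaceIntegrable f (α + Complex.I * τ) := hf.mono (by simp)
  have hprod : Integrable (Function.uncurry fun (ξ t : ℝ) =>
      ((poissonKernel b ξ : ℂ) * Complex.exp ((2 * Real.pi * ξ * t : ℝ) * Complex.I)) •
        (Complex.exp (-(α + Complex.I * τ) * t) • f t))
      (volume.prod (volume.restrict (Ioi 0))) := by
    have h1 : Integrable (fun z : ℝ × ℝ => (poissonKernel b z.1 : ℂ) •
        (Complex.exp (-(α + Complex.I * τ) * z.2) • f z.2))
        (volume.prod (volume.restrict (Ioi 0))) :=
      Integrable.smul_prod (integrable_poissonKernel hb).ofReal hfτ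
    have h2 := Integrable.bdd_smul (φ := fun z : ℝ × ℝ =>
        Complex.exp ((2 * Real.pi * z.1 * z.2 : ℝ) * Complex.I)) h1 1
      (Continuous.aestronglyMeasurable (by fun_prop)) (Eventually.of_forall fun z => by
        rw [Complex.norm_exp_ofReal_mul_I])
    refine h2.congr (Eventually.of_forall fun z => ?_)
    simp only [Function.uncurry, Pi.smul_apply']
    rw [smul_smul, smul_smul, smul_smul]
    congr 1
    ring
  have e1 : ∀ ξ : ℝ, (poissonKernel b ξ : ℂ) •
      laplace f (α + Complex.I * (τ - 2 * Real.pi * ξ : ℝ)) =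
        ∫ t in Ioi (0 : ℝ), ((poissonKernel b ξ : ℂ) *
          Complex.exp ((2 * Real.pi * ξ * t : ℝ) * Complex.I)) •
            (Complex.exp (-(α + Complex.I * τ) * t) • f t) := by
    intro ξ
    rw [laplace, ← integral_smul]
    refine integral_congr_ae (Eventually.of_forall fun t => ?_)
    simp only
    rw [smul_smul, smul_smul, mul_assoc (poissonKernel b ξ : ℂ), ← Complex.exp_add]
    congr 3
    push_cast
    ring
  simp only [e1]
  rw [integral_integral_swap hprod, laplace]
  refine setIntegral_congr_fun measurableSet_Ioi fun t ht => ?_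
  rw [integral_smul_const, integral_poissonKernel hb, abs_of_pos ht, smul_smul,
    Complex.ofReal_exp, ← Complex.exp_add]
  congr 2
  push_cast
  ring

theorem lintegral_poissonKernel {b : ℝ} (hb : 0 < b) :
    ∫⁻ ξ : ℝ, ENNReal.ofReal (poissonKernel b ξ) = 1 := by
  rw [← ofReal_integral_eq_lintegral_ofReal (integrable_poissonKernel hb)
    (Eventually.of_forall (poissonKernel_nonneg hb))]
  have := integral_poissonKernel hb 0
  simp only [mul_zero, Complex.ofReal_zero, zero_mul, Complex.exp_zero, mul_one, abs_zero,
    neg_zero, Real.exp_zero, Complex.ofReal_one] at this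
  rw [integral_complex_ofReal] at this
  have h1 : ∫ ξ : ℝ, poissonKernel b ξ = 1 := by exact_mod_cast this
  rw [h1, ENNReal.ofReal_one]

/-- The `L²` norm of the Laplace transform decreases with the real part. -/
theorem lintegral_laplace_line_le {f : ℝ → X} {α σ : ℝ} (hσ : α < σ)
    (hf : LaplaceIntegrable f α) :
    ∫⁻ τ : ℝ, ‖laplace f (σ + Complex.I * τ)‖ₑ ^ 2 ≤
      ∫⁻ τ : ℝ, ‖laplace f (α + Complex.I * τ)‖ₑ ^ 2 := by
  set b := σ - α with hbdef
  have hb : 0 < b := sub_pos.2 hσ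
  have hσ' : σ = α + b := by rw [hbdef]; ring
  have hcont := continuous_laplace_line hf
  set H : ℝ → X := fun τ => laplace f (α + Complex.I * τ) with hH
  have hpt : ∀ τ : ℝ, ‖laplace f (σ + Complex.I * τ)‖ₑ ^ 2 ≤
      ∫⁻ ξ : ℝ, ENNReal.ofReal (poissonKernel b ξ) * ‖H (τ - 2 * Real.pi * ξ)‖ₑ ^ 2 := by
    intro τ
    rw [hσ', laplace_eq_integral_poissonKernel hb hf]
    -- Splitting the kernel as ρ·ρ makes Cauchy–Schwarz act as Jensen's inequality for a probability
    -- density.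
    set ρ : ℝ → ℝ := fun ξ => √(poissonKernel b ξ) with hρ
    have hρc : Continuous ρ := (continuous_poissonKernel hb).sqrt
    have hρsq : ∀ ξ, ρ ξ ^ 2 = poissonKernel b ξ := fun ξ =>
        Real.sq_sqrt (poissonKernel_nonneg hb ξ)
    have hρe : ∀ ξ, ‖(ρ ξ : ℂ)‖ₑ ^ 2 = ENNReal.ofReal (poissonKernel b ξ) := by
      intro ξ
      rw [← ofReal_norm, ← ENNReal.ofReal_pow (norm_nonneg _), Complex.norm_real,
        Real.norm_eq_abs, sq_abs, hρsq]
    have hre : ∀ ξ : ℝ, (poissonKernel b ξ : ℂ) •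
        laplace f (α + Complex.I * (τ - 2 * Real.pi * ξ : ℝ)) =
          (ρ ξ : ℂ) • ((ρ ξ : ℂ) • H (τ - 2 * Real.pi * ξ)) := by
      intro ξ
      rw [smul_smul, ← Complex.ofReal_mul, ← sq, hρsq]
    simp only [hre]
    refine (enorm_integral_smul_sq_le (Continuous.aestronglyMeasurable (by fun_prop))
      (Continuous.aestronglyMeasurable (by fun_prop))).trans (le_of_eq ?_)
    simp only [enorm_smul, mul_pow, hρe]
    rw [lintegral_poissonKernel hb, one_mul]
  calc _ ≤ ∫⁻ τ : ℝ, ∫⁻ ξ : ℝ,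
        ENNReal.ofReal (poissonKernel b ξ) * ‖H (τ - 2 * Real.pi * ξ)‖ₑ ^ 2 := lintegral_mono hpt
    _ = ∫⁻ ξ : ℝ, ∫⁻ τ : ℝ,
        ENNReal.ofReal (poissonKernel b ξ) * ‖H (τ - 2 * Real.pi * ξ)‖ₑ ^ 2 := by
      refine lintegral_lintegral_swap (Measurable.aemeasurable ?_)
      refine Measurable.mul (f := fun z : ℝ × ℝ => ENNReal.ofReal (poissonKernel b z.2))
        (g := fun z : ℝ × ℝ => ‖H (z.1 - 2 * Real.pi * z.2)‖ₑ ^ 2) ?_ ?_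
      · exact ((continuous_poissonKernel hb).measurable.comp measurable_snd).ennreal_ofReal
      · refine Measurable.pow_const (Continuous.measurable ?_) 2
        fun_prop
    _ = ∫⁻ ξ : ℝ, ENNReal.ofReal (poissonKernel b ξ) * ∫⁻ τ : ℝ, ‖H τ‖ₑ ^ 2 := by
      refine lintegral_congr fun ξ => ?_
      rw [lintegral_const_mul' _ _ ENNReal.ofReal_ne_top]
      congr 1
      exact lintegral_sub_right_eq_self (fun τ => ‖H τ‖ₑ ^ 2) (2 * Real.pi * ξ)
    _ = _ := by
      rw [lintegral_mul_const _ (continuous_poissonKernel hb).measurable.ennreal_ofReal,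
        lintegral_poissonKernel hb, one_mul]

/-- Every line to the right of α is dominated by the line α itself; the factor 1/(2π) is simply
discarded. -/
theorem hardySq_laplace_le {f : ℝ → X} {α : ℝ} (hf : LaplaceIntegrable f α) :
    hardySq α (laplace f) ≤ ∫⁻ τ : ℝ, ‖laplace f (α + Complex.I * τ)‖ₑ ^ 2 := by
  refine iSup₂_le fun σ hσ => ?_
  refine le_trans ?_ (lintegral_laplace_line_le hσ hf)
  refine ENNReal.div_le_of_le_mul (le_mul_of_one_le_right' ?_)
  rw [← ENNReal.ofReal_one]
  exact ENNReal.ofReal_le_ofReal (by linarith [Real.pi_gt_three])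

end HardySpace

/-! ### The evolution equation and its Laplace transform. -/

section Evolution

theorem continuousOn_primitive_Ici {X : Type} [NormedAddCommGroup X] [NormedSpace ℝ X]
    {h h' : ℝ → X} {h₀ : X}
    (hint : ∀ T : ℝ, 0 ≤ T → IntervalIntegrable h' volume 0 T)
    (hprim : ∀ t : ℝ, 0 ≤ t → h t = h₀ + ∫ r in (0 : ℝ)..t, h' r) :
    ContinuousOn h (Ici 0) := by
  intro t ht
  have ht0 : (0 : ℝ) ≤ t := ht
  have h1 : ContinuousOn (fun x => h₀ + ∫ r in (0 : ℝ)..x, h' r) (Icc 0 (t + 1)) := by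
    have h2 := hint (t + 1) (by linarith)
    rw [intervalIntegrable_iff_integrableOn_Icc_of_le (by linarith)] at h2
    have := intervalIntegral.continuousOn_primitive_interval (a := 0) (b := t + 1) (μ := volume)
      (f := h') (by rwa [uIcc_of_le (by linarith)])
    rw [uIcc_of_le (by linarith)] at this
    exact continuousOn_const.add this
  have h2 : ContinuousOn h (Icc 0 (t + 1)) := h1.congr fun x hx => hprim x hx.1
  refine (h2 t ⟨ht0, by linarith⟩).mono_of_mem_nhdsWithin ?_
  rw [← Ici_inter_Iic]
  exact inter_mem_nhdsWithin _ (Iic_mem_nhds (by linarith))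

/-- No growth condition on the solution is assumed, so Laplace integrability has to be derived from
the equation. The integrating factor exp(lt) with l = p/μ ≥ 0 removes the damping term, and the
remaining derivative is bounded by that of an explicit exponential. -/
theorem exists_bound_of_ode {μ p η A : ℝ} (hμ : 0 < μ) (hp : 0 ≤ p) (hη : 0 < η) {f u u' : ℝ → ℂ}
    {u₀ : ℂ} (hfc : ContinuousOn f (Ici 0)) (hfA : ∀ t : ℝ, 0 ≤ t → ‖f t‖ ≤ A * Real.exp (η * t))
    (hint : ∀ T : ℝ, 0 ≤ T → IntervalIntegrable u' volume 0 T)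
    (hprim : ∀ t : ℝ, 0 ≤ t → u t = u₀ + ∫ r in (0 : ℝ)..t, u' r)
    (heq : ∀ᵐ t ∂(volume.restrict (Ioi (0 : ℝ))), μ * u' t + p * u t = f t) :
    ∃ B : ℝ, ∀ t : ℝ, 0 ≤ t → ‖u t‖ ≤ B * Real.exp (η * t) := by
  have huc := continuousOn_primitive_Ici hint hprim
  have hμC : (μ : ℂ) ≠ 0 := by exact_mod_cast hμ.ne'
  have hA : 0 ≤ A := by
    have := (norm_nonneg _).trans (hfA 0 le_rfl)
    simpa using this
  -- The right-hand side solved for u' is continuous on t ≥ 0; freezing it for t < 0 yields a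
  -- primitive v differentiable everywhere, whereas u' satisfies the equation only almost
  -- everywhere.
  set c : ℝ → ℂ := fun t => (f (max t 0) - p * u (max t 0)) / μ with hc
  have hcc : Continuous c := by
    have hmax : Continuous fun t : ℝ => max t 0 := by fun_prop
    have h1 := hfc.comp_continuous hmax fun t => show (0 : ℝ) ≤ max t 0 from le_max_right _ _
    have h2 := huc.comp_continuous hmax fun t => show (0 : ℝ) ≤ max t 0 from le_max_right _ _
    exact (h1.sub (continuous_const.mul h2)).div_const _
  set v : ℝ → ℂ := fun t => u₀ + ∫ r in (0 : ℝ)..t, c r with hv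
  have huv : ∀ t : ℝ, 0 ≤ t → u t = v t := by
    intro t ht
    rw [hprim t ht, hv]
    simp only
    congr 1
    rw [intervalIntegral.integral_of_le ht, intervalIntegral.integral_of_le ht]
    refine integral_congr_ae ?_
    have h1 : ∀ᵐ r ∂(volume.restrict (Ioc 0 t)), μ * u' r + p * u r = f r :=
      ae_restrict_of_ae_restrict_of_subset Ioc_subset_Ioi_self heq
    filter_upwards [h1, ae_restrict_mem measurableSet_Ioc] with r hr hr0
    rw [hc]
    simp only
    rw [max_eq_left hr0.1.le, ← hr]
    field_simp
    ring
  have hvd : ∀ t : ℝ, HasDerivAt v (c t) t := by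
    intro t
    exact (intervalIntegral.integral_hasDerivAt_right (hcc.intervalIntegrable _ _)
      (hcc.stronglyMeasurableAtFilter _ _) hcc.continuousAt).const_add u₀
  set l := p / μ with hl
  have hl0 : 0 ≤ l := by positivity
  set w : ℝ → ℂ := fun t => (Real.exp (l * t) : ℂ) * v t with hw
  have hwd : ∀ t : ℝ, HasDerivAt w
      (((Real.exp (l * t) * l : ℝ) : ℂ) * v t + (Real.exp (l * t) : ℂ) * c t) t := by
    intro t
    have h1 : HasDerivAt (fun t : ℝ => Real.exp (l * t)) (Real.exp (l * t) * l) t := by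
      simpa using ((hasDerivAt_id t).const_mul l).exp
    exact h1.ofReal_comp.mul (hvd t)
  set b : ℝ → ℝ := fun t => ‖u₀‖ + A / μ / (l + η) * Real.exp ((l + η) * t) with hb
  have hlη : 0 < l + η := by linarith
  have hbd : ∀ t : ℝ, HasDerivAt b (A / μ * Real.exp ((l + η) * t)) t := by
    intro t
    have h1 : HasDerivAt (fun t : ℝ => Real.exp ((l + η) * t))
        (Real.exp ((l + η) * t) * (l + η)) t := by
      simpa using ((hasDerivAt_id t).const_mul (l + η)).exp
    have h2 := (h1.const_mul (A / μ / (l + η))).const_add ‖u₀‖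
    rwa [mul_comm (Real.exp _), ← mul_assoc, div_mul_cancel₀ _ hlη.ne'] at h2
  have hbound : ∀ T : ℝ, 0 ≤ T → ‖w T‖ ≤ b T := by
    intro T hT
    refine image_norm_le_of_norm_deriv_right_le_deriv_boundary (a := 0) (b := T)
      (f := w) (B := b)
      (fun t _ => (hwd t).continuousAt.continuousWithinAt)
      (fun t _ => (hwd t).hasDerivWithinAt) ?_ hbd ?_ ⟨hT, le_rfl⟩
    · rw [hw, hb, hv]
      simp only [mul_zero, Real.exp_zero, Complex.ofReal_one, one_mul,
        intervalIntegral.integral_same, add_zero]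
      have : 0 ≤ A / μ / (l + η) * 1 := by positivity
      linarith
    · intro t ht
      have e : (((Real.exp (l * t) * l : ℝ) : ℂ) * v t + (Real.exp (l * t) : ℂ) * c t) =
          (Real.exp (l * t) : ℂ) * (f t / μ) := by
        rw [hc]
        simp only
        rw [max_eq_left ht.1, huv t ht.1, hl]
        push_cast
        field_simp
        ring
      rw [e, norm_mul, Complex.norm_real, Real.norm_of_nonneg (Real.exp_pos _).le, norm_div,
        Complex.norm_real, Real.norm_of_nonneg hμ.le, add_mul, Real.exp_add]
      calc _ ≤ Real.exp (l * t) * (A * Real.exp (η * t) / μ) := by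
            gcongr
            exact hfA t ht.1
        _ = _ := by ring
  refine ⟨‖u₀‖ + A / μ / (l + η), fun t ht => ?_⟩
  have h1 := hbound t ht
  rw [huv t ht]
  rw [hw] at h1
  simp only [norm_mul, Complex.norm_real, Real.norm_of_nonneg (Real.exp_pos _).le] at h1
  have hE : 1 ≤ Real.exp (l * t) := Real.one_le_exp (by positivity)
  have hE2 : 1 ≤ Real.exp (η * t) := Real.one_le_exp (by positivity)
  have hA' : 0 ≤ A / μ / (l + η) := by positivity
  rw [hb] at h1
  simp only [add_mul, Real.exp_add] at h1
  refine le_of_mul_le_mul_left (h1.trans ?_) (Real.exp_pos (l * t))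
  have : ‖u₀‖ ≤ Real.exp (l * t) * (‖u₀‖ * Real.exp (η * t)) := by
    have h3 : 1 ≤ Real.exp (l * t) * Real.exp (η * t) := by nlinarith
    nlinarith [norm_nonneg u₀]
  calc _ ≤ Real.exp (l * t) * (‖u₀‖ * Real.exp (η * t)) +
        A / μ / (l + η) * (Real.exp (l * t) * Real.exp (η * t)) := by gcongr
    _ = _ := by ring

/-- For r ≤ t the factor exp(η(t − r)) is at least one, so the integral of ‖f'‖ up to t is at most
exp(ηt) times the finite integral of exp(−ηr)‖f'(r)‖. -/
theorem exists_bound_of_primitive {X : Type} [NormedAddCommGroup X] [NormedSpace ℂ X]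
    {f f' : ℝ → X} {f₀ : X}
    {η : ℝ} (hη : 0 < η) (hf' : MemLp f' 2 (volume.restrict (Ioi (0 : ℝ))))
    (hprim : ∀ t : ℝ, 0 ≤ t → f t = f₀ + ∫ r in (0 : ℝ)..t, f' r) :
    ∃ A : ℝ, ∀ t : ℝ, 0 ≤ t → ‖f t‖ ≤ A * Real.exp (η * t) := by
  have hL : LaplaceIntegrable f' η := LaplaceIntegrable.of_memLp hf' (by simpa using hη)
  set J := ∫ r in Ioi (0 : ℝ), ‖Complex.exp (-(η : ℂ) * r) • f' r‖ with hJ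
  refine ⟨‖f₀‖ + J, fun t ht => ?_⟩
  have hE : 1 ≤ Real.exp (η * t) := Real.one_le_exp (by positivity)
  have h1 : ‖∫ r in (0 : ℝ)..t, f' r‖ ≤ J * Real.exp (η * t) := by
    rw [intervalIntegral.integral_of_le ht]
    calc _ ≤ ∫ r in Ioc 0 t, ‖f' r‖ := norm_integral_le_integral_norm _
      _ ≤ ∫ r in Ioc 0 t, Real.exp (η * t) * ‖Complex.exp (-(η : ℂ) * r) • f' r‖ := by
        refine integral_mono_of_nonneg (Eventually.of_forall fun r => norm_nonneg _)
          ((IntegrableOn.mono_set hL.norm Ioc_subset_Ioi_self).const_mul _) ?_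
        filter_upwards [ae_restrict_mem measurableSet_Ioc] with r hr
        rw [norm_smul, norm_exp_neg_mul, ← mul_assoc, ← Real.exp_add]
        refine le_mul_of_one_le_left (norm_nonneg _) (Real.one_le_exp ?_)
        simp only [Complex.ofReal_re]
        nlinarith [hr.2]
      _ = Real.exp (η * t) * ∫ r in Ioc 0 t, ‖Complex.exp (-(η : ℂ) * r) • f' r‖ :=
        integral_const_mul _ _
      _ ≤ Real.exp (η * t) * J := by
        gcongr
        exact setIntegral_mono_set hL.norm (Eventually.of_forall fun r => norm_nonneg _)
          Ioc_subset_Ioi_self.eventuallyLE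
      _ = _ := mul_comm _ _
  rw [hprim t ht, add_mul]
  refine (norm_add_le _ _).trans (add_le_add ?_ h1)
  exact le_mul_of_one_le_right (norm_nonneg _) hE

theorem intervalIntegrable_of_memLp_two {X : Type} [NormedAddCommGroup X] {f : ℝ → X} {T : ℝ}
    (hT : 0 ≤ T) (hf : MemLp f 2 (volume.restrict (Ioc 0 T))) :
    IntervalIntegrable f volume 0 T := by
  rw [intervalIntegrable_iff_integrableOn_Ioc_of_le hT]
  exact hf.integrable one_le_two

variable {V : Type} [NormedAddCommGroup V] [InnerProductSpace ℂ V]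
  {ι : Type*} [Fintype ι]

theorem LaplaceIntegrable.of_coordinates (e : OrthonormalBasis ι ℂ V) {u : ℝ → V} {s : ℂ}
    (h : ∀ j, LaplaceIntegrable (fun t => inner ℂ (e j) (u t)) s) : LaplaceIntegrable u s := by
  have e1 : (fun t : ℝ => Complex.exp (-s * t) • u t) =
      fun t : ℝ => ∑ j, (Complex.exp (-s * t) • inner ℂ (e j) (u t)) • e j := by
    ext t
    conv_lhs => rw [← e.sum_repr' (u t)]
    rw [Finset.smul_sum]
    refine Finset.sum_congr rfl fun j _ => ?_
    rw [smul_smul, smul_eq_mul]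
  unfold LaplaceIntegrable
  rw [e1]
  exact integrable_finsetSum _ fun j _ => (h j).smul_const (e j)

/-- The basis decouples the equation into scalar ones. Since s f̂ = f(0) + (∂ₜf)^, the transform of
u' solves the same resolvent equation with data (∂ₜf)^ and f(0) − A u₀, as soon as the latter
functional is the embedding of some q. -/
theorem laplace_evolution [FiniteDimensional ℂ V] (e : OrthonormalBasis ι ℂ V) {m p : ι → ℝ}
    (hm : ∀ j, 0 < m j)
    (hp : ∀ j, 0 ≤ p j) {f f' : ℝ → AntiDual V} {u u' : ℝ → V} {u₀ : V}
    (hf' : MemLp f' 2 (volume.restrict (Ioi (0 : ℝ))))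
    (hfprim : ∀ t : ℝ, 0 ≤ t → f t = f 0 + ∫ r in (0 : ℝ)..t, f' r)
    (hu' : ∀ T : ℝ, MemLp u' 2 (volume.restrict (Ioc 0 T)))
    (huprim : ∀ t : ℝ, 0 ≤ t → u t = u₀ + ∫ r in (0 : ℝ)..t, u' r)
    (heq : ∀ᵐ t ∂(volume.restrict (Ioi (0 : ℝ))), ∀ j,
      m j * inner ℂ (e j) (u' t) + p j * inner ℂ (e j) (u t) = f t (e j))
    {s : ℂ} (hs : 0 < s.re) :
    LaplaceIntegrable u s ∧ LaplaceIntegrable u' s ∧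
      laplace u s = resolvent e m p s (laplace f s) u₀ ∧
      laplace u' s = s • laplace u s - u₀ ∧
      ∀ q : V, (∀ j, f 0 (e j) - p j * inner ℂ (e j) u₀ = m j * inner ℂ (e j) q) →
        laplace u' s = resolvent e m p s (laplace f' s) q := by
  have : CompleteSpace V := FiniteDimensional.complete ℂ V
  have hLf' : LaplaceIntegrable f' s := LaplaceIntegrable.of_memLp hf' hs
  obtain ⟨hLf, hLf_eq⟩ := hLf'.const_add_primitive hs hfprim
  -- The growth rate Re s/2 is strictly below Re s, which leaves room for integrability at s.
  have hη : 0 < s.re / 2 := by linarith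
  obtain ⟨A, hA⟩ := exists_bound_of_primitive hη hf' hfprim
  have hfint : ∀ T : ℝ, 0 ≤ T → IntervalIntegrable f' volume 0 T := fun T hT =>
    intervalIntegrable_of_memLp_two hT (hf'.mono_measure
      (Measure.restrict_mono Ioc_subset_Ioi_self le_rfl))
  have hfcont := continuousOn_primitive_Ici hfint hfprim
  have huint : ∀ T : ℝ, 0 ≤ T → IntervalIntegrable u' volume 0 T := fun T hT =>
    intervalIntegrable_of_memLp_two hT (hu' T)
  have hucont := continuousOn_primitive_Ici huint huprim
  have hfj : ∀ j, LaplaceIntegrable (fun t => f t (e j)) s ∧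
      laplace (fun t => f t (e j)) s = laplace f s (e j) := fun j =>
    laplace_clm (AntiDual.evalCLM (e j)) hLf
  have huj_prim : ∀ j, ∀ t : ℝ, 0 ≤ t → inner ℂ (e j) (u t) =
      inner ℂ (e j) u₀ + ∫ r in (0 : ℝ)..t, inner ℂ (e j) (u' r) := by
    intro j t ht
    rw [huprim t ht, inner_add_right]
    congr 1
    exact ((innerSL ℂ (e j)).intervalIntegral_comp_comm (huint t ht)).symm
  have huj : ∀ j, LaplaceIntegrable (fun t => inner ℂ (e j) (u t)) s := by
    intro j
    have hfjc : ContinuousOn (fun t => f t (e j)) (Ici 0) :=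
      (AntiDual.evalCLM (e j)).continuous.comp_continuousOn hfcont
    have hfA : ∀ t : ℝ, 0 ≤ t → ‖f t (e j)‖ ≤ A * Real.exp (s.re / 2 * t) := by
      intro t ht
      refine ((f t).le_opNorm (e j)).trans ?_
      rw [e.orthonormal.1 j, mul_one]
      exact hA t ht
    obtain ⟨B, hB⟩ := exists_bound_of_ode (f := fun t => f t (e j)) (A := A)
      (u := fun t => inner ℂ (e j) (u t)) (u' := fun t => inner ℂ (e j) (u' t)) (hm j) (hp j) hη
      hfjc hfA
      (fun T hT => ⟨(huint T hT).1.const_inner (e j), (huint T hT).2.const_inner (e j)⟩)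
      (huj_prim j) (by filter_upwards [heq] with t ht using ht j)
    refine laplaceIntegrable_of_bound (A := B) (η := s.re / 2) (by linarith) ?_ ?_
    · exact ((innerSL ℂ (e j)).continuous.comp_continuousOn
        (hucont.mono Ioi_subset_Ici_self)).aestronglyMeasurable measurableSet_Ioi
    · filter_upwards [ae_restrict_mem measurableSet_Ioi] with t ht using hB t (le_of_lt ht)
  have hmC : ∀ j, (m j : ℂ) ≠ 0 := fun j => by exact_mod_cast (hm j).ne'
  have hu'j : ∀ j, LaplaceIntegrable (fun t => inner ℂ (e j) (u' t)) s := by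
    intro j
    have h1 := (((hfj j).1).sub (Integrable.const_mul (huj j) (p j : ℂ))).const_mul (m j : ℂ)⁻¹
    refine Integrable.congr h1 ?_
    filter_upwards [heq] with t ht
    simp only [Pi.sub_apply, smul_eq_mul]
    rw [← ht j]
    field_simp [hmC j]
    ring
  have hLu : LaplaceIntegrable u s := LaplaceIntegrable.of_coordinates e huj
  have hLu' : LaplaceIntegrable u' s := LaplaceIntegrable.of_coordinates e hu'j
  obtain ⟨_, hLu_eq⟩ := hLu'.const_add_primitive hs huprim
  have hsne : ∀ j, s * m j + p j ≠ 0 := by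
    intro j h
    have := congrArg Complex.re h
    simp only [Complex.add_re, Complex.mul_re, Complex.ofReal_re, Complex.ofReal_im, mul_zero,
      sub_zero, Complex.zero_re] at this
    have h1 := mul_pos hs (hm j)
    linarith [hp j]
  have hcu : ∀ j, laplace (fun t => inner ℂ (e j) (u t)) s = inner ℂ (e j) (laplace u s) :=
    fun j => (laplace_clm (innerSL ℂ (e j)) hLu).2
  have hcu' : ∀ j, laplace (fun t => inner ℂ (e j) (u' t)) s = inner ℂ (e j) (laplace u' s) :=
    fun j => (laplace_clm (innerSL ℂ (e j)) hLu').2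
  have hode : ∀ j, m j * inner ℂ (e j) (laplace u' s) + p j * inner ℂ (e j) (laplace u s) =
      laplace f s (e j) := by
    intro j
    rw [← (hfj j).2, ← hcu, ← hcu', laplace, laplace, laplace, ← integral_const_mul,
      ← integral_const_mul, ← integral_add ((hu'j j).const_mul _) ((huj j).const_mul _)]
    refine integral_congr_ae ?_
    filter_upwards [heq] with t ht
    simp only [smul_eq_mul]
    rw [← ht j]
    ring
  have hsu : ∀ j, inner ℂ (e j) (laplace u' s) =
      s * inner ℂ (e j) (laplace u s) - inner ℂ (e j) u₀ := by
    intro j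
    rw [← inner_smul_right, hLu_eq, inner_add_right]
    ring
  refine ⟨hLu, hLu', ?_, ?_, ?_⟩
  · rw [← e.sum_repr' (laplace u s), resolvent]
    refine Finset.sum_congr rfl fun j _ => ?_
    congr 1
    rw [eq_div_iff (hsne j), ← hode j, hsu j]
    ring
  · rw [hLu_eq]; abel
  · intro q hq
    rw [← e.sum_repr' (laplace u' s), resolvent]
    refine Finset.sum_congr rfl fun j _ => ?_
    congr 1
    have h1 : s * laplace f s (e j) = f 0 (e j) + laplace f' s (e j) := by
      have := congrArg (fun φ : AntiDual V => φ (e j)) hLf_eq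
      simpa using this
    rw [eq_div_iff (hsne j), ← hq j]
    have h2 := hode j
    have h3 := hsu j
    linear_combination s * h2 + p j * h3 + h1

end Evolution

/-! ### Values of the analytic extension on the real axis. -/

section BoundaryValues

variable {X : Type} [NormedAddCommGroup X] [NormedSpace ℂ X]

/-- The extension is tied to the Laplace integral only below the real axis. A real point sinh x is
approached along sinh(x − iε): F is continuous there, and the integrals converge by domination by
the integrand at α₀. -/
theorem LaplaceExtends.eq_on_line {α d : ℝ} {f : ℝ → X} {F : ℂ → X} (hd : d ∈ Ioo 0 (Real.pi / 2))
    (h : LaplaceExtends α d f F) {α₀ : ℝ} (hα : α₀ < α) (hf : LaplaceIntegrable f α₀) (τ : ℝ) :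
    F τ = laplace f (α + Complex.I * τ) := by
  obtain ⟨x, rfl⟩ := Real.sinh_surjective τ
  set γ : ℝ → ℂ := fun ε => Complex.sinh (x + (-ε : ℝ) * Complex.I) with hγ
  have hγc : Continuous γ := Complex.continuous_sinh.comp (by fun_prop)
  have hγ0 : γ 0 = (Real.sinh x : ℝ) := by
    rw [hγ]
    simp
  have hmem : ∀ ε : ℝ, |ε| < d → γ ε ∈ dom d := fun ε hε =>
    sinh_mem_dom hd.2.le (by simpa using hε)
  have him : ∀ ε : ℝ, (γ ε).im = -(Real.cosh x * Real.sin ε) := by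
    intro ε
    rw [hγ]
    simp only
    rw [sinh_strip, Real.sin_neg]
    simp [-Complex.ofReal_sin, -Complex.ofReal_cos, -Complex.ofReal_neg]
  have hsub : Ioo 0 d ∈ 𝓝[>] (0 : ℝ) := Ioo_mem_nhdsGT hd.1
  have t1 : Tendsto (fun ε => F (γ ε)) (𝓝[>] 0) (𝓝 (F (γ 0))) := by
    have hc := h.mem.1.continuousOn (γ 0) (hmem 0 (by simpa using hd.1))
    refine hc.tendsto.comp (tendsto_nhdsWithin_iff.2 ⟨?_, ?_⟩)
    · exact (hγc.tendsto 0).mono_left nhdsWithin_le_nhds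
    · filter_upwards [hsub] with ε hε
      exact hmem ε (by rw [abs_of_pos hε.1]; exact hε.2)
  have t2 : Tendsto (fun ε => laplace f (α + Complex.I * γ ε)) (𝓝[>] 0)
      (𝓝 (laplace f (α + Complex.I * γ 0))) := by
    have hev : ∀ᶠ ε in 𝓝[>] (0 : ℝ), α₀ ≤ (α + Complex.I * γ ε : ℂ).re := by
      filter_upwards [hsub] with ε hε
      simp only [Complex.add_re, Complex.ofReal_re, Complex.mul_re, Complex.I_re, zero_mul,
        Complex.I_im, one_mul, zero_sub, him]
      have : 0 ≤ Real.cosh x * Real.sin ε := mul_nonneg (Real.cosh_pos x).le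
        (Real.sin_nonneg_of_nonneg_of_le_pi hε.1.le (by linarith [hε.2, hd.2, Real.pi_pos]))
      linarith
    unfold laplace
    refine tendsto_integral_filter_of_dominated_convergence
      (fun t => ‖Complex.exp (-(α₀ : ℂ) * t) • f t‖) ?_ ?_ hf.norm ?_
    · filter_upwards [hev] with ε hε
      exact (hf.mono (by rw [Complex.ofReal_re]; exact hε)).aestronglyMeasurable
    · filter_upwards [hev] with ε hε
      filter_upwards [ae_restrict_mem measurableSet_Ioi] with t ht
      rw [norm_smul, norm_smul, norm_exp_neg_mul, norm_exp_neg_mul]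
      have ht0 : (0 : ℝ) ≤ t := le_of_lt ht
      refine mul_le_mul_of_nonneg_right (Real.exp_le_exp.2 ?_) (norm_nonneg _)
      rw [Complex.ofReal_re]
      exact mul_le_mul_of_nonneg_right (neg_le_neg hε) ht0
    · refine Eventually.of_forall fun t => ?_
      refine Tendsto.smul_const ?_ _
      have : Continuous fun ε => Complex.exp (-(α + Complex.I * γ ε) * t) := by fun_prop
      exact (this.tendsto 0).mono_left nhdsWithin_le_nhds
  have heq : ∀ᶠ ε in 𝓝[>] (0 : ℝ), laplace f (α + Complex.I * γ ε) = F (γ ε) := by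
    filter_upwards [hsub] with ε hε
    refine (h.eq_laplace _ (hmem ε (by rw [abs_of_pos hε.1]; exact hε.2)) ?_).symm
    rw [him]
    have := mul_pos (Real.cosh_pos x)
      (Real.sin_pos_of_pos_of_lt_pi hε.1 (by linarith [hε.2, hd.2, Real.pi_pos]))
    linarith
  rw [← hγ0]
  exact tendsto_nhds_unique t1 (t2.congr' heq)

end BoundaryValues

/-! ### Integration by parts in H¹₀ and closability of the gradient. -/

section Sobolev

variable {n : ℕ} {Ω : Set (RSpace n)}

theorem IsTestFunction.continuous {φ : RSpace n → ℂ} (h : IsTestFunction Ω φ) : Continuous φ :=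
  h.smooth.continuous

theorem IsTestFunction.star {φ : RSpace n → ℂ} (h : IsTestFunction Ω φ) :
    IsTestFunction Ω fun x => starRingEnd ℂ (φ x) where
  smooth := Complex.conjCLE.contDiff.comp h.smooth
  compact := h.compact.comp_left (g := starRingEnd ℂ) (map_zero _)
  support := (closure_mono (Function.support_comp_subset (map_zero (starRingEnd ℂ)) φ)).trans
    h.support

theorem partialDeriv_star {φ : RSpace n → ℂ} (h : IsTestFunction Ω φ) (i : Fin n) (x : RSpace n) :
    partialDeriv i (fun x => starRingEnd ℂ (φ x)) x = starRingEnd ℂ (partialDeriv i φ x) := by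
  have h1 : HasFDerivAt φ (fderiv ℝ φ x) x :=
    (h.smooth.differentiable (by simp) x).hasFDerivAt
  have h2 := (Complex.conjCLE.toContinuousLinearMap.hasFDerivAt (x := φ x)).comp x h1
  unfold partialDeriv
  rw [show (fun x => starRingEnd ℂ (φ x)) = Complex.conjCLE.toContinuousLinearMap ∘ φ from rfl,
    h2.fderiv]
  rfl

theorem IsTestFunction.continuous_partialDeriv {φ : RSpace n → ℂ} (h : IsTestFunction Ω φ)
    (i : Fin n) : Continuous (partialDeriv i φ) :=
  (h.smooth.continuous_fderiv (by simp)).clm_apply continuous_const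

theorem IsTestFunction.hasCompactSupport_partialDeriv {φ : RSpace n → ℂ} (h : IsTestFunction Ω φ)
    (i : Fin n) : HasCompactSupport (partialDeriv i φ) :=
  h.compact.fderiv_apply (𝕜 := ℝ) _

theorem IsTestFunction.support_subset {φ : RSpace n → ℂ} (h : IsTestFunction Ω φ) :
    Function.support φ ⊆ Ω :=
  (subset_tsupport φ).trans h.support

theorem IsTestFunction.setIntegral_mul_partialDeriv {φ ψ : RSpace n → ℂ} (hφ : IsTestFunction Ω φ)
    (hψ : IsTestFunction Ω ψ) (i : Fin n) :
    ∫ x in Ω, φ x * partialDeriv i ψ x = -∫ x in Ω, partialDeriv i φ x * ψ x := by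
  rw [setIntegral_eq_integral_of_forall_compl_eq_zero,
    setIntegral_eq_integral_of_forall_compl_eq_zero]
  · refine integral_mul_fderiv_eq_neg_fderiv_mul_of_integrable ?_ ?_ ?_
      (fun x _ => hφ.smooth.differentiable (by simp) x)
      (fun x _ => hψ.smooth.differentiable (by simp) x)
    · exact ((hφ.continuous_partialDeriv i).mul hψ.continuous).integrable_of_hasCompactSupport
        hψ.compact.mul_left
    · exact (hφ.continuous.mul (hψ.continuous_partialDeriv i)).integrable_of_hasCompactSupport
        hφ.compact.mul_right
    · exact (hφ.continuous.mul hψ.continuous).integrable_of_hasCompactSupport hφ.compact.mul_right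
  · intro x hx
    rw [Function.notMem_support.1 fun h => hx (hψ.support_subset h), mul_zero]
  · intro x hx
    rw [Function.notMem_support.1 fun h => hx (hφ.support_subset h), zero_mul]

/-- `h` is the weak divergence of `g` on `Ω`, tested against `C_c^∞(Ω)`. -/
def HasWeakDiv (Ω : Set (RSpace n)) (g : L2 Ω (CSpace n)) (h : L2 Ω ℂ) : Prop :=
  ∀ φ : RSpace n → ℂ, IsTestFunction Ω φ →
    ∫ x in Ω, ∑ i, g x i * partialDeriv i φ x = -∫ x in Ω, h x * φ x

/-- The identity is closed in p, and on test functions it is the weak divergence tested with the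
conjugate of φ. -/
theorem inner_snd_eq_neg_inner_fst {p : L2 Ω ℂ × L2 Ω (CSpace n)} (hp : p ∈ H10 Ω)
    {g : L2 Ω (CSpace n)} {h : L2 Ω ℂ} (hg : HasWeakDiv Ω g h) :
    inner ℂ p.2 g = -inner ℂ p.1 h := by
  have hcl : IsClosed {p : L2 Ω ℂ × L2 Ω (CSpace n) | inner ℂ p.2 g = -inner ℂ p.1 h} :=
    isClosed_eq (by fun_prop) (by fun_prop)
  refine closure_minimal ?_ hcl hp
  rintro p ⟨φ, hφ, h1, h2⟩
  simp only [Set.mem_ofPred_eq]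
  rw [MeasureTheory.L2.inner_def, MeasureTheory.L2.inner_def]
  have e1 : ∫ x in Ω, inner ℂ (p.2 x) (g x) =
      ∫ x in Ω, ∑ i, g x i * partialDeriv i (fun x => starRingEnd ℂ (φ x)) x := by
    refine integral_congr_ae ?_
    filter_upwards [h2] with x hx
    rw [PiLp.inner_apply]
    refine Finset.sum_congr rfl fun i _ => ?_
    rw [partialDeriv_star hφ, RCLike.inner_apply, hx i]
  have e2 : ∫ x in Ω, inner ℂ (p.1 x) (h x) = ∫ x in Ω, h x * starRingEnd ℂ (φ x) := by
    refine integral_congr_ae ?_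
    filter_upwards [h1] with x hx
    rw [RCLike.inner_apply, hx]
  rw [e1, e2]
  exact hg _ hφ.star

theorem IsTestFunction.memLp {φ : RSpace n → ℂ} (hφ : IsTestFunction Ω φ) :
    MemLp φ 2 (volume.restrict Ω) :=
  (hφ.continuous.memLp_of_hasCompactSupport hφ.compact).restrict _

theorem IsTestFunction.memLp_partialDeriv {φ : RSpace n → ℂ} (hφ : IsTestFunction Ω φ)
    (i : Fin n) : MemLp (partialDeriv i φ) 2 (volume.restrict Ω) :=
  ((hφ.continuous_partialDeriv i).memLp_of_hasCompactSupport
    (hφ.hasCompactSupport_partialDeriv i)).restrict _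

/-- Testing with the field that has ψ as its i-th component, of divergence ∂_i ψ, shows that each
gradient component is orthogonal to all test functions, hence zero. This makes V → L²(Ω) injective,
so that the eigenvalues of the L² form are positive. -/
theorem snd_eq_zero_of_fst_eq_zero (hΩ : IsOpen Ω) {p : L2 Ω ℂ × L2 Ω (CSpace n)}
    (hp : p ∈ H10 Ω) (h0 : p.1 = 0) : p.2 = 0 := by
  have key : ∀ i : Fin n, ∀ ψ : RSpace n → ℂ, IsTestFunction Ω ψ →
      ∫ x in Ω, ψ x * starRingEnd ℂ (p.2 x i) = 0 := by
    intro i ψ hψ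
    have hG : MemLp (fun x => EuclideanSpace.single i (ψ x)) 2 (volume.restrict Ω) := by
      refine hψ.memLp.of_le ?_ (Eventually.of_forall fun x => by
        rw [PiLp.norm_single])
      have : Continuous fun x => (EuclideanSpace.single i (ψ x) : CSpace n) := by
        have h0 : Continuous fun c : ℂ => (Pi.single i c : Fin n → ℂ) := by
          refine continuous_pi fun j => ?_
          by_cases hj : j = i
          · subst hj
            simpa only [Pi.single_eq_same] using continuous_id'
          · simpa [hj] using continuous_const
        have h1 : Continuous fun c : ℂ => (EuclideanSpace.single i c : CSpace n) :=
          (PiLp.continuous_toLp 2 _).comp h0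
        exact h1.comp hψ.continuous
      exact this.aestronglyMeasurable
    have hdiv : HasWeakDiv Ω (hG.toLp _) ((hψ.memLp_partialDeriv i).toLp _) := by
      intro φ hφ
      have e1 : ∫ x in Ω, ∑ j, (hG.toLp _ : L2 Ω (CSpace n)) x j * partialDeriv j φ x =
          ∫ x in Ω, ψ x * partialDeriv i φ x := by
        refine integral_congr_ae ?_
        filter_upwards [hG.coeFn_toLp] with x hx
        rw [hx, Finset.sum_eq_single i]
        · simp
        · intro j _ hj
          simp [hj]
        · simp
      have e2 : ∫ x in Ω, ((hψ.memLp_partialDeriv i).toLp _ : L2 Ω ℂ) x * φ x =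
          ∫ x in Ω, partialDeriv i ψ x * φ x := by
        refine integral_congr_ae ?_
        filter_upwards [(hψ.memLp_partialDeriv i).coeFn_toLp] with x hx
        rw [hx]
      rw [e1, e2]
      exact hψ.setIntegral_mul_partialDeriv hφ i
    have h1 := inner_snd_eq_neg_inner_fst hp hdiv
    rw [h0, inner_zero_left, neg_zero, MeasureTheory.L2.inner_def] at h1
    rw [← h1]
    refine integral_congr_ae ?_
    filter_upwards [hG.coeFn_toLp] with x hx
    rw [hx, PiLp.inner_apply, Finset.sum_eq_single i]
    · simp [RCLike.inner_apply]
    · intro j _ hj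
      simp [hj]
    · simp
  have hz : ∀ i : Fin n, ∀ᵐ x ∂(volume.restrict Ω), p.2 x i = 0 := by
    intro i
    have hi : LocallyIntegrableOn (fun x => starRingEnd ℂ (p.2 x i)) Ω volume := by
      have h1 : MemLp (fun x => p.2 x i) 2 (volume.restrict Ω) :=
        (Lp.memLp p.2).continuousLinearMap_comp (EuclideanSpace.proj (𝕜 := ℂ) i)
      have h2 : MemLp (fun x => starRingEnd ℂ (p.2 x i)) 2 (volume.restrict Ω) :=
        h1.of_le (Complex.continuous_conj.comp_aestronglyMeasurable h1.1)
          (Eventually.of_forall fun x => by simp)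
      exact locallyIntegrableOn_of_locallyIntegrable_restrict
        (h2.locallyIntegrable one_le_two)
    have h2 := hΩ.ae_eq_zero_of_integral_contDiff_smul_eq_zero hi fun g hg hgc hgs => by
      have htest : IsTestFunction Ω fun x => (g x : ℂ) :=
        { smooth := Complex.ofRealCLM.contDiff.comp hg
          compact := hgc.comp_left (g := ((↑) : ℝ → ℂ)) Complex.ofReal_zero
          support := (closure_mono (Function.support_comp_subset Complex.ofReal_zero g)).trans hgs }
      rw [← key i _ htest, setIntegral_eq_integral_of_forall_compl_eq_zero]
      · rfl
      · intro x hx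
        rw [Function.notMem_support.1 fun h => hx (htest.support_subset h), zero_mul]
    rw [ae_restrict_iff' hΩ.measurableSet]
    filter_upwards [h2] with x hx hxΩ
    simpa using hx hxΩ
  refine Lp.eq_zero_iff_ae_eq_zero.2 ?_
  filter_upwards [ae_all_iff.2 hz] with x hx
  ext i
  simpa using hx i

end Sobolev

/-! ### The Poincaré inequality on a bounded open set. -/

section Poincare

variable {n : ℕ} {Ω : Set (RSpace n)}

theorem norm_fderiv_le_norm_partialDeriv (φ : RSpace n → ℂ) (x : RSpace n) {g : CSpace n}
    (hg : ∀ i, g i = partialDeriv i φ x) : ‖fderiv ℝ φ x‖ ≤ ‖g‖ := by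
  refine ContinuousLinearMap.opNorm_le_bound _ (norm_nonneg _) fun v => ?_
  have hv : v = ∑ i, v i • EuclideanSpace.single i (1 : ℝ) := by
    ext j
    simp [Finset.sum_apply, Pi.single_apply]
  have h1 : fderiv ℝ φ x v = ∑ i, (v i : ℂ) * g i := by
    conv_lhs => rw [hv]
    rw [map_sum]
    refine Finset.sum_congr rfl fun i _ => ?_
    rw [map_smul, hg i, partialDeriv, Complex.real_smul]
  have h2 : ∑ i, (v i : ℂ) * g i =
      inner ℂ (WithLp.toLp 2 fun i => (v i : ℂ) : CSpace n) g := by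
    rw [PiLp.inner_apply]
    refine Finset.sum_congr rfl fun i _ => ?_
    rw [RCLike.inner_apply, mul_comm]
    simp
  have h3 : ‖(WithLp.toLp 2 fun i => (v i : ℂ) : CSpace n)‖ = ‖v‖ := by
    rw [EuclideanSpace.norm_eq, EuclideanSpace.norm_eq]
    simp
  rw [h1, h2, mul_comm, ← h3]
  exact norm_inner_le_norm _ _

/-- The exponent 3/2 works in the Gagliardo–Nirenberg–Sobolev inequality for both dimensions: it is
below n, and 2/3 − 1/n ≤ 1/2. The exponent 2 would not be below n = 2. -/
theorem exists_sobolev (hn : n = 2 ∨ n = 3) (hb : Bornology.IsBounded Ω) :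
    ∃ q : ℝ≥0∞, q ≠ 0 ∧ q ≤ 2 ∧ ∃ C : NNReal, ∀ φ : RSpace n → ℂ, IsTestFunction Ω φ →
      eLpNorm φ 2 volume ≤ C * eLpNorm (fderiv ℝ φ) q volume := by
  have hq : ((3 / 2 : NNReal) : ℝ≥0∞) ≤ 2 := by
    rw [← ENNReal.coe_ofNat, ENNReal.coe_le_coe, ← NNReal.coe_le_coe]
    norm_num
  have hn' : (3 / 2 : NNReal) < Module.finrank ℝ (RSpace n) := by
    rw [finrank_euclideanSpace_fin, ← NNReal.coe_lt_coe]
    rcases hn with rfl | rfl <;> norm_num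
  have hpq : ((3 / 2 : NNReal) : ℝ)⁻¹ - (Module.finrank ℝ (RSpace n) : ℝ)⁻¹ ≤
      ((2 : NNReal) : ℝ)⁻¹ := by
    rw [finrank_euclideanSpace_fin]
    rcases hn with rfl | rfl <;> norm_num
  have h1 : (1 : NNReal) ≤ 3 / 2 := by
    rw [← NNReal.coe_le_coe]
    norm_num
  refine ⟨(3 / 2 : NNReal), by simp, hq, eLpNormLESNormFDerivOfLeConst ℂ (volume : Measure (RSpace
    n)) Ω (3 / 2) 2,
    fun φ hφ => ?_⟩
  have := eLpNorm_le_eLpNorm_fderiv_of_le (volume : Measure (RSpace n))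
    (hφ.smooth.of_le (by simp)) hφ.support_subset h1 hn' hpq hb
  rw [ENNReal.coe_ofNat] at this
  exact this

theorem eLpNorm_eq_restrict_of_support_subset {X E : Type} [MeasurableSpace X] {μ : Measure X}
    [NormedAddCommGroup E] {f : X → E} {s : Set X} (hf : Function.support f ⊆ s) (q : ℝ≥0∞) :
    eLpNorm f q μ = eLpNorm f q (μ.restrict s) :=
  (eLpNorm_restrict_eq_of_support_subset hf).symm

theorem IsTestFunction.eLpNorm_fderiv_restrict {φ : RSpace n → ℂ} (hφ : IsTestFunction Ω φ)
    (q : ℝ≥0∞) : eLpNorm (fderiv ℝ φ) q volume = eLpNorm (fderiv ℝ φ) q (volume.restrict Ω) := by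
  have h : Function.support (fderiv ℝ φ) ⊆ Ω := (support_fderiv_subset ℝ).trans hφ.support
  exact eLpNorm_eq_restrict_of_support_subset h q

/-- Since Ω has finite measure, Hölder's inequality raises the exponent of the gradient to 2. -/
theorem exists_eLpNorm_le_partialDeriv (hn : n = 2 ∨ n = 3) (hb : Bornology.IsBounded Ω) :
    ∃ C : NNReal, ∀ (φ : RSpace n → ℂ) (g : RSpace n → CSpace n), IsTestFunction Ω φ →
      (∀ᵐ x ∂(volume.restrict Ω), ∀ i, g x i = partialDeriv i φ x) →
      eLpNorm φ 2 (volume.restrict Ω) ≤ C * eLpNorm g 2 (volume.restrict Ω) := by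
  obtain ⟨q, hq0, hq, C₁, hC₁⟩ := exists_sobolev hn hb
  have hexp : 0 ≤ 1 / q.toReal - 1 / (2 : ℝ≥0∞).toReal :=
    sub_nonneg.2 (one_div_le_one_div_of_le
      (ENNReal.toReal_pos hq0 (ne_top_of_le_ne_top (by simp) hq))
      (ENNReal.toReal_mono (by simp) hq))
  set C₂ := (volume Ω) ^ (1 / q.toReal - 1 / (2 : ℝ≥0∞).toReal) with hC₂
  have hC₂top : C₂ ≠ ⊤ := ENNReal.rpow_ne_top_of_nonneg hexp hb.measure_lt_top.ne
  refine ⟨C₁ * C₂.toNNReal, fun φ g hφ hg => ?_⟩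
  have hr : eLpNorm (fderiv ℝ φ) q volume = eLpNorm (fderiv ℝ φ) q (volume.restrict Ω) :=
    hφ.eLpNorm_fderiv_restrict q
  have ht : eLpNorm (fderiv ℝ φ) q (volume.restrict Ω) ≤
      eLpNorm (fderiv ℝ φ) 2 (volume.restrict Ω) * C₂ := by
    have := eLpNorm_le_eLpNorm_mul_rpow_measure_univ (μ := volume.restrict Ω) (f := fderiv ℝ φ)
      hq (hφ.smooth.continuous_fderiv (by simp)).aestronglyMeasurable
    rwa [Measure.restrict_apply_univ] at this
  have hg' : eLpNorm (fderiv ℝ φ) 2 (volume.restrict Ω) ≤ eLpNorm g 2 (volume.restrict Ω) := by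
    refine eLpNorm_mono_ae ?_
    filter_upwards [hg] with x hx
    exact norm_fderiv_le_norm_partialDeriv φ x hx
  calc _ ≤ eLpNorm φ 2 volume := eLpNorm_mono_measure φ Measure.restrict_le_self
    _ ≤ C₁ * eLpNorm (fderiv ℝ φ) q volume := hC₁ φ hφ
    _ ≤ C₁ * (eLpNorm g 2 (volume.restrict Ω) * C₂) := by
      rw [hr]
      gcongr
      exact ht.trans (by gcongr)
    _ = _ := by
      rw [ENNReal.coe_mul, ENNReal.coe_toNNReal hC₂top]
      ring

theorem exists_poincare (hn : n = 2 ∨ n = 3) (hb : Bornology.IsBounded Ω) :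
    ∃ c : ℝ, 0 ≤ c ∧ ∀ p ∈ H10 Ω, ‖p.1‖ ≤ c * ‖p.2‖ := by
  obtain ⟨C, hC⟩ := exists_eLpNorm_le_partialDeriv hn hb
  refine ⟨C, C.2, fun p hp => ?_⟩
  have hcl : IsClosed {p : L2 Ω ℂ × L2 Ω (CSpace n) | ‖p.1‖ ≤ C * ‖p.2‖} :=
    isClosed_le (by fun_prop) (by fun_prop)
  refine closure_minimal ?_ hcl hp
  rintro p ⟨φ, hφ, h1, h2⟩
  simp only [Set.mem_ofPred_eq]
  have h3 : eLpNorm p.1 2 (volume.restrict Ω) ≤ C * eLpNorm p.2 2 (volume.restrict Ω) := by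
    rw [eLpNorm_congr_ae h1]
    exact hC φ _ hφ h2
  rw [Lp.norm_def, Lp.norm_def, ← ENNReal.coe_toReal, ← ENNReal.toReal_mul]
  exact ENNReal.toReal_mono (ENNReal.mul_ne_top ENNReal.coe_ne_top (Lp.eLpNorm_ne_top p.2)) h3

end Poincare

/-- By polarisation, an identity between squared norms carries over to the inner products. -/
theorem inner_eq_inner_add_of_norm_sq {V X Y : Type} [NormedAddCommGroup V]
    [InnerProductSpace ℂ V] [NormedAddCommGroup X] [InnerProductSpace ℂ X] [NormedAddCommGroup Y]
    [InnerProductSpace ℂ Y] {κ : ℝ} (E₁ : V →ₗ[ℂ] X) (E₂ : V →ₗ[ℂ] Y)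
    (h : ∀ v, ‖v‖ ^ 2 = ‖E₂ v‖ ^ 2 + κ * ‖E₁ v‖ ^ 2) (v w : V) :
    inner ℂ v w = inner ℂ (E₂ v) (E₂ w) + κ * inner ℂ (E₁ v) (E₁ w) := by
  have hsq : ∀ v, (‖v‖ : ℂ) ^ 2 = (‖E₂ v‖ : ℂ) ^ 2 + κ * (‖E₁ v‖ : ℂ) ^ 2 := by
    intro v
    exact_mod_cast h v
  have pol : ∀ {E : Type} [NormedAddCommGroup E] [InnerProductSpace ℂ E] (x y : E),
      inner ℂ x y = ((‖x + y‖ : ℂ) ^ 2 - (‖x - y‖ : ℂ) ^ 2 +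
        ((‖x - Complex.I • y‖ : ℂ) ^ 2 - (‖x + Complex.I • y‖ : ℂ) ^ 2) * Complex.I) / 4 :=
    fun x y => inner_eq_sum_norm_sq_div_four x y
  rw [pol, pol, pol, hsq, hsq, hsq, hsq]
  simp only [map_add, map_sub, map_smul]
  ring

namespace DiscreteSpace

/-! ### Simultaneous diagonalisation of the embedding and of A. -/

section Spectral

variable {n : ℕ} {κ : ℝ} {Ω : Set (RSpace n)} {V : Type}
  [NormedAddCommGroup V] [InnerProductSpace ℂ V] (S : DiscreteSpace κ Ω V)

theorem inner_eq (v w : V) : inner ℂ v w =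
    inner ℂ (S.emb v).2 (S.emb w).2 + κ * inner ℂ (S.emb v).1 (S.emb w).1 :=
  inner_eq_inner_add_of_norm_sq ((LinearMap.fst ℂ _ _).comp S.emb)
    ((LinearMap.snd ℂ _ _).comp S.emb) S.norm_sq v w

theorem emb_fst_ne_zero (hΩ : IsOpen Ω) {v : V} (hv : v ≠ 0) : (S.emb v).1 ≠ 0 := by
  intro h
  have h2 := snd_eq_zero_of_fst_eq_zero hΩ (S.emb_mem v) h
  have := S.norm_sq v
  rw [h, h2] at this
  simp at this
  exact hv this

/-- The constant is chosen before V, which is what makes the final bound uniform over discrete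
spaces. Adding one makes it positive. -/
theorem exists_norm_emb_fst_le (hn : n = 2 ∨ n = 3)
    (hb : Bornology.IsBounded Ω) (hκ : κ = 0 ∨ κ = 1) :
    ∃ c : ℝ, 0 < c ∧ ∀ (V : Type) [NormedAddCommGroup V] [InnerProductSpace ℂ V]
      (S : DiscreteSpace κ Ω V) (v : V), ‖(S.emb v).1‖ ≤ c * ‖v‖ := by
  obtain ⟨c, hc, h⟩ := exists_poincare hn hb
  refine ⟨c + 1, by linarith, fun V _ _ S v => ?_⟩
  have h1 := h _ (S.emb_mem v)
  have h2 : ‖(S.emb v).2‖ ≤ ‖v‖ := by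
    refine abs_le_of_sq_le_sq' ?_ (norm_nonneg _) |>.2
    have := S.norm_sq v
    rcases hκ with rfl | rfl <;> nlinarith [sq_nonneg ‖(S.emb v).1‖]
  nlinarith [norm_nonneg v, mul_le_mul_of_nonneg_left h2 hc]

variable [FiniteDimensional ℂ V]

@[simp]
theorem toDual_apply (v w : V) : S.toDual v w = inner ℂ (S.emb w).1 (S.emb v).1 := rfl

@[simp]
theorem A_apply (v w : V) : S.A v w = inner ℂ (S.emb w).2 (S.emb v).2 := rfl

/-- The embedding `V → V⋆` as a continuous linear map. -/
def toDualL : V →L[ℂ] AntiDual V :=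
  LinearMap.toContinuousLinearMap
    { toFun := S.toDual
      map_add' := fun v w => by ext; simp [inner_add_right]
      map_smul' := fun c v => by ext; simp [inner_smul_right] }

@[simp]
theorem toDualL_apply (v : V) : S.toDualL v = S.toDual v := rfl

theorem norm_toDual_le {c : ℝ} (hc : ∀ v, ‖(S.emb v).1‖ ≤ c * ‖v‖) (v : V) :
    ‖S.toDual v‖ ≤ c ^ 2 * ‖v‖ := by
  refine ContinuousLinearMap.opNorm_le_bound _ (by positivity) fun w => ?_
  rw [toDual_apply]
  calc _ ≤ ‖(S.emb w).1‖ * ‖(S.emb v).1‖ := norm_inner_le_norm _ _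
    _ ≤ (c * ‖w‖) * (c * ‖v‖) := mul_le_mul (hc w) (hc v) (norm_nonneg _)
        ((norm_nonneg _).trans (hc w))
    _ = _ := by ring

/-- The L² form is represented in V by the self-adjoint T = E₁⋆E₁, with eigenvalues `m j`. The inner
product of V is the Dirichlet form plus κ times the L² form, so the same basis diagonalises A, with
eigenvalues 1 − κ `m j`. -/
theorem exists_eigenbasis (hΩ : IsOpen Ω) :
    ∃ (e : OrthonormalBasis (Fin (Module.finrank ℂ V)) ℂ V) (m : Fin (Module.finrank ℂ V) → ℝ),
      (∀ j, 0 < m j) ∧ (∀ j, 0 ≤ 1 - κ * m j) ∧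
      (∀ j v, S.toDual v (e j) = m j * inner ℂ (e j) v) ∧
      ∀ j v, S.A v (e j) = (1 - κ * m j : ℝ) * inner ℂ (e j) v := by
  have : CompleteSpace V := FiniteDimensional.complete ℂ V
  set E₁ : V →L[ℂ] L2 Ω ℂ := LinearMap.toContinuousLinearMap ((LinearMap.fst ℂ _ _).comp S.emb)
    with hE₁
  have hE₁a : ∀ v, E₁ v = (S.emb v).1 := fun v => rfl
  set T : V →ₗ[ℂ] V := (ContinuousLinearMap.adjoint E₁ ∘L E₁).toLinearMap with hT
  have hTl : ∀ v w, inner ℂ (T v) w = inner ℂ (S.emb v).1 (S.emb w).1 := by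
    intro v w
    rw [← hE₁a, ← hE₁a]
    exact ContinuousLinearMap.adjoint_inner_left E₁ w (E₁ v)
  have hTr : ∀ v w, inner ℂ v (T w) = inner ℂ (S.emb v).1 (S.emb w).1 := by
    intro v w
    rw [← hE₁a, ← hE₁a]
    exact ContinuousLinearMap.adjoint_inner_right E₁ v (E₁ w)
  have hsym : T.IsSymmetric := fun v w => by rw [hTl, hTr]
  set e := hsym.eigenvectorBasis rfl
  set m := hsym.eigenvalues rfl
  have hTe : ∀ j, T (e j) = (m j : ℂ) • e j := hsym.apply_eigenvectorBasis rfl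
  have hB : ∀ j v, inner ℂ (S.emb (e j)).1 (S.emb v).1 = m j * inner ℂ (e j) v := by
    intro j v
    rw [← hTl, hTe, inner_smul_left, Complex.conj_ofReal]
  have hA : ∀ j v, inner ℂ (S.emb (e j)).2 (S.emb v).2 = (1 - κ * m j : ℝ) * inner ℂ (e j) v := by
    intro j v
    have h1 := S.inner_eq (e j) v
    rw [hB] at h1
    push_cast
    linear_combination -h1
  have hee : ∀ j, inner ℂ (e j) (e j) = (1 : ℂ) := by
    intro j
    rw [inner_self_eq_norm_sq_to_K, e.orthonormal.1 j]
    simp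
  refine ⟨e, m, fun j => ?_, fun j => ?_, hB, hA⟩
  · have h1 := hB j (e j)
    rw [hee, mul_one, inner_self_eq_norm_sq_to_K] at h1
    have h2 : ‖(S.emb (e j)).1‖ ^ 2 = m j := Complex.ofReal_injective (by push_cast; exact h1)
    rw [← h2]
    have := norm_pos_iff.2 (S.emb_fst_ne_zero hΩ (e.toBasis.ne_zero j))
    rw [OrthonormalBasis.coe_toBasis] at this
    positivity
  · have h1 := hA j (e j)
    rw [hee, mul_one, inner_self_eq_norm_sq_to_K] at h1
    have h2 : ‖(S.emb (e j)).2‖ ^ 2 = 1 - κ * m j :=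
      Complex.ofReal_injective (by rw [Complex.ofReal_pow]; exact h1)
    rw [← h2]
    positivity

end Spectral

end DiscreteSpace

/-! ### The initial data of the solution and of its time derivative. -/

section InitialData

variable {n : ℕ} {κ : ℝ} {Ω : Set (RSpace n)} {V : Type}
  [NormedAddCommGroup V] [InnerProductSpace ℂ V]

theorem H2.hasWeakDiv_grad (u : H2 Ω) : HasWeakDiv Ω u.grad u.laplacian := by
  intro φ hφ
  have hgrad : ∀ i, MemLp (fun x => u.grad x i) 2 (volume.restrict Ω) := fun i =>
    (Lp.memLp u.grad).continuousLinearMap_comp (EuclideanSpace.proj (𝕜 := ℂ) i)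
  have hhess : ∀ i, MemLp (fun x => u.hess x (i, i)) 2 (volume.restrict Ω) := fun i =>
    (Lp.memLp u.hess).continuousLinearMap_comp (EuclideanSpace.proj (𝕜 := ℂ) (i, i))
  have hI : ∀ i, Integrable (fun x => u.grad x i * partialDeriv i φ x) (volume.restrict Ω) :=
    fun i => (hgrad i).integrable_mul (hφ.memLp_partialDeriv i)
  have hJ : ∀ i, Integrable (fun x => u.hess x (i, i) * φ x) (volume.restrict Ω) :=
    fun i => (hhess i).integrable_mul hφ.memLp
  have e : ∫ x in Ω, u.laplacian x * φ x = ∫ x in Ω, ∑ i, u.hess x (i, i) * φ x := by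
    refine integral_congr_ae ?_
    filter_upwards [ContinuousLinearMap.coeFn_compLp (∑ i : Fin n, (EuclideanSpace.proj (i, i) :
      EuclideanSpace ℂ (Fin n × Fin n) →L[ℂ] ℂ)) u.hess] with x hx
    rw [H2.laplacian, hx, ← Finset.sum_mul]
    simp
  rw [e, integral_finsetSum _ fun i _ => hI i, integral_finsetSum _ fun i _ => hJ i,
    ← Finset.sum_neg_distrib]
  exact Finset.sum_congr rfl fun i _ => u.weak_hess i i φ hφ

/-- The projection tested with itself is a contraction in the full H¹ norm, which dominates the norm
of V for either value of κ. -/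
theorem DiscreteSpace.norm_sq_le_normSq (S : DiscreteSpace κ Ω V) (hκ : κ = 0 ∨ κ = 1) {u₀ : H2 Ω}
    {u₀h : V}
    (hu : S.IsH1Proj u₀.toH1 u₀h) : ‖u₀h‖ ^ 2 ≤ u₀.normSq := by
  set a := ‖(S.emb u₀h).1‖
  set b := ‖(S.emb u₀h).2‖
  have h1 := hu u₀h
  rw [inner_sub_right, inner_sub_right, inner_self_eq_norm_sq_to_K, inner_self_eq_norm_sq_to_K]
    at h1
  have h2 : ((a ^ 2 + b ^ 2 : ℝ) : ℂ) =
      inner ℂ (S.emb u₀h).1 u₀.val + inner ℂ (S.emb u₀h).2 u₀.grad := by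
    push_cast
    linear_combination h1
  have h3 : a ^ 2 + b ^ 2 ≤ a * ‖u₀.val‖ + b * ‖u₀.grad‖ := by
    calc a ^ 2 + b ^ 2 = ‖((a ^ 2 + b ^ 2 : ℝ) : ℂ)‖ := by
          rw [Complex.norm_real, Real.norm_of_nonneg (by positivity)]
      _ ≤ _ := by
          rw [h2]
          exact (norm_add_le _ _).trans
            (add_le_add (norm_inner_le_norm _ _) (norm_inner_le_norm _ _))
  have h4 := S.norm_sq u₀h
  have h5 : ‖u₀h‖ ^ 2 ≤ a ^ 2 + b ^ 2 := by
    rw [h4]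
    rcases hκ with rfl | rfl
    · nlinarith [sq_nonneg a]
    · exact le_of_eq (by ring)
  unfold H2.normSq
  nlinarith [sq_nonneg (a - ‖u₀.val‖), sq_nonneg (b - ‖u₀.grad‖), sq_nonneg ‖u₀.hess‖]

variable [FiniteDimensional ℂ V] (S : DiscreteSpace κ Ω V)

/-- For w in V ⊆ H¹₀ there is no boundary term, so (∇u₀, ∇w) = −(Δu₀, w). The H¹ projection then
gives (∇u₀h, ∇w) = −(Δu₀, w) − (u₀h − u₀, w), and each function may be replaced by its L²
projection. -/
theorem DiscreteSpace.l2Functional_sub_A_eq_toDual {f₀ : H1 Ω} {u₀ : H2 Ω}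
    {u₀h Pf₀ PΔu₀ Pu₀ : V} (hu : S.IsH1Proj u₀.toH1 u₀h) (hf : S.IsL2Proj f₀.val Pf₀)
    (hΔ : S.IsL2Proj u₀.laplacian PΔu₀) (hP : S.IsL2Proj u₀.val Pu₀) (w : V) :
    S.l2Functional f₀.val w - S.A u₀h w = S.toDual (Pf₀ + PΔu₀ + (u₀h - Pu₀)) w := by
  have h1 := hu w
  have h2 := hf w
  have h3 := hΔ w
  have h4 := hP w
  have h5 := inner_snd_eq_neg_inner_fst (S.emb_mem w) u₀.hasWeakDiv_grad
  have h6 : S.toDual (Pf₀ + PΔu₀ + (u₀h - Pu₀)) w = S.toDual Pf₀ w + S.toDual PΔu₀ w +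
      (S.toDual u₀h w - S.toDual Pu₀ w) := by
    simp only [← S.toDualL_apply, map_add, map_sub]
    rfl
  have h7 : S.l2Functional f₀.val w = inner ℂ (S.emb w).1 f₀.val := rfl
  rw [h6, h7]
  simp only [DiscreteSpace.A_apply, DiscreteSpace.toDual_apply]
  rw [inner_sub_right] at h1 h2 h3 h4
  rw [inner_sub_right] at h1
  linear_combination -h1 - h2 - h3 + h4 - h5

end InitialData

/-! ### Reduction of the goal functional to one vertical line. -/

section Goal

variable {n : ℕ} {κ : ℝ} {Ω : Set (RSpace n)} {V : Type}
  [NormedAddCommGroup V] [InnerProductSpace ℂ V] [FiniteDimensional ℂ V]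
  (S : DiscreteSpace κ Ω V)

theorem hardySq_congr {X : Type} [NormedAddCommGroup X] [NormedSpace ℂ X] {α : ℝ} {g h : ℂ → X}
    (H : ∀ s : ℂ, α < s.re → g s = h s) : hardySq α g = hardySq α h := by
  unfold hardySq
  refine iSup_congr fun σ => iSup_congr fun hσ => ?_
  have e : ∀ τ : ℝ, g (σ + Complex.I * τ) = h (σ + Complex.I * τ) := fun τ =>
    H _ (by simpa using hσ)
  simp only [e]

/-- The operator 1 − P commutes with the transform, so both Hardy functions are themselves Laplace
transforms. The embedding V ⊆ V⋆ has norm at most c², which enters squared. -/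
theorem goal_le {c α : ℝ} (hc : ∀ v, ‖(S.emb v).1‖ ≤ c * ‖v‖) {u u' : ℝ → V}
    (hu : LaplaceIntegrable u α) (hu' : LaplaceIntegrable u' α) (W : Submodule ℂ V) :
    goal S α u u' W ≤
      (∫⁻ τ : ℝ, ‖laplace u (α + Complex.I * τ) -
        W.starProjection (laplace u (α + Complex.I * τ))‖ₑ ^ 2) +
      ENNReal.ofReal (c ^ 4) * ∫⁻ τ : ℝ, ‖laplace u' (α + Complex.I * τ) -
        W.starProjection (laplace u' (α + Complex.I * τ))‖ₑ ^ 2 := by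
  have : CompleteSpace V := FiniteDimensional.complete ℂ V
  set Q : V →L[ℂ] V := ContinuousLinearMap.id ℂ V - W.starProjection
  have hre : ∀ τ : ℝ, (α : ℂ).re ≤ (α + Complex.I * τ : ℂ).re := fun τ => by simp
  have hQ : ∀ v, Q v = v - W.starProjection v := fun v => rfl
  refine add_le_add ?_ ?_
  · rw [hardySq_congr (h := laplace fun t => Q (u t)) fun s hs => by
      rw [(laplace_clm Q (hu.mono (by simpa using hs.le))).2, hQ]]
    refine (hardySq_laplace_le (laplace_clm Q hu).1).trans (le_of_eq ?_)
    refine lintegral_congr fun τ => ?_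
    rw [(laplace_clm Q (hu.mono (hre τ))).2, hQ]
  · have hT : ∀ s : ℂ, α ≤ s.re →
        laplace (fun t => S.toDual (Q (u' t))) s = S.toDualL (Q (laplace u' s)) := fun s hs =>
      (laplace_clm (S.toDualL ∘L Q) (hu'.mono (by simpa using hs))).2
    rw [hardySq_congr (h := laplace fun t => S.toDual (Q (u' t))) fun s hs => by
      have h1 := (laplace_clm S.toDualL (hu'.mono (s' := s) (by simpa using hs.le))).2
      have h2 := (laplace_clm (S.toDualL ∘L W.starProjection)
        (hu'.mono (s' := s) (by simpa using hs.le))).2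
      rw [hT s hs.le, hQ, map_sub]
      exact congrArg₂ (· - ·) h1 h2]
    refine (hardySq_laplace_le (laplace_clm (S.toDualL ∘L Q) hu').1).trans ?_
    rw [← lintegral_const_mul' _ _ ENNReal.ofReal_ne_top]
    refine lintegral_mono fun τ => ?_
    have h3 := hT (α + Complex.I * τ) (by simp)
    rw [show laplace (fun t => (S.toDualL ∘L Q) (u' t)) (α + Complex.I * τ) = _ from h3, ← hQ]
    have h4 := S.norm_toDual_le hc (Q (laplace u' (α + Complex.I * τ)))
    rw [← ofReal_norm, ← ofReal_norm, ← ENNReal.ofReal_pow (norm_nonneg _),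
      ← ENNReal.ofReal_pow (norm_nonneg _), ← ENNReal.ofReal_mul (by positivity)]
    refine ENNReal.ofReal_le_ofReal ?_
    calc _ ≤ (c ^ 2 * ‖Q (laplace u' (α + Complex.I * τ))‖) ^ 2 :=
          pow_le_pow_left₀ (norm_nonneg _) h4 2
      _ = _ := by ring

end Goal

/-! ### Comparison of the rates in K and in R. -/

section Rate

/-- Subadditivity of the square root gives √(πdR) ≤ √(2πdK) + √(3πd), and 3πd ≤ 3π²/2 < 16. The
excess of R over 2K thus costs only the factor e⁴. -/
theorem rate_lower_bound {d : ℝ} (hd : d ∈ Ioo 0 (Real.pi / 2)) {K R : ℕ} (hR : R ≤ 2 * K + 3) :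
    Real.exp (-√(2 * Real.pi * d * K)) ≤
      Real.exp 4 * Real.exp (-2 * √(Real.pi * d * R / 4)) := by
  have hπ := Real.pi_pos
  have hd0 := hd.1
  rw [← Real.exp_add]
  refine Real.exp_le_exp.2 ?_
  have h1 : 2 * √(Real.pi * d * R / 4) = √(Real.pi * d * R) := by
    rw [Real.sqrt_div (by positivity), show (4 : ℝ) = 2 ^ 2 by norm_num,
      Real.sqrt_sq (by norm_num)]
    ring
  have h2 : √(Real.pi * d * R) ≤ √(2 * Real.pi * d * K) + √(3 * Real.pi * d) := by
    rw [Real.sqrt_le_left (by positivity), add_sq, Real.sq_sqrt (by positivity),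
      Real.sq_sqrt (by positivity)]
    have h0 : 0 ≤ 2 * √(2 * Real.pi * d * K) * √(3 * Real.pi * d) := by positivity
    have : (R : ℝ) ≤ 2 * K + 3 := by exact_mod_cast hR
    have h3 : Real.pi * d * R ≤ Real.pi * d * (2 * K + 3) := by gcongr
    linarith
  have h3 : √(3 * Real.pi * d) ≤ 4 := by
    rw [Real.sqrt_le_left (by norm_num)]
    nlinarith [Real.pi_lt_d2, hd.2]
  linarith

theorem sqrt_mul_exp_le_rate {d : ℝ} (hd : d ∈ Ioo 0 (Real.pi / 2)) {K R : ℕ} (hKR : K ≤ R)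
    (hR : R ≤ 2 * K + 3) :
    √K * Real.exp (-√(2 * Real.pi * d * K)) ≤ Real.exp 4 * rate d R := by
  unfold rate
  rw [← Real.sqrt_eq_rpow]
  calc _ ≤ √R * (Real.exp 4 * Real.exp (-2 * √(Real.pi * d * R / 4))) :=
        mul_le_mul (Real.sqrt_le_sqrt (by exact_mod_cast hKR)) (rate_lower_bound hd hR)
          (Real.exp_pos _).le (Real.sqrt_nonneg _)
    _ = _ := by ring

theorem one_le_rate {d : ℝ} (hd : d ∈ Ioo 0 (Real.pi / 2)) {R : ℕ} (h1 : 1 ≤ R) (hR : R ≤ 3) :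
    1 ≤ Real.exp 4 * rate d R := by
  have h := rate_lower_bound (K := 0) hd (R := R) (by omega)
  simp only [Nat.cast_zero, mul_zero, Real.sqrt_zero, neg_zero, Real.exp_zero] at h
  unfold rate
  rw [← Real.sqrt_eq_rpow]
  have h2 : 1 ≤ √(R : ℝ) := Real.one_le_sqrt.2 (by exact_mod_cast h1)
  have h3 := mul_le_mul h2 h zero_le_one (Real.sqrt_nonneg _)
  linarith

end Rate

/-! ### Assembly of the bounds. -/

section Main

theorem finrank_span_nodes_le {V : Type} [NormedAddCommGroup V] [InnerProductSpace ℂ V] (q : V)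
    (w : ℤ → V) (K : ℕ) :
    Module.finrank ℂ (Submodule.span ℂ ({q} ∪ w '' {k : ℤ | |k| ≤ (K : ℤ)})) ≤ 2 * K + 2 := by
  classical
  have h1 : ({q} ∪ w '' {k : ℤ | |k| ≤ (K : ℤ)} : Set V) =
      (({q} ∪ (Finset.Icc (-(K : ℤ)) K).image w : Finset V) : Set V) := by
    ext v
    simp [abs_le]
  rw [h1]
  refine (finrank_span_finset_le_card _).trans ((Finset.card_union_le _ _).trans ?_)
  have h2 : ((Finset.Icc (-(K : ℤ)) K).image w).card ≤ 2 * K + 1 := by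
    refine Finset.card_image_le.trans ?_
    rw [Int.card_Icc]
    omega
  rw [Finset.card_singleton]
  omega

variable {n : ℕ} {κ : ℝ} {Ω : Set (RSpace n)} {V : Type}
  [NormedAddCommGroup V] [InnerProductSpace ℂ V] [FiniteDimensional ℂ V]

/-- The dependence of the error bound on `d`. -/
def angleConst (d : ℝ) : ℝ := (10 * stripConst d + 4) * ((1 - Real.sin d)⁻¹) ^ 2

theorem angleConst_pos {d : ℝ} (hd : d ∈ Ioo 0 (Real.pi / 2)) : 0 < angleConst d := by
  have h1 := stripConst_pos hd.1
  have h2 := one_sub_sin_pos hd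
  unfold angleConst
  positivity

/-- The divergence comes from (1 − sin d)⁻² alone; the other factor is at least one. -/
theorem tendsto_angleConst : Tendsto angleConst (𝓝[<] (Real.pi / 2)) atTop := by
  have h1 : Tendsto (fun d => 1 - Real.sin d) (𝓝[<] (Real.pi / 2)) (𝓝[>] 0) := by
    refine tendsto_nhdsWithin_iff.2 ⟨?_, ?_⟩
    · have : Tendsto (fun d => 1 - Real.sin d) (𝓝 (Real.pi / 2)) (𝓝 (1 - Real.sin (Real.pi / 2))) :=
        (continuous_const.sub Real.continuous_sin).tendsto _
      rw [Real.sin_pi_div_two, sub_self] at this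
      exact this.mono_left nhdsWithin_le_nhds
    · filter_upwards [Ioo_mem_nhdsLT (by positivity : (0 : ℝ) < Real.pi / 2)] with d hd
      exact one_sub_sin_pos hd
  have h2 : Tendsto (fun d => ((1 - Real.sin d)⁻¹) ^ 2) (𝓝[<] (Real.pi / 2)) atTop :=
    (tendsto_pow_atTop two_ne_zero).comp (tendsto_inv_nhdsGT_zero.comp h1)
  refine tendsto_atTop_mono' _ ?_ h2
  filter_upwards [Ioo_mem_nhdsLT (by positivity : (0 : ℝ) < Real.pi / 2)] with d hd
  have h3 := stripConst_pos hd.1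
  unfold angleConst
  exact le_mul_of_one_le_left (by positivity) (by linarith)

/-- For Re s > 0 no diagonal entry s `m j` + `p j` vanishes, so the solution is unique; it is
therefore the value of the transform of u. -/
theorem DiscreteSpace.IsLaplaceSolution.eq_resolvent {S : DiscreteSpace κ Ω V} {ι : Type*}
    [Fintype ι] (e : OrthonormalBasis ι ℂ V) {m p : ι → ℝ} (hm : ∀ j, 0 < m j) (hp : ∀ j, 0 ≤ p j)
    (hB : ∀ j v, S.toDual v (e j) = m j * inner ℂ (e j) v)
    (hA : ∀ j v, S.A v (e j) = p j * inner ℂ (e j) v) {s : ℂ} (hs : 0 < s.re) {φ : AntiDual V}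
    {q w : V} (hw : S.IsLaplaceSolution s (φ + S.toDual q) w) : w = resolvent e m p s φ q := by
  rw [← e.sum_repr' w, resolvent]
  refine Finset.sum_congr rfl fun j _ => ?_
  congr 1
  have hne : s * m j + p j ≠ 0 := by
    intro h
    have := congrArg Complex.re h
    simp only [Complex.add_re, Complex.mul_re, Complex.ofReal_re, Complex.ofReal_im, mul_zero,
      sub_zero, Complex.zero_re] at this
    have h1 := mul_pos hs (hm j)
    linarith [hp j]
  have h1 := congrArg (fun ψ : AntiDual V => ψ (e j)) hw
  simp only [add_apply, smul_apply, hB, hA,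
    smul_eq_mul] at h1
  rw [eq_div_iff hne]
  linear_combination h1

theorem add_ofReal_le_ofReal_mul {a b : ℝ≥0∞} {x β M : ℝ} (hM : 1 ≤ M) (hx : x ≤ M * β) :
    a + ENNReal.ofReal x ≤ ENNReal.ofReal M * (a + b + ENNReal.ofReal β) := by
  have h1 : (1 : ℝ≥0∞) ≤ ENNReal.ofReal M := by
    rw [← ENNReal.ofReal_one]
    exact ENNReal.ofReal_le_ofReal hM
  rw [mul_add, mul_add, ← ENNReal.ofReal_mul (by linarith)]
  exact add_le_add ((le_mul_of_one_le_left' h1).trans le_self_add) (ENNReal.ofReal_le_ofReal hx)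

theorem add_ofReal_mul_le {a b N : ℝ≥0∞} {c T M T' : ℝ} (hc : 0 ≤ c) (hM : 0 ≤ M)
    (hTT : T ≤ T') (ha : a ≤ ENNReal.ofReal T * (ENNReal.ofReal M * N))
    (hb : b ≤ ENNReal.ofReal T * (ENNReal.ofReal M * N)) :
    a + ENNReal.ofReal c * b ≤ ENNReal.ofReal ((1 + c) * M * T') * N := by
  calc _ ≤ ENNReal.ofReal T * (ENNReal.ofReal M * N) +
        ENNReal.ofReal c * (ENNReal.ofReal T * (ENNReal.ofReal M * N)) := by gcongr
    _ = ENNReal.ofReal ((1 + c) * M * T) * N := by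
      rw [ENNReal.ofReal_mul (by positivity), ENNReal.ofReal_mul (by positivity),
        ENNReal.ofReal_add zero_le_one hc, ENNReal.ofReal_one]
      ring
    _ ≤ _ := by gcongr

/-- The first conclusion is the sinc estimate for both terms of `goal`, the second the unsampled
bound for arbitrary W, and the third identifies solutions at the sinc points with values of `laplace
u`. -/
theorem goal_bounds (hΩ : IsOpen Ω) (hκ : κ = 0 ∨ κ = 1) {c α d C₀ : ℝ}
    (hd : d ∈ Ioo 0 (Real.pi / 2)) (hα : 1 ≤ α) (S : DiscreteSpace κ Ω V)
    (hc : ∀ v, ‖(S.emb v).1‖ ≤ c * ‖v‖) {f f' : ℝ → AntiDual V} {F F' : ℂ → AntiDual V}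
    {f₀ : H1 Ω} {u₀ : H2 Ω} {u₀h Pf₀ PΔu₀ Pu₀ : V} {u u' : ℝ → V}
    (hu₀h : S.IsH1Proj u₀.toH1 u₀h) (hPf : S.IsL2Proj f₀.val Pf₀)
    (hPΔ : S.IsL2Proj u₀.laplacian PΔu₀) (hPu : S.IsL2Proj u₀.val Pu₀)
    (hadm : Admissible S α d C₀ f f' F F' f₀) (hsol : S.IsSolution f u₀h u u') :
    (∀ K : ℕ, 1 ≤ K → ∀ W : Submodule ℂ V, u₀h ∈ W →
      (∀ k : ℤ, |k| ≤ (K : ℤ) → laplace u (α + Complex.I * sincPoint d K k) ∈ W) →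
      goal S α u u' W ≤
        ENNReal.ofReal ((1 + c ^ 4) * (2 * C₀ ^ 2 + 6) *
          (angleConst d * (√K * Real.exp (-√(2 * Real.pi * d * K))))) *
        (nTwoSq d F + nTwoSq d F' +
          ENNReal.ofReal (1 + ‖Pf₀‖ ^ 2 + ‖PΔu₀‖ ^ 2 + ‖u₀h - Pu₀‖ ^ 2 + u₀.normSq))) ∧
    (∀ W : Submodule ℂ V, goal S α u u' W ≤
      ENNReal.ofReal ((1 + c ^ 4) * (2 * C₀ ^ 2 + 6) * angleConst d) *
        (nTwoSq d F + nTwoSq d F' +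
          ENNReal.ofReal (1 + ‖Pf₀‖ ^ 2 + ‖PΔu₀‖ ^ 2 + ‖u₀h - Pu₀‖ ^ 2 + u₀.normSq))) ∧
    ∀ (τ : ℝ) (w : V), S.IsLaplaceSolution (α + Complex.I * τ) (F τ + S.toDual u₀h) w →
      w = laplace u (α + Complex.I * τ) := by
  have : CompleteSpace V := FiniteDimensional.complete ℂ V
  obtain ⟨e, m, hm, hp, hB, hA⟩ := S.exists_eigenbasis hΩ
  have heq : ∀ᵐ t ∂(volume.restrict (Ioi (0 : ℝ))), ∀ j, m j * inner ℂ (e j) (u' t) +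
      ((1 - κ * m j : ℝ) : ℂ) * inner ℂ (e j) (u t) = f t (e j) := by
    filter_upwards [hsol.equation] with t ht j
    rw [← ht, add_apply, hB, hA]
  have hevo := fun {s : ℂ} (hs : 0 < s.re) => laplace_evolution e hm hp hadm.memLp_deriv
    hadm.primitive hsol.memLp hsol.primitive heq hs
  have hf' : ∀ {s : ℂ}, 0 < s.re → LaplaceIntegrable f' s := fun hs =>
    LaplaceIntegrable.of_memLp hadm.memLp_deriv hs
  have hf : ∀ {s : ℂ}, 0 < s.re → LaplaceIntegrable f s := fun hs =>
    ((hf' hs).const_add_primitive hs hadm.primitive).1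
  -- Since f' is in unweighted L², both transforms converge for all Re s > 0, so α/2 is an abscissa
  -- strictly to the left of α.
  have hα2 : 0 < ((α / 2 : ℝ) : ℂ).re := by
    rw [Complex.ofReal_re]
    linarith
  have hF : ∀ τ : ℝ, F τ = laplace f (α + Complex.I * τ) :=
    hadm.extends_f.eq_on_line hd (α₀ := α / 2) (by linarith) (hf hα2)
  have hF' : ∀ τ : ℝ, F' τ = laplace f' (α + Complex.I * τ) :=
    hadm.extends_deriv.eq_on_line hd (α₀ := α / 2) (by linarith) (hf' hα2)
  have hs : ∀ τ : ℝ, 0 < (α + Complex.I * τ : ℂ).re := fun τ => by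
    simp only [Complex.add_re, Complex.ofReal_re, Complex.mul_re, Complex.I_re, zero_mul,
      Complex.I_im, one_mul, Complex.ofReal_im, sub_self, add_zero]
    linarith
  have hαre : 0 < (α : ℂ).re := by
    rw [Complex.ofReal_re]
    linarith
  set q := Pf₀ + PΔu₀ + (u₀h - Pu₀) with hq
  have hG : ∀ τ : ℝ, laplace u (α + Complex.I * τ) =
      resolvent e m (fun j => 1 - κ * m j) (α + Complex.I * τ) (F τ) u₀h := fun τ => by
    rw [hF, (hevo (hs τ)).2.2.1]
  have hG' : ∀ τ : ℝ, laplace u' (α + Complex.I * τ) =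
      resolvent e m (fun j => 1 - κ * m j) (α + Complex.I * τ) (F' τ) q := fun τ => by
    rw [hF']
    refine (hevo (hs τ)).2.2.2.2 q fun j => ?_
    rw [← hB, ← S.l2Functional_sub_A_eq_toDual hu₀h hPf hPΔ hPu, hA, hadm.initial]
  have hκ1 : κ ≤ 1 := by rcases hκ with rfl | rfl <;> norm_num
  -- Both lower bounds on ν = p + αm use κ ≤ 1 ≤ α; this is where α ≥ 1 removes α from the
  -- constants.
  have hν : ∀ j, m j ≤ (1 - κ * m j) + α * m j := fun j => by nlinarith [hm j, hp j]
  have hν1 : ∀ j, 1 ≤ (1 - κ * m j) + α * m j := fun j => by nlinarith [hm j]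
  have hC : ∀ τ : ℝ, ‖F τ‖ ≤ C₀ / √(1 + τ ^ 2) := fun τ =>
    (le_add_of_nonneg_right (norm_nonneg _)).trans (hadm.decay τ)
  have hC' : ∀ τ : ℝ, ‖F' τ‖ ≤ C₀ / √(1 + τ ^ 2) := fun τ =>
    (le_add_of_nonneg_left (norm_nonneg _)).trans (hadm.decay τ)
  set β := 1 + ‖Pf₀‖ ^ 2 + ‖PΔu₀‖ ^ 2 + ‖u₀h - Pu₀‖ ^ 2 + u₀.normSq with hβ
  have hnormSq := S.norm_sq_le_normSq hκ hu₀h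
  -- The constant comes from (C₀ + ‖q‖)² ≤ 2C₀² + 2‖q‖², together with ‖q‖² ≤ 3β for a sum of three
  -- terms and 1 ≤ β.
  have hM : 1 ≤ 2 * C₀ ^ 2 + 6 := by nlinarith [sq_nonneg C₀]
  have hβ1 : 1 ≤ β := by
    have : 0 ≤ u₀.normSq := (sq_nonneg _).trans hnormSq
    rw [hβ]
    linarith [sq_nonneg ‖Pf₀‖, sq_nonneg ‖PΔu₀‖, sq_nonneg ‖u₀h - Pu₀‖]
  have hx : (C₀ + ‖u₀h‖) ^ 2 ≤ (2 * C₀ ^ 2 + 6) * β := by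
    have h1 : ‖u₀h‖ ^ 2 ≤ β := by
      rw [hβ]
      linarith [sq_nonneg ‖Pf₀‖, sq_nonneg ‖PΔu₀‖, sq_nonneg ‖u₀h - Pu₀‖]
    have h2 := mul_le_mul_of_nonneg_left hβ1 (sq_nonneg C₀)
    linarith [sq_nonneg (C₀ - ‖u₀h‖), add_sq C₀ ‖u₀h‖, sub_sq C₀ ‖u₀h‖]
  have hx' : (C₀ + ‖q‖) ^ 2 ≤ (2 * C₀ ^ 2 + 6) * β := by
    have h1 : ‖q‖ ^ 2 ≤ 3 * β := by
      have h3 : ‖q‖ ≤ ‖Pf₀‖ + ‖PΔu₀‖ + ‖u₀h - Pu₀‖ := norm_add₃_le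
      have h4 : 0 ≤ u₀.normSq := (sq_nonneg _).trans hnormSq
      have h5 := pow_le_pow_left₀ (norm_nonneg q) h3 2
      rw [hβ]
      linarith [sq_nonneg (‖Pf₀‖ - ‖PΔu₀‖), sq_nonneg (‖PΔu₀‖ - ‖u₀h - Pu₀‖),
        sq_nonneg (‖Pf₀‖ - ‖u₀h - Pu₀‖), add_sq (‖Pf₀‖ + ‖PΔu₀‖) ‖u₀h - Pu₀‖, add_sq ‖Pf₀‖ ‖PΔu₀‖,
        sub_sq ‖Pf₀‖ ‖PΔu₀‖, sub_sq ‖PΔu₀‖ ‖u₀h - Pu₀‖, sub_sq ‖Pf₀‖ ‖u₀h - Pu₀‖]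
    have h2 := mul_le_mul_of_nonneg_left hβ1 (sq_nonneg C₀)
    linarith [sq_nonneg (C₀ - ‖q‖), add_sq C₀ ‖q‖, sub_sq C₀ ‖q‖]
  have hgoal := goal_le S hc (hevo hαre).1 (hevo hαre).2.1
  simp only [hG, hG'] at hgoal
  have hc4 : 0 ≤ c ^ 4 := by positivity
  have hM0 : 0 ≤ 2 * C₀ ^ 2 + 6 := by linarith
  have hsc := stripConst_pos hd.1
  refine ⟨fun K hK W hW hWu => ?_, fun W => ?_, fun τ w hw => ?_⟩
  · refine (hgoal W).trans (add_ofReal_mul_le hc4 hM0 (T := 10 * stripConst d *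
      ((1 - Real.sin d)⁻¹) ^ 2 * (√K * Real.exp (-√(2 * Real.pi * d * K)))) ?_ ?_ ?_)
    · unfold angleConst
      have h0 : 0 ≤ 4 * ((1 - Real.sin d)⁻¹) ^ 2 *
          (√K * Real.exp (-√(2 * Real.pi * d * K))) := by positivity
      linarith
    · refine (lintegral_resolvent_sub_starProjection_le hd (fun j => (hm j).le) hν hν1
        hadm.extends_f.mem hC hK W fun k hk => ?_).trans ?_
      · rw [← hG]
        exact hWu k hk
      · gcongr
        exact add_ofReal_le_ofReal_mul hM hx
    · refine (lintegral_resolvent_sub_starProjection_le hd (fun j => (hm j).le) hν hν1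
        hadm.extends_deriv.mem hC' hK W fun k hk => ?_).trans ?_
      -- The sample of the transform of u' is s û(s) − u₀h, which is why u₀h has to belong to W.
      · rw [← hG', (hevo (hs _)).2.2.2.1]
        exact W.sub_mem (W.smul_mem _ (hWu k hk)) hW
      · gcongr
        rw [add_comm (nTwoSq d F)]
        exact add_ofReal_le_ofReal_mul hM hx'
  · have hle : ∀ {x : ℝ}, x ≤ (2 * C₀ ^ 2 + 6) * β →
        ENNReal.ofReal (4 * ((1 - Real.sin d)⁻¹) ^ 2 * x) ≤
          ENNReal.ofReal (4 * ((1 - Real.sin d)⁻¹) ^ 2) * (ENNReal.ofReal (2 * C₀ ^ 2 + 6) *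
            (nTwoSq d F + nTwoSq d F' + ENNReal.ofReal β)) := by
      intro x hx
      rw [ENNReal.ofReal_mul (by positivity)]
      gcongr
      refine (ENNReal.ofReal_le_ofReal hx).trans ?_
      rw [ENNReal.ofReal_mul hM0]
      gcongr
      exact le_add_self
    refine (hgoal W).trans (add_ofReal_mul_le hc4 hM0 (T := 4 * ((1 - Real.sin d)⁻¹) ^ 2)
      ?_ ?_ ?_)
    · unfold angleConst
      gcongr
      linarith
    · exact (lintegral_resolvent_sub_starProjection_le_const hd (fun j => (hm j).le) hν hν1 hC
        W).trans (hle hx)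
    · exact (lintegral_resolvent_sub_starProjection_le_const hd (fun j => (hm j).le) hν hν1 hC'
        W).trans (hle hx')
  · rw [hG]
    exact DiscreteSpace.IsLaplaceSolution.eq_resolvent e hm hp hB hA (hs τ) hw

end Main

end LaplaceRB

end

theorem lemma4p5 :
    ∃ C : ℝ → ℝ → ℝ,
      (∀ d ∈ Ioo 0 (Real.pi / 2), ∀ α : ℝ, 1 ≤ α → 0 < C d α) ∧
      (∀ α : ℝ, 1 ≤ α → Tendsto (fun d => C d α) (𝓝[<] (Real.pi / 2)) atTop) ∧
      ∀ (n : ℕ), (n = 2 ∨ n = 3) →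
      ∀ (Ω : Set (LaplaceRB.RSpace n)), IsOpen Ω → Bornology.IsBounded Ω →
      ∀ (κ : ℝ), (κ = 0 ∨ κ = 1) → ∀ (C₀ : ℝ),
      ∃ c : ℝ, 0 < c ∧
        ∀ d ∈ Ioo 0 (Real.pi / 2), ∀ α : ℝ, 1 ≤ α →
        ∀ (V : Type) [NormedAddCommGroup V] [InnerProductSpace ℂ V] [FiniteDimensional ℂ V]
          (S : LaplaceRB.DiscreteSpace κ Ω V)
          (f f' : ℝ → LaplaceRB.AntiDual V) (F F' : ℂ → LaplaceRB.AntiDual V)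
          (f₀ : LaplaceRB.H1 Ω) (u₀ : LaplaceRB.H2 Ω)
          (u₀h Pf₀ PΔu₀ Pu₀ : V) (u u' : ℝ → V),
          LaplaceRB.DiscreteSpace.IsH1Proj S u₀.toH1 u₀h →
          LaplaceRB.DiscreteSpace.IsL2Proj S f₀.val Pf₀ →
          LaplaceRB.DiscreteSpace.IsL2Proj S u₀.laplacian PΔu₀ →
          LaplaceRB.DiscreteSpace.IsL2Proj S u₀.val Pu₀ →
          LaplaceRB.Admissible S α d C₀ f f' F F' f₀ →
          LaplaceRB.DiscreteSpace.IsSolution S f u₀h u u' →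
          (∀ R : ℕ, 1 ≤ R →
            LaplaceRB.bestGoal S α u u' R ≤
              ENNReal.ofReal (c * (C d α * LaplaceRB.rate d R)) *
                (LaplaceRB.nTwoSq d F + LaplaceRB.nTwoSq d F' +
                  ENNReal.ofReal (1 + ‖Pf₀‖ ^ 2 + ‖PΔu₀‖ ^ 2 + ‖u₀h - Pu₀‖ ^ 2 + u₀.normSq))) ∧
          (∀ K : ℕ, 1 ≤ K → ∀ w : ℤ → V,
            (∀ k : ℤ, |k| ≤ (K : ℤ) →
              LaplaceRB.DiscreteSpace.IsLaplaceSolution S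
                (α + Complex.I * LaplaceRB.sincPoint d K k)
                (F (LaplaceRB.sincPoint d K k) + LaplaceRB.DiscreteSpace.toDual S u₀h) (w k)) →
            LaplaceRB.goal S α u u'
                (Submodule.span ℂ ({u₀h} ∪ w '' {k : ℤ | |k| ≤ (K : ℤ)})) ≤
              ENNReal.ofReal (c * (C d α * LaplaceRB.rate d (2 * K + 2))) *
                (LaplaceRB.nTwoSq d F + LaplaceRB.nTwoSq d F' +
                  ENNReal.ofReal (1 + ‖Pf₀‖ ^ 2 + ‖PΔu₀‖ ^ 2 + ‖u₀h - Pu₀‖ ^ 2 + u₀.normSq))) := by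
  refine ⟨fun d _ => LaplaceRB.angleConst d, fun d hd _ _ => LaplaceRB.angleConst_pos hd,
    fun _ _ => LaplaceRB.tendsto_angleConst, ?_⟩
  intro n hn Ω hΩ hb κ hκ C₀
  obtain ⟨c, hc0, hc⟩ := LaplaceRB.DiscreteSpace.exists_norm_emb_fst_le hn hb hκ
  -- The factor e⁴ pays for passing from K to R, and 1 + c⁴ for the two terms of `goal`.
  refine ⟨Real.exp 4 * ((1 + c ^ 4) * (2 * C₀ ^ 2 + 6)), by positivity, ?_⟩
  intro d hd α hα V _ _ _ S f f' F F' f₀ u₀ u₀h Pf₀ PΔu₀ Pu₀ u u' hu₀h hPf hPΔ hPu hadm hsol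
  obtain ⟨hnodes, htriv, hunique⟩ := LaplaceRB.goal_bounds hΩ hκ hd hα S (hc V S) hu₀h hPf hPΔ hPu
    hadm hsol
  have hang := (LaplaceRB.angleConst_pos hd).le
  have hrate : ∀ {x : ℝ} {R : ℕ}, x ≤ Real.exp 4 * LaplaceRB.rate d R →
      ENNReal.ofReal ((1 + c ^ 4) * (2 * C₀ ^ 2 + 6) * (LaplaceRB.angleConst d * x)) ≤
        ENNReal.ofReal (Real.exp 4 * ((1 + c ^ 4) * (2 * C₀ ^ 2 + 6)) *
          (LaplaceRB.angleConst d * LaplaceRB.rate d R)) := by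
    intro x R hx
    refine ENNReal.ofReal_le_ofReal ?_
    calc _ ≤ (1 + c ^ 4) * (2 * C₀ ^ 2 + 6) *
          (LaplaceRB.angleConst d * (Real.exp 4 * LaplaceRB.rate d R)) := by gcongr
      _ = _ := by ring
  refine ⟨fun R hR => ?_, fun K hK w hw => ?_⟩
  -- For R ≤ 3 there is no room for 2K + 2 vectors with K ≥ 1. The zero space suffices, since the
  -- rate is then bounded below by e⁻⁴.
  · rcases le_or_gt R 3 with h3 | h3
    · refine (iInf₂_le (⊥ : Submodule ℂ V) (by simp)).trans ((htriv ⊥).trans ?_)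
      gcongr ?_ * _
      have h1 := hrate (LaplaceRB.one_le_rate hd hR h3)
      rwa [mul_one] at h1
    -- Rounding down gives 2K + 2 ≤ R ≤ 2K + 3.
    · set K := (R - 2) / 2 with hK
      have hK1 : 1 ≤ K := by omega
      refine (iInf₂_le (Submodule.span ℂ ({u₀h} ∪ (fun k : ℤ => LaplaceRB.laplace u
        (α + Complex.I * LaplaceRB.sincPoint d K k)) '' {k : ℤ | |k| ≤ (K : ℤ)}))
        ((LaplaceRB.finrank_span_nodes_le u₀h _ K).trans (by omega))).trans ?_
      refine (hnodes K hK1 _ (Submodule.subset_span (Or.inl rfl)) fun k hk =>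
        Submodule.subset_span (Or.inr ⟨k, hk, rfl⟩)).trans ?_
      gcongr ?_ * _
      exact hrate (LaplaceRB.sqrt_mul_exp_le_rate hd (by omega) (by omega))
  · refine (hnodes K hK _ (Submodule.subset_span (Or.inl rfl)) fun k hk => ?_).trans ?_
    · rw [← hunique _ _ (hw k hk)]
      exact Submodule.subset_span (Or.inr ⟨k, hk, rfl⟩)
    · gcongr ?_ * _
      exact hrate (LaplaceRB.sqrt_mul_exp_le_rate hd (by omega) (by omega))
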